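/- Let $K,M,N,Q,s,V$ be positive integers with $N\le M$, $s\le K$, $s\le Q$, let $c_m,c_s,c_r>0$, and consider the following MapReduce framework. There are $K$ nodes, $N$ input files $\omega_1,\dots,\omega_N$ and $Q$ output functions $\phi_q(\omega_1,\dots,\omega_N)=h_q(v_{q,1},\dots,v_{q,N})$, where $v_{q,n}=g_{q,n}(\omega_n)$ is a $V$-bit intermediate value. In a scheme, node $k$ maps the files in a set $\mathcal M_k$, i.e. learns $v_{1,n},\dots,v_{Q,n}$ for $n\in\mathcal M_k$, where $\bigcup_k\mathcal M_k=\{1,\dots,N\}$ and $\sum_k|\mathcal M_k|\le M$. It then multicasts to all nodes $\ell_k$ bits that are a function of these values, and finally computes the outputs $\phi_q$, $q\in\mathcal W_k$, from its own intermediate values and all the messages. The scheme has to work for all Map and Reduce functions $g_{q,n}$, $h_q$ (with files and outputs of any bit length) and all files. The Reduce assignment is weakly symmetric: for some set $\mathcal K_s$ of nodes with $|\mathcal K_s|\ge s$, the $Q$ functions are split into $\binom{|\mathcal K_s|}{s}$ batches of equal integer size, one for each $s$-subset $\mathcal P$ of $\mathcal K_s$, and the functions in the batch of $\mathcal P$ are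 computed by exactly the nodes in $\mathcal P$. The execution time of the scheme is $$c_m\,\frac{\max_k|\mathcal M_k|}{N}+c_s\,\frac{\sum_k \ell_k}{NQV}+c_r\max_k|\mathcal W_k| ,$$ and $T^*_{\mathcal W}(s)$ is the minimum execution time over all schemes, including the choice of $\mathcal K_s$, for the given $K,M,N,Q,s,V,c_m,c_s,c_r$. For integers $K_s\ge s$ and $0\le r\le K_s$ let $$L_1(r,s,K_s)=\sum_{\ell=\max\{r+1,s\}}^{\min\{r+s,K_s\}}\frac{\binom{K_s}{\ell}\binom{\ell-1}{r}\binom{r}{\ell-s}}{\binom{K_s}{r}\binom{K_s}{s}}\,\frac{\ell}{\ell-1}\quad(r\ge1),\qquad L_2(r,s,K_s)=\sum_{\ell=\max\{r+1,s\}}^{\min\{r+s,K_s\}}\frac{\binom{K_s}{\ell}\binom{\ell-1}{r}\binom{r}{\ell-s}}{\binom{K_s}{r}\binom{K_s}{s}},$$ and let $L_1^*(\cdot,s,K_s)$ on $[1,K_s]$ and $L_2^*(\cdot,s,K_s)$ on $[0,K_s]$ be the lower convex envelopes of the points $(r,L_1(r,s,K_s))$, $1\le r\le K_s$, and $(r,L_2(r,s,K_s))$,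 $0\le r\le K_s$, respectively. With $\bar\alpha=1-\alpha$, define $$\tau=\min_{(\alpha,r_1,r_2,K_s,K_h)}\; c_m\max\Big\{\frac{\alpha r_1+\bar\alpha r_2}{K_s},\frac{\bar\alpha}{K_h}\Big\}+\alpha c_sL_1^*(r_1,s,K_s)+\bar\alpha c_sL_2^*(r_2,s,K_s)+c_r\frac{sQ}{K_s}$$ over all real $\alpha\in[0,1]$, $r_1\in[1,K_s]$, $r_2\in[0,K_s]$ and integers $K_s,K_h\ge0$ such that $K_s+K_h\le K$, $\max\{1,s\}\le K_s\le Q$, $\binom{K_s}{s}$ divides $Q$, and $\alpha r_1+\bar\alpha(r_2+1)\le M/N$; if $K_h=0$, then $\alpha=1$ is required and $\bar\alpha/K_h$ is read as $0$. This minimum is attained, and it depends on $M,N$ only through $M/N$. Theorem 1. The minimum $T^*_{\mathcal W}(s)$ exists and $T^*_{\mathcal W}(s)\ge\tau$ for all parameters as above. Moreover, there is a positive integer $D$ depending only on $K$ such that, whenever $D$ divides $V$, the following hold. 1. There is a positive integer $t_0$, not depending on $V$, such that for every positive multiple $t$ of $t_0$ the minimum execution time with $tN$ files and total storage $tM$ (the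 other parameters unchanged) is exactly $\tau$. 2. For every $N$ and $M\ge N$, $\tau\le T^*_{\mathcal W}(s)\le\tau+D(c_m+c_s)/N$. 3. For every $N$ and $M\ge N$: if $(\alpha,r_1,r_2,K_s,K_h)$ is feasible, $r_1,r_2$ are integers, and $\alpha N$ and $\bar\alpha N$ are nonnegative integer multiples of $\binom{K_s}{r_1}$ and of $K_h\binom{K_s}{r_2}$, respectively, then some scheme has execution time equal to the value of the objective at this point; hence, if the minimum $\tau$ is attained at such a point, then $T^*_{\mathcal W}(s)=\tau$ exactly. -/

import Mathlib

open Finset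

/-- Strings of `n` bits, playing the role of the set `𝔽_{2^n}`. -/
abbrev Bits (n : ℕ) : Type := Fin n → Bool

/-- A MapReduce task with `N` input files of `F` bits, `Q` output functions of `B` bits and
intermediate values of `V` bits. -/
structure MRTask (N Q V : ℕ) where
  F : ℕ
  B : ℕ
  /-- The Map functions `g_{q,n}`. -/
  mapFn : Fin Q → Fin N → Bits F → Bits V
  /-- The Reduce functions `h_q`. -/
  reduceFn : Fin Q → (Fin N → Bits V) → Bits B

namespace MRTask

variable {N Q V : ℕ}

/-- The intermediate value `v_{q,n} = g_{q,n}(ω_n)`. -/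
def interVal (T : MRTask N Q V) (ω : Fin N → Bits T.F) (q : Fin Q) (n : Fin N) : Bits V :=
  T.mapFn q n (ω n)

/-- The output value `u_q = φ_q(ω_1, …, ω_N) = h_q(v_{q,1}, …, v_{q,N})`. -/
def output (T : MRTask N Q V) (ω : Fin N → Bits T.F) (q : Fin Q) : Bits T.B :=
  T.reduceFn q (T.interVal ω q)

end MRTask

/-- The intermediate values `v_{1,n}, …, v_{Q,n}`, `n ∈ A`, known to a node that maps the files
in `A`. -/
abbrev LocalVals (N Q V : ℕ) (A : Finset (Fin N)) : Type := Fin Q → {n // n ∈ A} → Bits V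

/-- Restriction of all intermediate values to the files in `A`. -/
def restrictVals {N Q V : ℕ} (A : Finset (Fin N)) (v : Fin Q → Fin N → Bits V) :
    LocalVals N Q V A :=
  fun q n => v q n

/-- A Map–Shuffle–Reduce scheme for `K` nodes with total storage `M`, `N` files, `Q` Reduce
functions and `V`-bit intermediate values, whose Reduce design is weakly symmetric with
parameter `s`. Its operation does not depend on the particular Map and Reduce functions. -/
structure Scheme (K M N Q s V : ℕ) where
  /-- The set `𝓜_k` of files mapped by node `k`. -/
  mapped : Fin K → Finset (Fin N)
  mapped_cover : ∀ n, ∃ k, n ∈ mapped k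
  storage : ∑ k, (mapped k).card ≤ M
  /-- The set `𝓚_s` of nodes that produce Reduce functions. -/
  solvers : Finset (Fin K)
  /-- The set of `s` solvers that produce the Reduce function `q`; so the batch `𝓓_P` is the
  fibre of this map over `P`. -/
  assigned : Fin Q → Finset (Fin K)
  assigned_mem : ∀ q, assigned q ∈ solvers.powersetCard s
  /-- All batches have size `Q / binom(|𝓚_s|, s)`; in particular this number is an integer. -/
  balanced : ∀ P ∈ solvers.powersetCard s,
    (univ.filter fun q => assigned q = P).card * solvers.card.choose s = Q
  /-- The number of bits multicast by node `k`. -/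
  len : Fin K → ℕ
  /-- The encoding function `ψ_k`. -/
  encode : ∀ k, LocalVals N Q V (mapped k) → Bits (len k)
  /-- For every task, each node computes each of its output values from its own intermediate
  values and the multicast messages. -/
  correct : ∀ T : MRTask N Q V,
    ∃ produce : ∀ k : Fin K, Fin Q → LocalVals N Q V (mapped k) → (∀ j, Bits (len j)) → Bits T.B,
      ∀ (ω : Fin N → Bits T.F) (k : Fin K) (q : Fin Q), k ∈ assigned q →
        produce k q (restrictVals (mapped k) (T.interVal ω))
          (fun j => encode j (restrictVals (mapped j) (T.interVal ω))) = T.output ω q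

namespace Scheme

variable {K M N Q s V : ℕ}

/-- The set `𝓦_k` of Reduce functions produced by node `k`. -/
def reduceSet (S : Scheme K M N Q s V) (k : Fin K) : Finset (Fin Q) :=
  univ.filter fun q => k ∈ S.assigned q

/-- The peak computation load `p = max_k |𝓜_k| / N`. -/
noncomputable def peakLoad (S : Scheme K M N Q s V) : ℝ :=
  ((univ.sup fun k => (S.mapped k).card : ℕ) : ℝ) / N

/-- The communication load `L = (∑_k ℓ_k) / (N Q V)`. -/
noncomputable def commLoad (S : Scheme K M N Q s V) : ℝ :=
  ((∑ k, S.len k : ℕ) : ℝ) / (N * Q * V)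

/-- The execution time `T_map + T_shuffle + T_reduce`. -/
noncomputable def time (S : Scheme K M N Q s V) (cm cs cr : ℝ) : ℝ :=
  cm * S.peakLoad + cs * S.commLoad + cr * ((univ.sup fun k => (S.reduceSet k).card : ℕ) : ℝ)

end Scheme

/-- The set of all achievable execution times. -/
def executionTimes (K M N Q s V : ℕ) (cm cs cr : ℝ) : Set ℝ :=
  {t | ∃ S : Scheme K M N Q s V, S.time cm cs cr = t}

/-- The communication load `L₁(r, s, K)` of coded distributed computing; used for `r ≥ 1` only,
so that `ℓ ≥ 2` below. -/
noncomputable def loadCDC (r s K : ℕ) : ℝ :=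
  ∑ l ∈ Icc (max (r + 1) s) (min (r + s) K),
    ((K.choose l : ℝ) * ((l - 1).choose r : ℝ) * (r.choose (l - s) : ℝ)) /
      ((K.choose r : ℝ) * (K.choose s : ℝ)) * ((l : ℝ) / ((l : ℝ) - 1))

/-- The communication load `L₂(r, s, K)` of generalized asymmetric coded distributed computing. -/
noncomputable def loadACDC (r s K : ℕ) : ℝ :=
  ∑ l ∈ Icc (max (r + 1) s) (min (r + s) K),
    ((K.choose l : ℝ) * ((l - 1).choose r : ℝ) * (r.choose (l - s) : ℝ)) /
      ((K.choose r : ℝ) * (K.choose s : ℝ))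

/-- The lower convex envelope at `x` of a set of points of the plane. -/
noncomputable def lowerConvexEnvelope (A : Set (ℝ × ℝ)) (x : ℝ) : ℝ :=
  sInf {y | (x, y) ∈ convexHull ℝ A}

/-- `L₁*(·, s, K)` on `[1, K]`: the envelope of the points `(r, L₁(r, s, K))`, `1 ≤ r ≤ K`. -/
noncomputable def loadCDCEnv (x : ℝ) (s K : ℕ) : ℝ :=
  lowerConvexEnvelope {p | ∃ r ∈ Set.Icc 1 K, p = ((r : ℝ), loadCDC r s K)} x

/-- `L₂*(·, s, K)` on `[0, K]`: the envelope of the points `(r, L₂(r, s, K))`, `0 ≤ r ≤ K`. -/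
noncomputable def loadACDCEnv (x : ℝ) (s K : ℕ) : ℝ :=
  lowerConvexEnvelope {p | ∃ r ∈ Set.Icc 0 K, p = ((r : ℝ), loadACDC r s K)} x

/-- The variables `(α, r₁, r₂, K_s, K_h)` of the resource allocation problem. -/
structure Allocation where
  α : ℝ
  r₁ : ℝ
  r₂ : ℝ
  Ks : ℕ
  Kh : ℕ

namespace Allocation

/-- The constraints of the resource allocation problem. Without helper nodes, all files have to
belong to the part without helpers. -/
structure Feasible (a : Allocation) (K M N Q s : ℕ) : Prop where
  servers : a.Ks + a.Kh ≤ K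
  one_le_Ks : 1 ≤ a.Ks
  Ks_le : a.Ks ≤ Q
  s_le : s ≤ a.Ks
  batches : a.Ks.choose s ∣ Q
  storage : a.α * a.r₁ + (1 - a.α) * (a.r₂ + 1) ≤ (M : ℝ) / N
  α_mem : a.α ∈ Set.Icc (0 : ℝ) 1
  r₁_mem : a.r₁ ∈ Set.Icc (1 : ℝ) a.Ks
  r₂_mem : a.r₂ ∈ Set.Icc (0 : ℝ) a.Ks
  no_helper : a.Kh = 0 → a.α = 1

/-- The objective of the resource allocation problem. -/
noncomputable def time (a : Allocation) (Q s : ℕ) (cm cs cr : ℝ) : ℝ :=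
  cm * max ((a.α * a.r₁ + (1 - a.α) * a.r₂) / a.Ks) ((1 - a.α) / a.Kh)
    + a.α * cs * loadCDCEnv a.r₁ s a.Ks
    + (1 - a.α) * cs * loadACDCEnv a.r₂ s a.Ks
    + cr * ((s : ℝ) * Q / a.Ks)

/-- `r₁`, `r₂` are integers, and the `αN` and `(1-α)N` files of the two parts can be split evenly
into `binom(K_s, r₁)` and `K_h · binom(K_s, r₂)` batches, respectively. -/
def Integral (a : Allocation) (N : ℕ) : Prop :=
  ∃ r₁ r₂ b₁ b₂ : ℕ, a.r₁ = r₁ ∧ a.r₂ = r₂ ∧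
    a.α * N = b₁ * (a.Ks.choose r₁ : ℝ) ∧ (1 - a.α) * N = b₂ * ((a.Kh : ℝ) * a.Ks.choose r₂)

end Allocation

/-- The values of the resource allocation problem at all feasible points. -/
def allocationTimes (K M N Q s : ℕ) (cm cs cr : ℝ) : Set ℝ :=
  {t | ∃ a : Allocation, a.Feasible K M N Q s ∧ a.time Q s cm cs cr = t}

/-!
A scheme is compared with the *mixture* of its file types, where the type of a file records the
number of solvers (nodes that compute Reduce functions) that map it and whether some other node, a
helper, maps it too. Both bounds on the execution time are phrased in terms of mixtures, and the
resource allocation problem is the linear program over mixtures, written with envelopes.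

*Lower bound.* Correctness for the task whose Reduce functions return all of their inputs forces
every node to recover the intermediate values that it needs. Merge all helpers into one node that
wants nothing. If all intermediate values are independent and uniform, then the messages solve an
index coding problem, and `index_coding_bound` says that a value known by the nodes in `R` and
wanted by the nodes in `P` costs at least `(|P ∪ R| - |R|) / (|P ∪ R| - 1)` transmissions. This
follows from submodularity of entropy by removing one node at a time and averaging over the removed
node. Since the Reduce assignment is symmetric, the average of this cost over all `s`-sets `P` of
solvers depends only on the type of the file, and it equals `L₁(r, s, K_s)` without a helper and
`L₂(r, s, K_s)` with one (`sum_powersetCard_cdc`, `sum_powersetCard_acdc`). This is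
`Scheme.load_lower_bound`, and with the bounds on the peak load it gives `Scheme.exists_mixture`.

*Upper bound.* Conversely, let the files of each type be spread evenly over the sets of solvers of
the right size and over the helpers. The values that involve a group `U` of solvers are delivered
with Vandermonde parity symbols over a field with `2 ^ (K + 1)` elements: by the helper, if there is
one (`Deliverable.helper_group`), and otherwise by all nodes of `U`, each of them serving one of the
`r` segments into which the values are cut (`Deliverable.cdc_group`). The divisibility condition on
`V` makes these symbols fit. Every value then costs exactly what the lower bound asks for
(`exists_coded_scheme`).

*Optimization.* The functions `L₁` and `L₂` are convex in `r`, hence agree with their envelopes at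
integers (`loadCDCEnv_natCast`, `loadACDCEnv_natCast`). Allocations and mixtures have the same
minimal time `τ`, which exists by compactness. The constraints on mixtures are rational, and the
costs are linear apart from one maximum of two rational functionals; thus there is an optimal
mixture with rational fractions even if the coefficients `c_m`, `c_s` are real
(`exists_rational_minimizer_max`). If the number of files is divisible enough, then the optimal
mixture is realized exactly. Otherwise its fractions are rounded down, and the boundedly many
leftover files are stored once and sent uncoded, which costs at most `(c_m + c_s) / N` for each of
them.
-/

/-! ### Entropy of partitions of a finite probability space -/

open Classical in
/-- The number of elements of the class of `ω` under `σ`. -/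
noncomputable def classCard {Ω : Type*} [Fintype Ω] (σ : Setoid Ω) (ω : Ω) : ℕ :=
  (univ.filter fun ω' => σ ω ω').card

/-- The Shannon entropy, in bits, of the class of a uniformly distributed element of `Ω`. Random
variables enter only through the partitions they induce, so that `σ ⊓ τ` is the joint variable
and `σ ≤ τ` says that `τ` is a function of `σ`. -/
noncomputable def entropy {Ω : Type*} [Fintype Ω] (σ : Setoid Ω) : ℝ :=
  (∑ ω, Real.logb 2 (Fintype.card Ω / classCard σ ω)) / Fintype.card Ω

section Entropy

variable {Ω : Type*} [Fintype Ω]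

lemma classCard_pos (σ : Setoid Ω) (ω : Ω) : 0 < classCard σ ω := by
  classical
  exact card_pos.2 ⟨ω, by simp⟩

lemma classCard_congr {σ : Setoid Ω} {ω ω' : Ω} (h : σ ω ω') : classCard σ ω = classCard σ ω' := by
  classical
  unfold classCard
  congr 1
  ext x
  simp only [mem_filter, mem_univ, true_and]
  exact ⟨fun hx => σ.trans (σ.symm h) hx, fun hx => σ.trans h hx⟩

lemma classCard_mono {σ τ : Setoid Ω} (h : σ ≤ τ) (ω : Ω) : classCard σ ω ≤ classCard τ ω := by
  classical
  exact card_le_card fun x hx => by simp only [mem_filter, mem_univ, true_and] at hx ⊢; exact h hx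

lemma entropy_anti {σ τ : Setoid Ω} (h : σ ≤ τ) : entropy τ ≤ entropy σ := by
  unfold entropy
  gcongr with ω _
  · norm_num
  · have := classCard_pos τ ω
    have : 0 < Fintype.card Ω := Fintype.card_pos_iff.2 ⟨ω⟩
    positivity
  · exact_mod_cast classCard_pos σ ω
  · exact classCard_mono h ω

lemma entropy_top [Nonempty Ω] : entropy (⊤ : Setoid Ω) = 0 := by
  have h (ω : Ω) : classCard (⊤ : Setoid Ω) ω = Fintype.card Ω := by
    classical
    simp [classCard, Setoid.top_def]
  simp [entropy, h]

lemma sum_ratio_le (a b c : Setoid Ω) :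
    ∑ ω, ((classCard (a ⊓ c) ω : ℝ) * classCard (b ⊓ c) ω) /
      (classCard (a ⊓ b ⊓ c) ω * classCard c ω) ≤ Fintype.card Ω := by
  classical
  have hpos (σ : Setoid Ω) (ω : Ω) : (0 : ℝ) < classCard σ ω := by exact_mod_cast classCard_pos σ ω
  calc ∑ ω, ((classCard (a ⊓ c) ω : ℝ) * classCard (b ⊓ c) ω) /
        (classCard (a ⊓ b ⊓ c) ω * classCard c ω)
      = ∑ ω, ∑ x, ∑ y, if (a ⊓ c) ω x ∧ (b ⊓ c) ω y then
          ((classCard (a ⊓ b ⊓ c) ω : ℝ) * classCard c ω)⁻¹ else 0 := by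
        refine sum_congr rfl fun ω _ => ?_
        rw [← sum_product', ← sum_filter, sum_const, nsmul_eq_mul, div_eq_mul_inv]
        congr 1
        rw [classCard, classCard, ← Nat.cast_mul, ← card_product, ← filter_product]
    _ = ∑ x, ∑ y, ∑ ω, if (a ⊓ c) ω x ∧ (b ⊓ c) ω y then
          ((classCard (a ⊓ b ⊓ c) ω : ℝ) * classCard c ω)⁻¹ else 0 := by
        rw [sum_comm]
        exact sum_congr rfl fun x _ => sum_comm
    _ ≤ ∑ x, ∑ y, if c x y then (classCard c x : ℝ)⁻¹ else 0 := by
        refine sum_le_sum fun x _ => sum_le_sum fun y _ => ?_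
        by_cases h : ∃ z, (a ⊓ c) z x ∧ (b ⊓ c) z y
        · obtain ⟨z, hzx, hzy⟩ := h
          have hxy : c x y := c.trans (c.symm hzx.2) hzy.2
          -- the classes of `x` and `y` meet in the class of `z`
          have key (ω : Ω) : (if (a ⊓ c) ω x ∧ (b ⊓ c) ω y then
              ((classCard (a ⊓ b ⊓ c) ω : ℝ) * classCard c ω)⁻¹ else 0) =
              if (a ⊓ b ⊓ c) z ω then ((classCard (a ⊓ b ⊓ c) z : ℝ) * classCard c x)⁻¹ else 0 := by
            have hiff : ((a ⊓ c) ω x ∧ (b ⊓ c) ω y) ↔ (a ⊓ b ⊓ c) z ω := by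
              constructor
              · rintro ⟨h1, h2⟩
                exact ⟨⟨a.trans hzx.1 (a.symm h1.1), b.trans hzy.1 (b.symm h2.1)⟩,
                  c.trans hzx.2 (c.symm h1.2)⟩
              · rintro ⟨⟨h1, h2⟩, h3⟩
                exact ⟨⟨a.trans (a.symm h1) hzx.1, c.trans (c.symm h3) hzx.2⟩,
                  ⟨b.trans (b.symm h2) hzy.1, c.trans (c.symm h3) hzy.2⟩⟩
            by_cases hω : (a ⊓ b ⊓ c) z ω
            · rw [if_pos (hiff.2 hω), if_pos hω, classCard_congr hω,
                classCard_congr (c.trans (c.symm hω.2) hzx.2)]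
            · rw [if_neg (mt hiff.1 hω), if_neg hω]
          rw [sum_congr rfl fun ω _ => key ω, ← sum_filter, sum_const, nsmul_eq_mul, if_pos hxy]
          change (classCard (a ⊓ b ⊓ c) z : ℝ) * _ ≤ _
          have h1 := hpos (a ⊓ b ⊓ c) z
          have h2 := hpos c x
          apply le_of_eq
          field_simp
        · push Not at h
          rw [sum_eq_zero]
          · split_ifs
            · exact (inv_pos.2 (hpos c x)).le
            · rfl
          · intro ω _
            exact if_neg fun hω => h ω hω.1 hω.2
    _ = Fintype.card Ω := by
        have (x : Ω) : (∑ y, if c x y then (classCard c x : ℝ)⁻¹ else 0) = 1 := by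
          rw [← sum_filter, sum_const, nsmul_eq_mul]
          exact mul_inv_cancel₀ (hpos c x).ne'
        simp [this]

lemma sum_logb_nonpos {f : Ω → ℝ} (hf : ∀ ω, 0 < f ω) (hs : ∑ ω, f ω ≤ Fintype.card Ω) :
    ∑ ω, Real.logb 2 (f ω) ≤ 0 := by
  have h : ∑ ω, Real.log (f ω) ≤ 0 := by
    calc ∑ ω, Real.log (f ω) ≤ ∑ ω, (f ω - 1) :=
          sum_le_sum fun ω _ => Real.log_le_sub_one_of_pos (hf ω)
      _ ≤ 0 := by simp; linarith
  simp only [Real.logb, ← sum_div]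
  exact div_nonpos_of_nonpos_of_nonneg h (Real.log_nonneg (by norm_num))

/-- Nonnegativity of conditional mutual information. -/
lemma entropy_submodular (a b c : Setoid Ω) :
    entropy (a ⊓ b ⊓ c) + entropy c ≤ entropy (a ⊓ c) + entropy (b ⊓ c) := by
  have hpos (σ : Setoid Ω) (ω : Ω) : (0 : ℝ) < classCard σ ω := by exact_mod_cast classCard_pos σ ω
  have h := sum_logb_nonpos (f := fun ω => ((classCard (a ⊓ c) ω : ℝ) * classCard (b ⊓ c) ω) /
      (classCard (a ⊓ b ⊓ c) ω * classCard c ω))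
    (fun ω => div_pos (mul_pos (hpos _ _) (hpos _ _)) (mul_pos (hpos _ _) (hpos _ _)))
    (sum_ratio_le a b c)
  have h2 : ∑ ω, Real.logb 2 (((classCard (a ⊓ c) ω : ℝ) * classCard (b ⊓ c) ω) /
      (classCard (a ⊓ b ⊓ c) ω * classCard c ω)) =
      ∑ ω, Real.logb 2 (Fintype.card Ω / classCard (a ⊓ b ⊓ c) ω) +
      ∑ ω, Real.logb 2 (Fintype.card Ω / classCard c ω) -
      ∑ ω, Real.logb 2 (Fintype.card Ω / classCard (a ⊓ c) ω) -
      ∑ ω, Real.logb 2 (Fintype.card Ω / classCard (b ⊓ c) ω) := by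
    rw [← sum_add_distrib, ← sum_sub_distrib, ← sum_sub_distrib]
    refine sum_congr rfl fun ω _ => ?_
    have hn : (Fintype.card Ω : ℝ) ≠ 0 := by
      exact_mod_cast (Fintype.card_pos_iff.2 ⟨ω⟩).ne'
    have e1 := (hpos (a ⊓ b ⊓ c) ω).ne'
    have e2 := (hpos c ω).ne'
    have e3 := (hpos (a ⊓ c) ω).ne'
    have e4 := (hpos (b ⊓ c) ω).ne'
    rw [Real.logb_div (mul_ne_zero e3 e4) (mul_ne_zero e1 e2), Real.logb_mul e3 e4,
      Real.logb_mul e1 e2, Real.logb_div hn e1, Real.logb_div hn e2, Real.logb_div hn e3,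
      Real.logb_div hn e4]
    ring
  rw [h2] at h
  unfold entropy
  rw [← add_div, ← add_div]
  exact div_le_div_of_nonneg_right (by linarith) (Nat.cast_nonneg _)

lemma entropy_inf_le_sum {ι : Type*} (S : Finset ι) (a : ι → Setoid Ω) (c : Setoid Ω) :
    entropy (S.inf a ⊓ c) - entropy c ≤ ∑ k ∈ S, (entropy (a k ⊓ c) - entropy c) := by
  classical
  induction S using Finset.induction_on with
  | empty => simp
  | insert k S hk ih =>
    rw [inf_insert, sum_insert hk]
    have := entropy_submodular (a k) (S.inf a) c
    linarith

lemma entropy_ker_le {β : Type*} [Fintype β] [Nonempty Ω] (X : Ω → β) :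
    entropy (Setoid.ker X) ≤ Real.logb 2 (Fintype.card β) := by
  classical
  have hpos (ω : Ω) : (0 : ℝ) < classCard (Setoid.ker X) ω := by
    exact_mod_cast classCard_pos _ ω
  have hn : (0 : ℝ) < Fintype.card Ω := by exact_mod_cast Fintype.card_pos
  have hβ : (0 : ℝ) < Fintype.card β := by
    exact_mod_cast Fintype.card_pos_iff.2 ⟨X (Classical.arbitrary Ω)⟩
  have h1 : ∑ ω, (classCard (Setoid.ker X) ω : ℝ)⁻¹ ≤ Fintype.card β := by
    rw [← sum_fiberwise univ X]
    calc ∑ b, ∑ ω with X ω = b, (classCard (Setoid.ker X) ω : ℝ)⁻¹ ≤ ∑ b : β, (1 : ℝ) := by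
          refine sum_le_sum fun b _ => ?_
          have : ∀ ω ∈ univ.filter (fun ω => X ω = b), (classCard (Setoid.ker X) ω : ℝ)⁻¹ =
              ((univ.filter (fun ω => X ω = b)).card : ℝ)⁻¹ := by
            intro ω hω
            simp only [mem_filter, mem_univ, true_and] at hω
            subst hω
            simp [classCard, Setoid.ker_def, eq_comm]
          rw [sum_congr rfl this, sum_const, nsmul_eq_mul]
          exact mul_inv_le_one
      _ = Fintype.card β := by simp
  have h := sum_logb_nonpos
    (f := fun ω => (Fintype.card Ω / classCard (Setoid.ker X) ω) / (Fintype.card β : ℝ))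
    (fun ω => div_pos (div_pos hn (hpos ω)) hβ) (by
      simp only [div_eq_mul_inv, ← sum_mul, ← mul_sum]
      rw [mul_assoc]
      refine mul_le_of_le_one_right hn.le ?_
      rw [← div_eq_mul_inv]
      exact (div_le_one hβ).2 h1)
  have h2 (ω : Ω) : Real.logb 2 ((Fintype.card Ω / classCard (Setoid.ker X) ω) /
      (Fintype.card β : ℝ)) = Real.logb 2 (Fintype.card Ω / classCard (Setoid.ker X) ω) -
      Real.logb 2 (Fintype.card β) :=
    Real.logb_div (div_pos hn (hpos ω)).ne' hβ.ne'
  simp only [h2, sum_sub_distrib, sum_const, nsmul_eq_mul, card_univ] at h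
  unfold entropy
  rw [div_le_iff₀ hn]
  linarith

end Entropy

/-- The partition induced by the coordinates in `C`. -/
def coordSetoid {ι α : Type*} (C : Set ι) : Setoid (ι → α) where
  r v w := ∀ i ∈ C, v i = w i
  iseqv := ⟨fun _ _ _ => rfl, fun h i hi => (h i hi).symm,
    fun h h' i hi => (h i hi).trans (h' i hi)⟩

lemma coordSetoid_union {ι α : Type*} (C D : Set ι) :
    (coordSetoid (C ∪ D) : Setoid (ι → α)) = coordSetoid C ⊓ coordSetoid D := by
  ext v w
  constructor
  · exact fun h => ⟨fun i hi => h i (Or.inl hi), fun i hi => h i (Or.inr hi)⟩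
  · rintro ⟨h, h'⟩ i (hi | hi)
    exacts [h i hi, h' i hi]

lemma coordSetoid_anti {ι α : Type*} {C D : Set ι} (h : C ⊆ D) :
    (coordSetoid D : Setoid (ι → α)) ≤ coordSetoid C :=
  fun _ _ hv i hi => hv i (h hi)

lemma entropy_coordSetoid {ι α : Type*} [Fintype ι] [DecidableEq ι] [Fintype α] [Nonempty α]
    (C : Finset ι) :
    entropy (coordSetoid (C : Set ι) : Setoid (ι → α)) =
      C.card * Real.logb 2 (Fintype.card α) := by
  classical
  have hα : (0 : ℝ) < Fintype.card α := by exact_mod_cast Fintype.card_pos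
  have h (v : ι → α) : (Fintype.card (ι → α) : ℝ) / classCard (coordSetoid (C : Set ι)) v =
      (Fintype.card α : ℝ) ^ C.card := by
    have h1 : (univ.filter fun w => (coordSetoid (C : Set ι) : Setoid (ι → α)) v w) =
        Fintype.piFinset fun i => if i ∈ C then {v i} else univ := by
      ext w
      simp only [mem_filter, mem_univ, true_and, Fintype.mem_piFinset]
      constructor
      · intro hw i
        by_cases hi : i ∈ C
        · simp [hi, hw i hi]
        · simp [hi]
      · intro hw i hi
        have := hw i
        rw [if_pos (mem_coe.1 hi), mem_singleton] at this
        exact this.symm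
    have h2 : classCard (coordSetoid (C : Set ι) : Setoid (ι → α)) v =
        Fintype.card α ^ (univ \ C).card := by
      unfold classCard
      rw [h1, Fintype.card_piFinset, ← prod_sdiff (subset_univ C)]
      have h3 : ∏ i ∈ C, (if i ∈ C then ({v i} : Finset α) else univ).card = 1 :=
        prod_eq_one fun i hi => by simp [hi]
      rw [h3, mul_one, ← prod_const]
      refine prod_congr rfl fun i hi => ?_
      rw [if_neg (mem_sdiff.1 hi).2, card_univ]
    rw [h2, div_eq_iff (by positivity), Fintype.card_fun, Nat.cast_pow, Nat.cast_pow, ← pow_add,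
      add_comm, card_sdiff_add_card_eq_card (subset_univ C), card_univ]
  have hn : (Fintype.card (ι → α) : ℝ) ≠ 0 := by exact_mod_cast Fintype.card_ne_zero
  simp only [entropy, h, sum_const, nsmul_eq_mul, card_univ, Real.logb_pow]
  field_simp

/-! ### The index-coding converse -/

section IndexCoding

variable {I ι α : Type*} [DecidableEq I] [Fintype ι]

/-- The value of `(|P ∪ R| - |R|) / (|P ∪ R| - 1)`, the number of transmissions that a value known
by the nodes in `R` and wanted by the nodes in `P` costs. If `P ∪ R` is a single node, then this
node knows the value, and the quotient `0 / 0 = 0` is the right cost. -/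
noncomputable def unitCost (P R : Finset I) : ℝ :=
  (((P ∪ R).card : ℝ) - R.card) / ((P ∪ R).card - 1)

lemma unitCost_mul {P R : Finset I} (hR : R.Nonempty) :
    unitCost P R * ((P ∪ R).card - 1) = (P ∪ R).card - R.card := by
  unfold unitCost
  by_cases h : ((P ∪ R).card : ℝ) - 1 = 0
  · have h1 : (1 : ℝ) ≤ R.card := by exact_mod_cast hR.card_pos
    have h2 : (R.card : ℝ) ≤ (P ∪ R).card := by exact_mod_cast card_le_card subset_union_right
    rw [h, mul_zero]
    linarith
  · exact div_mul_cancel₀ _ h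

open Classical in
/-- The coordinates that are known to or wanted by some node outside `S`. -/
noncomputable def outerCoords (want know : ι → Finset I) (S : Finset I) : Finset ι :=
  univ.filter fun p => ¬ want p ∪ know p ⊆ S

/-- One node decodes what it wants, which exposes the new coordinates it wants and reduces the
problem to the remaining nodes. -/
lemma entropy_peel_node {I ι α : Type*} [Fintype I] [DecidableEq I] [Fintype ι] [DecidableEq ι]
    [Fintype α] [Nonempty α] (want know : ι → Finset I)
    (X : I → Setoid (ι → α))
    (hX : ∀ k, (coordSetoid {p | k ∈ know p} : Setoid (ι → α)) ≤ X k)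
    (hdec : ∀ k, (coordSetoid {p | k ∈ know p} : Setoid (ι → α)) ⊓ univ.inf X ≤
      coordSetoid {p | k ∈ want p}) (S : Finset I) {k : I} (hk : k ∈ S) :
    ((univ.filter fun p => want p ∪ know p ⊆ S ∧ k ∈ want p ∧ k ∉ know p).card : ℝ) *
        Real.logb 2 (Fintype.card α) +
      (entropy ((S.erase k).inf X ⊓ coordSetoid (outerCoords want know (S.erase k))) -
        entropy (coordSetoid (outerCoords want know (S.erase k)) : Setoid (ι → α))) ≤
      entropy (S.inf X ⊓ coordSetoid (outerCoords want know S)) -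
        entropy (X k ⊓ coordSetoid (outerCoords want know S)) := by
  classical
  set Y : Finset I → Setoid (ι → α) := fun S => coordSetoid (outerCoords want know S) with hY
  set L : Setoid (ι → α) := coordSetoid {p | k ∈ know p} with hL
  change _ + (entropy ((S.erase k).inf X ⊓ Y (S.erase k)) - entropy (Y (S.erase k))) ≤
    entropy (S.inf X ⊓ Y S) - entropy (X k ⊓ Y S)
  have hinf : S.inf X = X k ⊓ (S.erase k).inf X := by
    rw [← inf_insert, insert_erase hk]
  have hYk : Y (S.erase k) = Y S ⊓ L ⊓ coordSetoid {p | k ∈ want p} := by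
    rw [hL, hY]
    simp only
    rw [← coordSetoid_union, ← coordSetoid_union]
    congr 1
    ext p
    simp only [outerCoords, coe_filter, mem_univ, true_and, Set.mem_ofPred_eq, Set.mem_union]
    rw [subset_erase, mem_union]
    tauto
  -- all messages from outside `S` are functions of the coordinates in `outerCoords`
  have hXY (j : I) (hj : j ∉ S) : Y S ≤ X j := by
    refine le_trans (coordSetoid_anti ?_) (hX j)
    intro p hp
    simp only [outerCoords, coe_filter, mem_univ, true_and, Set.mem_ofPred_eq]
    exact fun h => hj (h (mem_union_right _ hp))
  have hmain : S.inf X ⊓ L ⊓ Y S = (S.erase k).inf X ⊓ Y (S.erase k) := by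
    rw [hYk]
    apply le_antisymm
    · refine le_inf ?_ (le_inf (le_inf inf_le_right (inf_le_left.trans inf_le_right)) ?_)
      · rw [hinf]
        exact inf_le_left.trans (inf_le_left.trans inf_le_right)
      · refine le_trans (le_inf (inf_le_left.trans inf_le_right) ?_) (hdec k)
        refine Finset.le_inf fun j _ => ?_
        by_cases hj : j ∈ S
        · exact inf_le_left.trans (inf_le_left.trans (Finset.inf_le hj))
        · exact inf_le_right.trans (hXY j hj)
    · refine le_inf (le_inf ?_ ?_) ?_
      · rw [hinf]
        exact le_inf (inf_le_right.trans (inf_le_left.trans (inf_le_right.trans (hX k))))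
          inf_le_left
      · exact inf_le_right.trans (inf_le_left.trans inf_le_right)
      · exact inf_le_right.trans (inf_le_left.trans inf_le_left)
  have hsub := entropy_submodular (S.inf X) L (X k ⊓ Y S)
  have e1 : S.inf X ⊓ L ⊓ (X k ⊓ Y S) = S.inf X ⊓ L ⊓ Y S := by
    apply le_antisymm
    · exact inf_le_inf_left _ inf_le_right
    · exact le_inf inf_le_left (le_inf (inf_le_left.trans (inf_le_left.trans
        (Finset.inf_le hk))) inf_le_right)
  have e2 : S.inf X ⊓ (X k ⊓ Y S) = S.inf X ⊓ Y S := by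
    rw [← inf_assoc, inf_eq_left.2 (Finset.inf_le hk)]
  have e3 : L ⊓ (X k ⊓ Y S) = L ⊓ Y S := by
    rw [← inf_assoc, inf_eq_left.2 (hX k)]
  rw [e1, e2, e3, hmain] at hsub
  have hLY : L ⊓ Y S = coordSetoid ((univ.filter fun p => k ∈ know p) ∪ outerCoords want know S :
      Finset ι) := by
    rw [coe_union, coordSetoid_union, hL, hY]
    simp
  have hcount : (outerCoords want know (S.erase k)).card =
      (univ.filter fun p => want p ∪ know p ⊆ S ∧ k ∈ want p ∧ k ∉ know p).card +
      ((univ.filter fun p => k ∈ know p) ∪ outerCoords want know S).card := by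
    rw [← card_union_of_disjoint]
    · congr 1
      ext p
      simp only [outerCoords, mem_filter, mem_union, mem_univ, true_and]
      rw [subset_erase, mem_union]
      tauto
    · rw [disjoint_left]
      intro p hp
      simp only [outerCoords, mem_filter, mem_union, mem_univ, true_and] at hp ⊢
      tauto
  have h1 : entropy (Y (S.erase k)) =
      ((univ.filter fun p => want p ∪ know p ⊆ S ∧ k ∈ want p ∧ k ∉ know p).card : ℝ) *
        Real.logb 2 (Fintype.card α) + entropy (L ⊓ Y S) := by
    rw [hLY, hY]
    simp only
    rw [entropy_coordSetoid, entropy_coordSetoid, hcount]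
    push_cast
    ring
  linarith

/-- Summing over all nodes which one is peeled off first. -/
lemma sum_peel_count [Fintype I] (want know : ι → Finset I) (hknow : ∀ p, (know p).Nonempty)
    (S : Finset I) :
    ∑ k ∈ S, (((univ.filter fun p => want p ∪ know p ⊆ S ∧ k ∈ want p ∧ k ∉ know p).card : ℝ) +
      ∑ p with want p ∪ know p ⊆ S.erase k, unitCost (want p) (know p)) =
    (S.card - 1) * ∑ p with want p ∪ know p ⊆ S, unitCost (want p) (know p) := by
  classical
  have h1 : ∀ k ∈ S, (((univ.filter fun p => want p ∪ know p ⊆ S ∧ k ∈ want p ∧ k ∉ know p).card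
      : ℝ) + ∑ p with want p ∪ know p ⊆ S.erase k, unitCost (want p) (know p)) =
      ∑ p with want p ∪ know p ⊆ S, ((if k ∈ want p \ know p then (1 : ℝ) else 0) +
        if k ∉ want p ∪ know p then unitCost (want p) (know p) else 0) := by
    intro k _
    rw [sum_add_distrib, ← sum_filter, ← sum_filter, filter_filter, filter_filter, sum_const,
      nsmul_eq_mul, mul_one]
    congr 2
    · congr 1
      ext p
      simp [mem_sdiff]
    · ext p
      simp [subset_erase]
  rw [sum_congr rfl h1, sum_comm, mul_sum]
  refine sum_congr rfl fun p hp => ?_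
  have hpS := (mem_filter.1 hp).2
  have e1 : S.filter (fun k => k ∈ want p \ know p) = want p \ know p := by
    ext k
    simp only [mem_filter, mem_sdiff, and_iff_right_iff_imp]
    exact fun hk => hpS (mem_union_left _ hk.1)
  have e2 : S.filter (fun k => k ∉ want p ∪ know p) = S \ (want p ∪ know p) := by
    ext k
    simp
  have e3 : ((want p \ know p).card : ℝ) = (want p ∪ know p).card - (know p).card := by
    have := card_sdiff_add_card (want p) (know p)
    rw [← this]
    push_cast
    ring
  have e4 : ((S \ (want p ∪ know p)).card : ℝ) = S.card - (want p ∪ know p).card := by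
    rw [card_sdiff_of_subset hpS, Nat.cast_sub (card_le_card hpS)]
  rw [sum_add_distrib, ← sum_filter, ← sum_filter, e1, e2, sum_const, sum_const, nsmul_eq_mul,
    nsmul_eq_mul, e3, e4, ← unitCost_mul (hknow p)]
  ring

variable [DecidableEq ι] [Fintype α] [Nonempty α]

/-- The bound for the nodes in `S` only, given all coordinates that involve a node outside `S`. -/
lemma index_coding_aux [Fintype I] (want know : ι → Finset I)
    (hknow : ∀ p, (know p).Nonempty) (X : I → Setoid (ι → α))
    (hX : ∀ k, (coordSetoid {p | k ∈ know p} : Setoid (ι → α)) ≤ X k)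
    (hdec : ∀ k, (coordSetoid {p | k ∈ know p} : Setoid (ι → α)) ⊓ univ.inf X ≤
      coordSetoid {p | k ∈ want p}) (n : ℕ) : ∀ S : Finset I, S.card = n →
    (∑ p with want p ∪ know p ⊆ S, unitCost (want p) (know p)) * Real.logb 2 (Fintype.card α) ≤
      entropy (S.inf X ⊓ coordSetoid (outerCoords want know S)) -
        entropy (coordSetoid (outerCoords want know S) : Setoid (ι → α)) := by
  induction n with
  | zero =>
    intro S hS
    rw [card_eq_zero] at hS
    subst hS
    rw [sum_eq_zero]
    · simp
    · intro p hp
      have := (mem_filter.1 hp).2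
      obtain ⟨k, hk⟩ := hknow p
      exact absurd (this (mem_union_right _ hk)) (notMem_empty k)
  | succ n ih =>
    intro S hS
    rcases Nat.eq_zero_or_pos n with rfl | hn
    · have h0 : ∑ p with want p ∪ know p ⊆ S, unitCost (want p) (know p) = 0 := by
        refine sum_eq_zero fun p hp => ?_
        have h1 := card_le_card (mem_filter.1 hp).2
        have h2 := card_le_card (subset_union_right (s₁ := want p) (s₂ := know p))
        have h3 := (hknow p).card_pos
        have h4 : (want p ∪ know p).card = 1 := by omega
        simp [unitCost, h4]
      rw [h0, zero_mul, sub_nonneg]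
      exact entropy_anti inf_le_right
    · have hsum := sum_le_sum fun k (hk : k ∈ S) =>
        entropy_peel_node want know X hX hdec S hk
      have hih : ∀ k ∈ S, _ := fun k hk => ih (S.erase k) (by rw [card_erase_of_mem hk, hS]; rfl)
      have hsum2 := sum_le_sum hih
      have hsub := entropy_inf_le_sum S X (coordSetoid (outerCoords want know S))
      have hcount := congrArg (· * Real.logb 2 (Fintype.card α))
        (sum_peel_count want know hknow S)
      simp only [add_mul, sum_add_distrib, sum_sub_distrib, sum_const, nsmul_eq_mul, sum_mul,
        hS] at hsum hsum2 hsub hcount ⊢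
      push_cast at hsum hsum2 hsub hcount ⊢
      have hn' : (0 : ℝ) < n := by exact_mod_cast hn
      refine le_of_mul_le_mul_left ?_ hn'
      rw [add_sub_cancel_right, mul_assoc, sum_mul] at hcount
      linarith

/-- The converse bound for index coding with messages `X k` that are functions of the side
information of the nodes: every coordinate contributes its unit cost. -/
theorem index_coding_bound [Fintype I] (want know : ι → Finset I)
    (hknow : ∀ p, (know p).Nonempty) (X : I → Setoid (ι → α))
    (hX : ∀ k, (coordSetoid {p | k ∈ know p} : Setoid (ι → α)) ≤ X k)
    (hdec : ∀ k, (coordSetoid {p | k ∈ know p} : Setoid (ι → α)) ⊓ univ.inf X ≤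
      coordSetoid {p | k ∈ want p}) :
    (∑ p, unitCost (want p) (know p)) * Real.logb 2 (Fintype.card α) ≤ ∑ k, entropy (X k) := by
  have h := index_coding_aux want know hknow X hX hdec _ univ rfl
  have h1 : (coordSetoid (outerCoords want know univ : Finset ι) : Setoid (ι → α)) = ⊤ := by
    have : outerCoords want know univ = ∅ := by simp [outerCoords]
    rw [this]
    ext v w
    exact ⟨fun _ => trivial, fun _ i hi => absurd hi (by simp)⟩
  have h2 := entropy_inf_le_sum univ X ⊤
  rw [h1] at h
  simp only [entropy_top, sub_zero, inf_top_eq, subset_univ, filter_true] at h h2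
  exact h.trans h2

end IndexCoding

/-! ### The communication loads as averages of unit costs -/

section Loads

variable {I : Type*} [DecidableEq I]

lemma card_filter_card_union {T R : Finset I} (hR : R ⊆ T) {s l : ℕ} (hrl : R.card ≤ l)
    (hsl : s ≤ l) (hl : l ≤ R.card + s) :
    ((T.powersetCard s).filter fun P => (P ∪ R).card = l).card =
      (T.card - R.card).choose (l - R.card) * R.card.choose (l - s) := by
  have h1 : R.card.choose (l - s) = R.card.choose (s - (l - R.card)) := by
    rw [← Nat.choose_symm (by omega : l - s ≤ R.card)]
    congr 1
    omega
  rw [h1, ← card_sdiff_of_subset hR, ← card_powersetCard, ← card_powersetCard, ← card_product]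
  refine card_nbij' (fun P => (P \ R, P ∩ R)) (fun X => X.1 ∪ X.2) ?_ ?_ ?_ ?_
  · intro P hP
    simp only [mem_coe, mem_filter, mem_powersetCard, mem_product] at hP ⊢
    obtain ⟨⟨hPT, hPs⟩, hPl⟩ := hP
    have e1 := card_sdiff_add_card P R
    have e2 := card_sdiff_add_card_inter P R
    exact ⟨⟨sdiff_subset_sdiff hPT le_rfl, by omega⟩, inter_subset_right, by omega⟩
  · rintro ⟨A, B⟩ hX
    simp only [mem_coe, mem_filter, mem_powersetCard, mem_product] at hX ⊢
    obtain ⟨⟨hA, hAc⟩, hB, hBc⟩ := hX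
    have hAR : Disjoint A R := disjoint_of_subset_left hA sdiff_disjoint
    have e1 : (A ∪ B ∪ R) = A ∪ R := by
      rw [union_assoc, union_eq_right.2 hB]
    have e2 := card_union_of_disjoint hAR
    have e3 := card_union_of_disjoint (disjoint_of_subset_right hB hAR)
    exact ⟨⟨union_subset (hA.trans sdiff_subset) (hB.trans hR), by omega⟩, by rw [e1]; omega⟩
  · intro P _
    exact sdiff_union_inter P R
  · rintro ⟨A, B⟩ hX
    simp only [mem_coe, mem_powersetCard, mem_product] at hX
    obtain ⟨⟨hA, -⟩, hB, -⟩ := hX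
    have hAR : Disjoint A R := disjoint_of_subset_left hA sdiff_disjoint
    simp only [Prod.mk.injEq]
    rw [union_sdiff_distrib, sdiff_eq_empty_iff_subset.2 hB, union_empty,
      sdiff_eq_self_of_disjoint hAR, union_inter_distrib_right,
      disjoint_iff_inter_eq_empty.1 hAR, empty_union]
    exact ⟨rfl, inter_eq_left.2 hB⟩

lemma sum_powersetCard_union {T R : Finset I} (hR : R ⊆ T) (s : ℕ) (g : ℕ → ℝ)
    (hg : g R.card = 0) :
    ∑ P ∈ T.powersetCard s, g (P ∪ R).card =
      ∑ l ∈ Icc (max (R.card + 1) s) (min (R.card + s) T.card),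
        ((T.card - R.card).choose (l - R.card) * R.card.choose (l - s) : ℕ) * g l := by
  have hmaps : ∀ P ∈ (T.powersetCard s).filter (fun P => (P ∪ R).card ≠ R.card),
      (P ∪ R).card ∈ Icc (max (R.card + 1) s) (min (R.card + s) T.card) := by
    intro P hP
    simp only [mem_filter, mem_powersetCard] at hP
    have e1 := card_le_card (subset_union_left (s₁ := P) (s₂ := R))
    have e2 := card_le_card (subset_union_right (s₁ := P) (s₂ := R))
    have e3 := card_union_le P R
    have e4 := card_le_card (union_subset hP.1.1 hR)
    simp only [mem_Icc]
    omega
  have h0 : ∑ P ∈ T.powersetCard s, g (P ∪ R).card =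
      ∑ P ∈ T.powersetCard s with (P ∪ R).card ≠ R.card, g (P ∪ R).card := by
    rw [sum_filter]
    refine sum_congr rfl fun P _ => ?_
    split_ifs with h
    · rfl
    · rw [not_not.1 h, hg]
  rw [h0, ← sum_fiberwise_of_maps_to hmaps]
  refine sum_congr rfl fun l hl => ?_
  simp only [mem_Icc] at hl
  rw [← card_filter_card_union hR (by omega) (by omega) (by omega), filter_filter]
  have : ∀ P ∈ (T.powersetCard s).filter
      (fun P => (P ∪ R).card ≠ R.card ∧ (P ∪ R).card = l), g (P ∪ R).card = g l := by
    intro P hP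
    rw [(mem_filter.1 hP).2.2]
  rw [sum_congr rfl this, sum_const, nsmul_eq_mul]
  congr 3
  ext P
  simp only [mem_filter]
  constructor
  · exact fun h => ⟨h.1, h.2.2⟩
  · exact fun h => ⟨h.1, by omega, h.2⟩

lemma choose_mul_choose_mul {K l r : ℕ} (hl : l ≤ K) (hrl : r + 1 ≤ l) :
    ((K - r).choose (l - r) : ℝ) * K.choose r * (l - r) = K.choose l * (l - 1).choose r * l := by
  obtain ⟨m, rfl⟩ : ∃ m, l = m + 1 := ⟨l - 1, by omega⟩
  have h1 := Nat.choose_mul (n := K) (show r ≤ m + 1 by omega)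
  have h2 := Nat.choose_mul_succ_eq m r
  have h3 : ((m + 1 - r : ℕ) : ℝ) = ((m + 1 : ℕ) : ℝ) - r := by
    rw [Nat.cast_sub (by omega)]
  rw [← h3]
  norm_cast
  simp only [Nat.add_sub_cancel]
  calc (K - r).choose (m + 1 - r) * K.choose r * (m + 1 - r)
      = (K.choose r * (K - r).choose (m + 1 - r)) * (m + 1 - r) := by ring
    _ = K.choose (m + 1) * ((m + 1).choose r * (m + 1 - r)) := by rw [← h1]; ring
    _ = _ := by rw [← h2]; ring

/-- The communication load of coded distributed computing is the average, over the `s`-subsets `P`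
of `T`, of the cost `(|P ∪ R| - |R|) / (|P ∪ R| - 1)` of a value known by the nodes in `R`. -/
lemma sum_powersetCard_cdc {T R : Finset I} (hR : R ⊆ T) {s : ℕ} (hs : s ≤ T.card) :
    ∑ P ∈ T.powersetCard s, (((P ∪ R).card : ℝ) - R.card) / ((P ∪ R).card - 1) =
      T.card.choose s * loadCDC R.card s T.card := by
  rw [sum_powersetCard_union hR s (fun l => ((l : ℝ) - R.card) / (l - 1)) (by simp), loadCDC,
    mul_sum]
  refine sum_congr rfl fun l hl => ?_
  simp only [mem_Icc] at hl
  have h := choose_mul_choose_mul (K := T.card) (l := l) (r := R.card) (by omega) (by omega)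
  have h1 : (T.card.choose s : ℝ) ≠ 0 := by exact_mod_cast (Nat.choose_pos hs).ne'
  have h2 : (T.card.choose R.card : ℝ) ≠ 0 := by
    exact_mod_cast (Nat.choose_pos (card_le_card hR)).ne'
  push_cast
  rw [div_eq_mul_inv _ ((l : ℝ) - 1), div_eq_mul_inv _ ((l : ℝ) - 1)]
  generalize ((l : ℝ) - 1)⁻¹ = e
  field_simp
  linear_combination ((R.card.choose (l - s) : ℝ) * e) * h

/-- The communication load with a helper is the average, over the `s`-subsets `P` of `T`, of the
cost `(|P ∪ R| - |R|) / |P ∪ R|` of a value known by a helper and by the nodes in `R`. -/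
lemma sum_powersetCard_acdc {T R : Finset I} (hR : R ⊆ T) {s : ℕ} (hs : s ≤ T.card) :
    ∑ P ∈ T.powersetCard s, (((P ∪ R).card : ℝ) - R.card) / (P ∪ R).card =
      T.card.choose s * loadACDC R.card s T.card := by
  rw [sum_powersetCard_union hR s (fun l => ((l : ℝ) - R.card) / l) (by simp), loadACDC,
    mul_sum]
  refine sum_congr rfl fun l hl => ?_
  simp only [mem_Icc] at hl
  have h := choose_mul_choose_mul (K := T.card) (l := l) (r := R.card) (by omega) (by omega)
  have h1 : (T.card.choose s : ℝ) ≠ 0 := by exact_mod_cast (Nat.choose_pos hs).ne'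
  have h2 : (T.card.choose R.card : ℝ) ≠ 0 := by
    exact_mod_cast (Nat.choose_pos (card_le_card hR)).ne'
  have h3 : (l : ℝ) ≠ 0 := by exact_mod_cast (by omega : l ≠ 0)
  push_cast
  field_simp
  linear_combination (R.card.choose (l - s) : ℝ) * h

lemma loadCDC_nonneg {r s K : ℕ} (hr : 1 ≤ r) : 0 ≤ loadCDC r s K := by
  refine sum_nonneg fun l hl => ?_
  simp only [mem_Icc] at hl
  have : (1 : ℝ) ≤ l := by exact_mod_cast (by omega : 1 ≤ l)
  have : (0 : ℝ) ≤ (l : ℝ) - 1 := by linarith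
  positivity

lemma loadACDC_nonneg (r s K : ℕ) : 0 ≤ loadACDC r s K :=
  sum_nonneg fun l _ => by positivity

lemma loadACDC_zero {s K : ℕ} (hs : 1 ≤ s) (hsK : s ≤ K) : loadACDC 0 s K = 1 := by
  have h : (K.choose s : ℝ) ≠ 0 := by exact_mod_cast (Nat.choose_pos hsK).ne'
  have h1 : max (0 + 1) s = s := by omega
  have h2 : min (0 + s) K = s := by omega
  rw [loadACDC, h1, h2]
  simp [h]

end Loads

/-! ### Convexity of the communication loads -/

lemma sum_Icc_load (r s K : ℕ) (F : ℕ → ℝ) :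
    ∑ l ∈ Icc (max (r + 1) s) (min (r + s) K), F l =
      ∑ i ∈ range s, if s ≤ i + r + 1 ∧ i + r + 1 ≤ K then F (i + r + 1) else 0 := by
  rw [← sum_filter]
  refine sum_nbij' (fun l => l - (r + 1)) (fun i => i + r + 1) ?_ ?_ ?_ ?_ ?_
  · intro l hl
    simp only [mem_Icc, mem_filter, mem_range] at hl ⊢
    omega
  · intro i hi
    simp only [mem_Icc, mem_filter, mem_range] at hi ⊢
    omega
  · intro l hl
    simp only [mem_Icc] at hl
    omega
  · intro i _
    omega
  · intro l hl
    simp only [mem_Icc] at hl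
    congr 1
    omega

lemma sum_range_choose_mul_choose (a r : ℕ) {s : ℕ} (hs : 1 ≤ s) :
    ∑ i ∈ range s, (if s ≤ i + r + 1 then a.choose i * r.choose (i + r + 1 - s) else 0) =
      (a + r).choose (s - 1) := by
  rw [Nat.add_choose_eq, Nat.sum_antidiagonal_eq_sum_range_succ_mk, Nat.succ_eq_add_one,
    Nat.sub_add_cancel hs]
  refine sum_congr rfl fun i hi => ?_
  have := mem_range.1 hi
  split_ifs with h
  · congr 1
    rw [← Nat.choose_symm (by omega)]
    congr 1
    omega
  · simp only
    rw [Nat.choose_eq_zero_of_lt (by omega : r < s - 1 - i), mul_zero]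

lemma sum_range_choose_succ (n k : ℕ) :
    ∑ m ∈ range n, m.choose k = n.choose (k + 1) := by
  induction n with
  | zero => simp
  | succ n ih => rw [sum_range_succ, ih, Nat.choose_succ_succ, add_comm]

lemma loadACDC_eq_sum_choose {r s K : ℕ} (hs : 1 ≤ s) (hsK : s ≤ K) (hr : r ≤ K) :
    loadACDC r s K = ∑ m ∈ range K,
      ((m.choose (s - 1) : ℝ) / K.choose s) * ((m.choose r : ℝ) / K.choose r) := by
  have h1 : (K.choose s : ℝ) ≠ 0 := by exact_mod_cast (Nat.choose_pos hsK).ne'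
  have h2 : (K.choose r : ℝ) ≠ 0 := by exact_mod_cast (Nat.choose_pos hr).ne'
  have key : ∑ i ∈ range s, (if s ≤ i + r + 1 ∧ i + r + 1 ≤ K then
      ((K.choose (i + r + 1) * (i + r).choose r * r.choose (i + r + 1 - s) : ℕ) : ℝ) else 0) =
      ∑ m ∈ range K, (m.choose (s - 1) : ℝ) * m.choose r := by
    have e1 : ∀ i ∈ range s, (if s ≤ i + r + 1 ∧ i + r + 1 ≤ K then
        ((K.choose (i + r + 1) * (i + r).choose r * r.choose (i + r + 1 - s) : ℕ) : ℝ) else 0) =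
        ((∑ m ∈ range K, m.choose r * if s ≤ i + r + 1 then
          (m - r).choose i * r.choose (i + r + 1 - s) else 0 : ℕ) : ℝ) := by
      intro i _
      by_cases h : s ≤ i + r + 1
      · by_cases h' : i + r + 1 ≤ K
        · rw [if_pos ⟨h, h'⟩, ← sum_range_choose_succ _ (i + r), sum_mul, sum_mul]
          simp only [if_pos h]
          congr 1
          refine sum_congr rfl fun m _ => ?_
          rw [Nat.choose_mul (by omega : r ≤ i + r), Nat.add_sub_cancel]
          ring
        · rw [if_neg (by tauto), sum_eq_zero]
          · simp
          · intro m hm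
            have := mem_range.1 hm
            rcases Nat.lt_or_ge m r with hmr | hmr
            · rw [Nat.choose_eq_zero_of_lt hmr, zero_mul]
            · rw [if_pos h, Nat.choose_eq_zero_of_lt (by omega : m - r < i), zero_mul, mul_zero]
      · rw [if_neg (by tauto), sum_eq_zero]
        · simp
        · intro m _
          rw [if_neg h, mul_zero]
    rw [sum_congr rfl e1, ← Nat.cast_sum, sum_comm, Nat.cast_sum]
    refine sum_congr rfl fun m _ => ?_
    rw [← mul_sum]
    rcases Nat.lt_or_ge m r with hmr | hmr
    · rw [Nat.choose_eq_zero_of_lt hmr]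
      simp
    · rw [sum_range_choose_mul_choose _ _ hs, Nat.sub_add_cancel hmr]
      push_cast
      ring
  rw [loadACDC, sum_Icc_load]
  calc _ = (∑ i ∈ range s, (if s ≤ i + r + 1 ∧ i + r + 1 ≤ K then
      ((K.choose (i + r + 1) * (i + r).choose r * r.choose (i + r + 1 - s) : ℕ) : ℝ) else 0)) /
        (K.choose r * K.choose s) := by
        rw [sum_div]
        refine sum_congr rfl fun i _ => ?_
        rw [ite_div, zero_div]
        push_cast [Nat.add_sub_cancel]
        rfl
    _ = _ := by
        rw [key, sum_div]
        refine sum_congr rfl fun m _ => ?_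
        field_simp

lemma loadCDC_eq_sum_choose {r s K : ℕ} (hs : 1 ≤ s) (hsK : s ≤ K) (hr : r + 1 ≤ K) :
    loadCDC (r + 1) s K = ∑ m ∈ range (K - 1),
      (((m + 1).choose (s - 1) : ℝ) / K.choose s) * ((m.choose r : ℝ) / (K - 1).choose r) := by
  obtain ⟨k, rfl⟩ : ∃ k, K = k + 1 := ⟨K - 1, by omega⟩
  have h1 : ((k + 1).choose s : ℝ) ≠ 0 := by exact_mod_cast (Nat.choose_pos hsK).ne'
  have h2 : (k.choose r : ℝ) ≠ 0 := by
    exact_mod_cast (Nat.choose_pos (by omega : r ≤ k)).ne'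
  have h3 : ((k + 1).choose (r + 1) : ℝ) ≠ 0 := by exact_mod_cast (Nat.choose_pos hr).ne'
  rw [Nat.add_sub_cancel]
  have key : ∑ i ∈ range s, (if s ≤ i + (r + 1) + 1 ∧ i + (r + 1) + 1 ≤ k + 1 then
      ((k.choose (i + r + 1) * (i + r).choose r * (r + 1).choose (i + (r + 1) + 1 - s) : ℕ) : ℝ)
        else 0) = ∑ m ∈ range k, ((m + 1).choose (s - 1) : ℝ) * m.choose r := by
    have e1 : ∀ i ∈ range s, (if s ≤ i + (r + 1) + 1 ∧ i + (r + 1) + 1 ≤ k + 1 then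
        ((k.choose (i + r + 1) * (i + r).choose r * (r + 1).choose (i + (r + 1) + 1 - s) : ℕ) : ℝ)
          else 0) =
        ((∑ m ∈ range k, m.choose r * if s ≤ i + (r + 1) + 1 then
          (m - r).choose i * (r + 1).choose (i + (r + 1) + 1 - s) else 0 : ℕ) : ℝ) := by
      intro i _
      by_cases h : s ≤ i + (r + 1) + 1
      · by_cases h' : i + (r + 1) + 1 ≤ k + 1
        · rw [if_pos ⟨h, h'⟩, ← sum_range_choose_succ _ (i + r), sum_mul, sum_mul]
          simp only [if_pos h]
          congr 1
          refine sum_congr rfl fun m _ => ?_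
          rw [Nat.choose_mul (by omega : r ≤ i + r), Nat.add_sub_cancel]
          ring
        · rw [if_neg (by tauto), sum_eq_zero]
          · simp
          · intro m hm
            have := mem_range.1 hm
            rcases Nat.lt_or_ge m r with hmr | hmr
            · rw [Nat.choose_eq_zero_of_lt hmr, zero_mul]
            · rw [if_pos h, Nat.choose_eq_zero_of_lt (by omega : m - r < i), zero_mul, mul_zero]
      · rw [if_neg (by tauto), sum_eq_zero]
        · simp
        · intro m _
          rw [if_neg h, mul_zero]
    rw [sum_congr rfl e1, ← Nat.cast_sum, sum_comm, Nat.cast_sum]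
    refine sum_congr rfl fun m _ => ?_
    rw [← mul_sum]
    rcases Nat.lt_or_ge m r with hmr | hmr
    · rw [Nat.choose_eq_zero_of_lt hmr]
      simp
    · rw [sum_range_choose_mul_choose _ _ hs, ← add_assoc, Nat.sub_add_cancel hmr]
      push_cast
      ring
  rw [loadCDC, sum_Icc_load]
  calc _ = (∑ i ∈ range s, (if s ≤ i + (r + 1) + 1 ∧ i + (r + 1) + 1 ≤ k + 1 then
      ((k.choose (i + r + 1) * (i + r).choose r * (r + 1).choose (i + (r + 1) + 1 - s) : ℕ) : ℝ)
        else 0)) / (k.choose r * (k + 1).choose s) := by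
        rw [sum_div]
        refine sum_congr rfl fun i _ => ?_
        rw [ite_div, zero_div]
        -- absorption identities move the factor `l / (l - 1)` into the binomial coefficients
        have a1 : ((k + 1 : ℕ) : ℝ) * k.choose (i + r + 1) =
            (k + 1).choose (i + r + 1 + 1) * ((i + r + 1 + 1 : ℕ) : ℝ) := by
          exact_mod_cast Nat.add_one_mul_choose_eq k (i + r + 1)
        have a2 : ((i + r + 1 : ℕ) : ℝ) * (i + r).choose r =
            (i + r + 1).choose (r + 1) * ((r + 1 : ℕ) : ℝ) := by
          exact_mod_cast Nat.add_one_mul_choose_eq (i + r) r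
        have a3 : ((k + 1 : ℕ) : ℝ) * k.choose r = (k + 1).choose (r + 1) * ((r + 1 : ℕ) : ℝ) := by
          exact_mod_cast Nat.add_one_mul_choose_eq k r
        have e : i + (r + 1) + 1 = i + r + 1 + 1 := by ring
        rw [e, Nat.add_sub_cancel]
        have p1 : ((i + r + 1 : ℕ) : ℝ) ≠ 0 := by positivity
        have p2 : ((k + 1 : ℕ) : ℝ) ≠ 0 := by positivity
        have p3 : ((r + 1 : ℕ) : ℝ) ≠ 0 := by positivity
        have e2 : ((i + r + 1 + 1 : ℕ) : ℝ) - 1 = ((i + r + 1 : ℕ) : ℝ) := by push_cast; ring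
        rw [e2, Nat.cast_mul, Nat.cast_mul]
        have b1 := eq_div_of_mul_eq p2 ((mul_comm _ _).trans a1)
        have b2 := eq_div_of_mul_eq p1 ((mul_comm _ _).trans a2)
        have b3 := eq_div_of_mul_eq p2 ((mul_comm _ _).trans a3)
        rw [b1, b2, b3]
        congr 1
        field_simp
    _ = _ := by
        rw [key, sum_div]
        refine sum_congr rfl fun m _ => ?_
        field_simp

/-- Discrete convexity of `r ↦ C(m, r) / C(n, r)`, the probability that a random `r`-subset of
`{1, …, n}` lies in `{1, …, m}`. -/
lemma choose_div_choose_convex {m n r : ℕ} (hmn : m ≤ n) (hr : r + 2 ≤ n) :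
    2 * ((m.choose (r + 1) : ℝ) / n.choose (r + 1)) ≤
      (m.choose r : ℝ) / n.choose r + (m.choose (r + 2) : ℝ) / n.choose (r + 2) := by
  rcases Nat.lt_or_ge m (r + 1) with h | h
  · rw [Nat.choose_eq_zero_of_lt h]
    simp only [Nat.cast_zero, zero_div, mul_zero]
    positivity
  obtain ⟨u, rfl⟩ : ∃ u, m = r + 1 + u := ⟨m - (r + 1), by omega⟩
  obtain ⟨w, rfl⟩ : ∃ w, n = r + 1 + u + w := ⟨n - (r + 1 + u), by omega⟩
  have step (k j : ℕ) (hj : j ≤ k) :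
      (k.choose (j + 1) : ℝ) = k.choose j * ((k : ℝ) - j) / (j + 1) := by
    rw [eq_div_iff (by positivity)]
    have := Nat.choose_succ_right_eq k j
    rw [← Nat.cast_sub hj]
    exact_mod_cast this
  have c1 : (((r + 1 + u).choose r : ℕ) : ℝ) ≠ 0 := by
    exact_mod_cast (Nat.choose_pos (by omega)).ne'
  have c2 : (((r + 1 + u + w).choose r : ℕ) : ℝ) ≠ 0 := by
    exact_mod_cast (Nat.choose_pos (by omega)).ne'
  have hA : (0 : ℝ) ≤ ((r + 1 + u).choose r : ℝ) / (r + 1 + u + w).choose r := by positivity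
  rw [step (r + 1 + u) (r + 1) (by omega), step (r + 1 + u + w) (r + 1) (by omega),
    step (r + 1 + u) r (by omega), step (r + 1 + u + w) r (by omega)]
  push_cast
  have huw : (1 : ℝ) ≤ (u : ℝ) + w := by exact_mod_cast (by omega : 1 ≤ u + w)
  have e1 : ((r : ℝ) + 1 + u - r) = 1 + u := by ring
  have e2 : ((r : ℝ) + 1 + u - (r + 1)) = u := by ring
  have e3 : ((r : ℝ) + 1 + u + w - r) = 1 + u + w := by ring
  have e4 : ((r : ℝ) + 1 + u + w - (r + 1)) = u + w := by ring
  rw [e1, e2, e3, e4]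
  have p1 : (0 : ℝ) < u + w := by linarith
  have p2 : (0 : ℝ) < 1 + u + w := by linarith
  have p3 : (0 : ℝ) < (r : ℝ) + 1 := by positivity
  have p4 : (0 : ℝ) < (r : ℝ) + 1 + 1 := by positivity
  have key : 0 ≤ 1 + (1 + (u : ℝ)) * u / ((1 + u + w) * (u + w)) -
      2 * ((1 + u) / (1 + u + w)) := by
    have : 1 + (1 + (u : ℝ)) * u / ((1 + u + w) * (u + w)) - 2 * ((1 + u) / (1 + u + w)) =
        ((w : ℝ) * w - w) / ((1 + u + w) * (u + w)) := by
      field_simp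
      ring
    rw [this]
    apply div_nonneg _ (by positivity)
    have : w ≤ w * w := Nat.le_mul_self w
    have : (w : ℝ) ≤ w * w := by exact_mod_cast this
    linarith
  have := mul_nonneg hA key
  have e : (((r + 1 + u).choose r : ℕ) : ℝ) / (r + 1 + u + w).choose r *
      (1 + (1 + (u : ℝ)) * u / ((1 + u + w) * (u + w)) - 2 * ((1 + u) / (1 + u + w))) =
      (((r + 1 + u).choose r : ℕ) : ℝ) / (r + 1 + u + w).choose r +
      ((r + 1 + u).choose r : ℝ) * (1 + u) / (r + 1) * u / (r + 1 + 1) /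
        ((r + 1 + u + w).choose r * (1 + u + w) / (r + 1) * (u + w) / (r + 1 + 1)) -
      2 * (((r + 1 + u).choose r : ℝ) * (1 + u) / (r + 1) /
        ((r + 1 + u + w).choose r * (1 + u + w) / (r + 1))) := by
    field_simp
  rw [e] at this
  linarith

lemma loadACDC_convex {r s K : ℕ} (hs : 1 ≤ s) (hsK : s ≤ K) (hr : r + 2 ≤ K) :
    2 * loadACDC (r + 1) s K ≤ loadACDC r s K + loadACDC (r + 2) s K := by
  rw [loadACDC_eq_sum_choose hs hsK (by omega), loadACDC_eq_sum_choose hs hsK (by omega),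
    loadACDC_eq_sum_choose hs hsK hr, mul_sum, ← sum_add_distrib]
  refine sum_le_sum fun m hm => ?_
  rw [← mul_add, mul_left_comm]
  exact mul_le_mul_of_nonneg_left
    (choose_div_choose_convex (mem_range.1 hm).le hr) (by positivity)

lemma loadCDC_convex {r s K : ℕ} (hs : 1 ≤ s) (hsK : s ≤ K) (hr1 : 1 ≤ r) (hr : r + 2 ≤ K) :
    2 * loadCDC (r + 1) s K ≤ loadCDC r s K + loadCDC (r + 2) s K := by
  obtain ⟨r, rfl⟩ : ∃ q, r = q + 1 := ⟨r - 1, by omega⟩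
  rw [loadCDC_eq_sum_choose hs hsK (by omega), loadCDC_eq_sum_choose hs hsK (by omega),
    show r + 1 + 2 = r + 2 + 1 by ring, loadCDC_eq_sum_choose hs hsK (by omega), mul_sum,
    ← sum_add_distrib]
  refine sum_le_sum fun m hm => ?_
  rw [← mul_add, mul_left_comm]
  exact mul_le_mul_of_nonneg_left
    (choose_div_choose_convex (mem_range.1 hm).le (by omega)) (by positivity)

/-! ### Lower convex envelopes of finitely many points -/

section Envelope

lemma graphPoints_eq_image (a b : ℕ) (L : ℕ → ℝ) :
    {p : ℝ × ℝ | ∃ r ∈ Set.Icc a b, p = ((r : ℝ), L r)} =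
      ((Finset.Icc a b).image fun r : ℕ => ((r : ℝ), L r) : Finset (ℝ × ℝ)) := by
  ext p
  simp only [Set.mem_ofPred_eq, coe_image, Set.mem_image, coe_Icc]
  exact exists_congr fun r => and_congr_right fun _ => eq_comm

lemma mem_convexHull_graphPoints {a b : ℕ} {L : ℕ → ℝ} {x y : ℝ} :
    (x, y) ∈ convexHull ℝ {p : ℝ × ℝ | ∃ r ∈ Set.Icc a b, p = ((r : ℝ), L r)} ↔
      ∃ w : ℕ → ℝ, (∀ r ∈ Icc a b, 0 ≤ w r) ∧ ∑ r ∈ Icc a b, w r = 1 ∧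
        ∑ r ∈ Icc a b, w r * r = x ∧ ∑ r ∈ Icc a b, w r * L r = y := by
  have hinj : Set.InjOn (fun r : ℕ => ((r : ℝ), L r)) (Icc a b : Finset ℕ) := by
    intro r _ r' _ h
    simpa using (Prod.ext_iff.1 h).1
  rw [graphPoints_eq_image, Finset.mem_convexHull']
  constructor
  · rintro ⟨w, hw, hw1, hwx⟩
    rw [sum_image hinj] at hw1 hwx
    refine ⟨fun r => w ((r : ℝ), L r), fun r hr => hw _ (mem_image_of_mem _ hr), hw1, ?_, ?_⟩
    · simpa [Prod.fst_sum] using congrArg Prod.fst hwx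
    · simpa [Prod.snd_sum] using congrArg Prod.snd hwx
  · rintro ⟨w, hw, hw1, hx, hy⟩
    -- the weight of a point of the graph is read off from its abscissa
    refine ⟨fun p => w ⌊p.1⌋₊, ?_, ?_, ?_⟩
    · intro p hp
      obtain ⟨r, hr, rfl⟩ := mem_image.1 hp
      simpa using hw r hr
    · rw [sum_image hinj]
      simpa using hw1
    · rw [sum_image hinj]
      ext
      · simpa [Prod.fst_sum] using hx
      · simpa [Prod.snd_sum] using hy

lemma isCompact_graphHull (a b : ℕ) (L : ℕ → ℝ) :
    IsCompact (convexHull ℝ {p : ℝ × ℝ | ∃ r ∈ Set.Icc a b, p = ((r : ℝ), L r)}) := by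
  rw [graphPoints_eq_image]
  exact (Finset.finite_toSet _).isCompact_convexHull ℝ

lemma isCompact_graphFiber (a b : ℕ) (L : ℕ → ℝ) (x : ℝ) :
    IsCompact {y | (x, y) ∈ convexHull ℝ {p : ℝ × ℝ | ∃ r ∈ Set.Icc a b, p = ((r : ℝ), L r)}} := by
  set H := convexHull ℝ {p : ℝ × ℝ | ∃ r ∈ Set.Icc a b, p = ((r : ℝ), L r)} with hH
  have h : {y | (x, y) ∈ H} = Prod.snd '' (H ∩ {p | p.1 = x}) := by
    ext y
    constructor
    · exact fun hy => ⟨(x, y), ⟨hy, rfl⟩, rfl⟩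
    · rintro ⟨⟨x', y'⟩, ⟨hp, rfl⟩, rfl⟩
      exact hp
  rw [h]
  exact ((isCompact_graphHull a b L).inter_right
    (isClosed_eq continuous_fst continuous_const)).image continuous_snd

lemma lowerConvexEnvelope_le {a b : ℕ} {L w : ℕ → ℝ} (hw : ∀ r ∈ Icc a b, 0 ≤ w r)
    (hw1 : ∑ r ∈ Icc a b, w r = 1) :
    lowerConvexEnvelope {p : ℝ × ℝ | ∃ r ∈ Set.Icc a b, p = ((r : ℝ), L r)}
      (∑ r ∈ Icc a b, w r * r) ≤ ∑ r ∈ Icc a b, w r * L r :=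
  csInf_le (isCompact_graphFiber a b L _).bddBelow
    (mem_convexHull_graphPoints.2 ⟨w, hw, hw1, rfl, rfl⟩)

lemma exists_weights_lowerConvexEnvelope {a b : ℕ} (L : ℕ → ℝ) {x : ℝ}
    (hx : x ∈ Set.Icc (a : ℝ) b) :
    ∃ w : ℕ → ℝ, (∀ r ∈ Icc a b, 0 ≤ w r) ∧ ∑ r ∈ Icc a b, w r = 1 ∧
      ∑ r ∈ Icc a b, w r * r = x ∧ ∑ r ∈ Icc a b, w r * L r =
        lowerConvexEnvelope {p : ℝ × ℝ | ∃ r ∈ Set.Icc a b, p = ((r : ℝ), L r)} x := by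
  have hab : a ≤ b := by exact_mod_cast hx.1.trans hx.2
  set A := {p : ℝ × ℝ | ∃ r ∈ Set.Icc a b, p = ((r : ℝ), L r)} with hA
  have hne : {y | (x, y) ∈ convexHull ℝ A}.Nonempty := by
    have h1 : x ∈ segment ℝ (a : ℝ) b := by
      rw [segment_eq_Icc (by exact_mod_cast hab)]
      exact hx
    obtain ⟨t, u, ht, hu, htu, rfl⟩ := h1
    refine ⟨t • L a + u • L b, ?_⟩
    have ha : ((a : ℝ), L a) ∈ convexHull ℝ A := subset_convexHull ℝ A ⟨a, ⟨le_rfl, hab⟩, rfl⟩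
    have hb : ((b : ℝ), L b) ∈ convexHull ℝ A := subset_convexHull ℝ A ⟨b, ⟨hab, le_rfl⟩, rfl⟩
    exact convex_convexHull ℝ A ha hb ht hu htu
  exact mem_convexHull_graphPoints.1 ((isCompact_graphFiber a b L x).sInf_mem hne)

lemma increments_mono {a b : ℕ} {L : ℕ → ℝ}
    (hL : ∀ r, a ≤ r → r + 2 ≤ b → 2 * L (r + 1) ≤ L r + L (r + 2)) {i : ℕ} (hi : a ≤ i)
    (k : ℕ) (hk : i + k + 1 ≤ b) : L (i + 1) - L i ≤ L (i + k + 1) - L (i + k) := by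
  induction k with
  | zero => exact le_rfl
  | succ k ih =>
    have h1 := ih (by omega)
    have h2 := hL (i + k) (by omega) (by omega)
    have e1 : i + (k + 1) + 1 = i + k + 2 := by ring
    have e2 : i + (k + 1) = i + k + 1 := by ring
    rw [e1, e2]
    linarith

lemma le_of_slope_right {a b : ℕ} {L : ℕ → ℝ}
    (hL : ∀ r, a ≤ r → r + 2 ≤ b → 2 * L (r + 1) ≤ L r + L (r + 2)) {i : ℕ} (hi : a ≤ i)
    (k : ℕ) (hk : i + k ≤ b) : k * (L (i + 1) - L i) ≤ L (i + k) - L i := by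
  induction k with
  | zero => simp
  | succ k ih =>
    have h1 := ih (by omega)
    have h2 := increments_mono hL hi k (by omega)
    rw [← add_assoc]
    push_cast
    linarith

lemma le_of_slope_left {a b : ℕ} {L : ℕ → ℝ}
    (hL : ∀ r, a ≤ r → r + 2 ≤ b → 2 * L (r + 1) ≤ L r + L (r + 2)) {i : ℕ}
    (k : ℕ) (hi : a ≤ i) (hk : i + k + 1 ≤ b) :
    L (i + k) - L i ≤ k * (L (i + k + 1) - L (i + k)) := by
  induction k generalizing i with
  | zero => simp
  | succ k ih =>
    have h1 := ih (i := i + 1) (by omega) (by omega)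
    have h2 := increments_mono hL hi (k + 1) (by omega)
    have e1 : i + 1 + k = i + (k + 1) := by ring
    rw [e1] at h1
    push_cast
    linarith

/-- A discretely convex sequence has a supporting line at every index. -/
lemma exists_supporting_slope {a b : ℕ} {L : ℕ → ℝ}
    (hL : ∀ r, a ≤ r → r + 2 ≤ b → 2 * L (r + 1) ≤ L r + L (r + 2)) {r : ℕ}
    (hr : r ∈ Icc a b) : ∃ c : ℝ, ∀ j ∈ Icc a b, L r + c * ((j : ℝ) - r) ≤ L j := by
  obtain ⟨har, hrb⟩ := mem_Icc.1 hr
  rcases hrb.lt_or_eq with hlt | rfl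
  · refine ⟨L (r + 1) - L r, fun j hj => ?_⟩
    obtain ⟨haj, hjb⟩ := mem_Icc.1 hj
    rcases le_total r j with h | h
    · obtain ⟨k, rfl⟩ := Nat.exists_eq_add_of_le h
      have := le_of_slope_right hL har k hjb
      push_cast
      linarith
    · obtain ⟨k, rfl⟩ := Nat.exists_eq_add_of_le h
      have := le_of_slope_left hL k haj hlt
      push_cast
      linarith
  · rcases har.lt_or_eq with hlt | rfl
    · obtain ⟨q, rfl⟩ : ∃ q, r = q + 1 := ⟨r - 1, by omega⟩
      refine ⟨L (q + 1) - L q, fun j hj => ?_⟩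
      obtain ⟨haj, hjb⟩ := mem_Icc.1 hj
      rcases hjb.lt_or_eq with h | rfl
      · obtain ⟨k, rfl⟩ := Nat.exists_eq_add_of_le (Nat.lt_succ_iff.1 h)
        have := le_of_slope_left hL k haj le_rfl
        push_cast
        linarith
      · simp
    · refine ⟨0, fun j hj => ?_⟩
      obtain ⟨haj, hjb⟩ := mem_Icc.1 hj
      rw [le_antisymm hjb haj]
      simp

lemma lowerConvexEnvelope_natCast {a b : ℕ} {L : ℕ → ℝ}
    (hL : ∀ r, a ≤ r → r + 2 ≤ b → 2 * L (r + 1) ≤ L r + L (r + 2)) {r : ℕ}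
    (hr : r ∈ Icc a b) :
    lowerConvexEnvelope {p : ℝ × ℝ | ∃ r ∈ Set.Icc a b, p = ((r : ℝ), L r)} r = L r := by
  have hmem : L r ∈ {y | ((r : ℝ), y) ∈
      convexHull ℝ {p : ℝ × ℝ | ∃ r ∈ Set.Icc a b, p = ((r : ℝ), L r)}} :=
    subset_convexHull ℝ _ ⟨r, mem_Icc.1 hr, rfl⟩
  refine le_antisymm (csInf_le (isCompact_graphFiber a b L _).bddBelow hmem)
    (le_csInf ⟨_, hmem⟩ fun y hy => ?_)
  obtain ⟨w, hw, hw1, hx, rfl⟩ := mem_convexHull_graphPoints.1 hy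
  obtain ⟨c, hc⟩ := exists_supporting_slope hL hr
  calc L r = ∑ j ∈ Icc a b, w j * (L r + c * ((j : ℝ) - r)) := by
        have : ∀ j ∈ Icc a b, w j * (L r + c * ((j : ℝ) - r)) =
            (L r - c * r) * w j + c * (w j * j) := fun j _ => by ring
        rw [sum_congr rfl this, sum_add_distrib, ← mul_sum, ← mul_sum, hw1, hx]
        ring
    _ ≤ ∑ j ∈ Icc a b, w j * L j :=
        sum_le_sum fun j hj => mul_le_mul_of_nonneg_left (hc j hj) (hw j hj)

lemma loadCDCEnv_natCast {r s K : ℕ} (hs : 1 ≤ s) (hsK : s ≤ K) (hr : r ∈ Icc 1 K) :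
    loadCDCEnv r s K = loadCDC r s K :=
  lowerConvexEnvelope_natCast (L := fun r => loadCDC r s K)
    (fun _ h1 h2 => loadCDC_convex hs hsK h1 h2) hr

lemma loadACDCEnv_natCast {r s K : ℕ} (hs : 1 ≤ s) (hsK : s ≤ K) (hr : r ∈ Icc 0 K) :
    loadACDCEnv r s K = loadACDC r s K :=
  lowerConvexEnvelope_natCast (L := fun r => loadACDC r s K)
    (fun _ _ h2 => loadACDC_convex hs hsK h2) hr

end Envelope

/-! ### Delivery of intermediate values by multicasting -/

section Delivery

variable {K N Q V : ℕ}

/-- A node that maps the files in `A` cannot tell the intermediate values `v` and `v'` apart. -/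
def AgreeOn (A : Finset (Fin N)) (v v' : Fin Q → Fin N → Bits V) : Prop :=
  ∀ q, ∀ n ∈ A, v q n = v' q n

/-- With `L` multicast bits in total, every node `k` can be put into a position where it confuses
`v` and `v'` only if `D k v v'` holds. The messages are functions of the values known locally. -/
def Deliverable (mapped : Fin K → Finset (Fin N))
    (D : Fin K → (Fin Q → Fin N → Bits V) → (Fin Q → Fin N → Bits V) → Prop) (L : ℝ) : Prop :=
  ∃ (len : Fin K → ℕ) (enc : ∀ k, (Fin Q → Fin N → Bits V) → Bits (len k)),
    ((∑ k, len k : ℕ) : ℝ) = L ∧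
    (∀ k v v', AgreeOn (mapped k) v v' → enc k v = enc k v') ∧
    ∀ k v v', AgreeOn (mapped k) v v' → (∀ j, enc j v = enc j v') → D k v v'

namespace Deliverable

variable {mapped : Fin K → Finset (Fin N)}
  {D D' : Fin K → (Fin Q → Fin N → Bits V) → (Fin Q → Fin N → Bits V) → Prop} {L L' : ℝ}

lemma mono (h : Deliverable mapped D L)
    (hD : ∀ k v v', AgreeOn (mapped k) v v' → D k v v' → D' k v v') :
    Deliverable mapped D' L := by
  obtain ⟨len, enc, h1, h2, h3⟩ := h
  exact ⟨len, enc, h1, h2, fun k v v' ha he => hD k v v' ha (h3 k v v' ha he)⟩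

lemma trivial : Deliverable mapped (fun _ (_ _ : Fin Q → Fin N → Bits V) => True) 0 :=
  ⟨fun _ => 0, fun _ _ i => i.elim0, by simp, fun _ _ _ _ => rfl, fun _ _ _ _ _ => True.intro⟩

lemma and (h : Deliverable mapped D L) (h' : Deliverable mapped D' L') :
    Deliverable mapped (fun k v v' => D k v v' ∧ D' k v v') (L + L') := by
  obtain ⟨len, enc, h1, h2, h3⟩ := h
  obtain ⟨len', enc', h1', h2', h3'⟩ := h'
  refine ⟨fun k => len k + len' k, fun k v => Fin.append (enc k v) (enc' k v), ?_, ?_, ?_⟩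
  · rw [sum_add_distrib, Nat.cast_add, h1, h1']
  · intro k v v' ha
    simp only [h2 k v v' ha, h2' k v v' ha]
  · intro k v v' ha he
    have he1 (j : Fin K) : enc j v = enc j v' := by
      ext i
      simpa using congrFun (he j) (Fin.castAdd _ i)
    have he2 (j : Fin K) : enc' j v = enc' j v' := by
      ext i
      simpa using congrFun (he j) (Fin.natAdd _ i)
    exact ⟨h3 k v v' ha he1, h3' k v v' ha he2⟩

lemma forall_mem {τ : Type*} (S : Finset τ)
    {D : τ → Fin K → (Fin Q → Fin N → Bits V) → (Fin Q → Fin N → Bits V) → Prop} {L : τ → ℝ}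
    (h : ∀ i ∈ S, Deliverable mapped (D i) (L i)) :
    Deliverable mapped (fun k v v' => ∀ i ∈ S, D i k v v') (∑ i ∈ S, L i) := by
  classical
  induction S using Finset.induction_on with
  | empty =>
    rw [sum_empty]
    exact trivial.mono fun _ _ _ _ _ i hi => absurd hi (notMem_empty i)
  | insert a S ha ih =>
    rw [sum_insert ha]
    refine ((h a (mem_insert_self a S)).and
      (ih fun i hi => h i (mem_insert_of_mem hi))).mono fun k v v' _ hD i hi => ?_
    rcases mem_insert.1 hi with rfl | hi
    exacts [hD.1, hD.2 i hi]

lemma of_sender {β : Type*} [Fintype β] {n : ℕ} (hβ : Fintype.card β ≤ 2 ^ n) (k₀ : Fin K)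
    (X : (Fin Q → Fin N → Bits V) → β)
    (hX : ∀ v v', AgreeOn (mapped k₀) v v' → X v = X v') :
    Deliverable mapped (fun _ v v' => X v = X v') n := by
  classical
  have hcard : Fintype.card β ≤ Fintype.card (Bits n) := by simpa using hβ
  obtain ⟨e⟩ := Function.Embedding.nonempty_of_card_le hcard
  refine ⟨fun k => if k = k₀ then n else 0,
    fun k v i => if h : k = k₀ then e (X v) (Fin.cast (by simp [h]) i) else false, by simp, ?_, ?_⟩
  · rintro k v v' ha
    by_cases h : k = k₀
    · subst h
      simp only [hX v v' ha]
    · simp [h]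
  · intro k v v' _ he
    apply e.injective
    ext i
    simpa using congrFun (he k₀) (Fin.cast (by simp) i)

/-- A node that multicasts `d` generalized Reed–Solomon parity symbols of its items lets everybody
who is uncertain about at most `d` of the items recover all of them. -/
lemma parity_symbols {F τ : Type*} [Field F] [Fintype F] {m : ℕ} (hF : Fintype.card F = 2 ^ m)
    (k₀ : Fin K) (T : Finset τ) (hT : T.card ≤ Fintype.card F)
    (x : τ → (Fin Q → Fin N → Bits V) → F)
    (hx : ∀ t ∈ T, ∀ v v', AgreeOn (mapped k₀) v v' → x t v = x t v') (d : ℕ) :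
    Deliverable mapped (fun _ v v' => ∀ B ⊆ T, (∀ t ∈ T, t ∉ B → x t v = x t v') → B.card ≤ d →
      ∀ t ∈ T, x t v = x t v') ((m * d : ℕ) : ℝ) := by
  classical
  have : ∃ pt : τ → F, Set.InjOn pt T := by
    have hc : Fintype.card T ≤ Fintype.card F := by simpa using hT
    obtain ⟨e⟩ := Function.Embedding.nonempty_of_card_le hc
    refine ⟨fun t => if h : t ∈ T then e ⟨t, h⟩ else 0, fun t ht t' ht' h => ?_⟩
    have ht : t ∈ T := ht
    have ht' : t' ∈ T := ht'
    simp only [ht, ht', dif_pos] at h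
    simpa using e.injective h
  obtain ⟨pt, hpt⟩ := this
  have hcard : Fintype.card (Fin d → F) ≤ 2 ^ (m * d) := by
    rw [Fintype.card_fun, hF, Fintype.card_fin, pow_mul]
  refine (of_sender hcard k₀ (fun v i => ∑ t ∈ T, x t v * pt t ^ (i : ℕ)) ?_).mono ?_
  · intro v v' ha
    ext i
    exact sum_congr rfl fun t ht => by rw [hx t ht v v' ha]
  · intro _ v v' _ he B hBT hB hBd t ht
    by_cases htB : t ∈ B
    swap
    · exact hB t ht htB
    have hzero := Matrix.eq_zero_of_forall_pow_sum_mul_pow_eq_zero (R := F)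
      (f := fun j : Fin B.card => pt (B.equivFin.symm j))
      (v := fun j : Fin B.card => x (B.equivFin.symm j) v - x (B.equivFin.symm j) v')
      (by
        intro i j hij
        have := hpt (hBT (B.equivFin.symm i).2) (hBT (B.equivFin.symm j).2) hij
        exact B.equivFin.symm.injective (Subtype.ext this))
      (by
        intro i
        have h1 := congrFun he ⟨i, by omega⟩
        simp only at h1
        rw [Equiv.sum_comp B.equivFin.symm
          (fun t : B => (x t v - x t v') * pt t ^ (i : ℕ)),
          sum_coe_sort B (fun t => (x t v - x t v') * pt t ^ (i : ℕ)),
          sum_subset hBT (fun t ht htB => by rw [hB t ht htB, sub_self, zero_mul])]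
        simp only [sub_mul, sum_sub_distrib, h1, sub_self])
    have := congrFun hzero (B.equivFin ⟨t, htB⟩)
    simpa [sub_eq_zero] using this

end Deliverable

end Delivery

/-! ### Coded multicasting within a group of nodes -/

section GroupDelivery

variable {K N Q V : ℕ}

lemma exists_field_card (m : ℕ) :
    ∃ (F : Type) (_ : Field F) (_ : Fintype F), Fintype.card F = 2 ^ (m + 1) := by
  let _ : Fintype (GaloisField 2 (m + 1)) := Fintype.ofFinite _
  refine ⟨GaloisField 2 (m + 1), inferInstance, inferInstance, ?_⟩
  rw [← GaloisField.card 2 (m + 1) (Nat.succ_ne_zero m), Nat.card_eq_fintype_card]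

lemma card_powersetCard_filter_mem_notMem {U : Finset (Fin K)} {r : ℕ} {j k : Fin K} (hj : j ∈ U)
    (hk : k ∈ U) (hjk : j ≠ k) :
    ((U.powersetCard r).filter fun R => k ∈ R ∧ j ∉ R).card ≤ (U.card - 2).choose (r - 1) := by
  have h : ((U.erase j).erase k).card = U.card - 2 := by
    rw [card_erase_of_mem (mem_erase.2 ⟨hjk.symm, hk⟩), card_erase_of_mem hj]
    omega
  rw [← h, ← card_powersetCard]
  refine card_le_card_of_injOn (fun R => R.erase k) ?_ ?_
  · intro R hR
    simp only [mem_coe, mem_filter, mem_powersetCard] at hR ⊢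
    obtain ⟨⟨hRU, hRc⟩, hkR, hjR⟩ := hR
    refine ⟨erase_subset_erase _ (subset_erase.2 ⟨hRU, hjR⟩), ?_⟩
    rw [card_erase_of_mem hkR, hRc]
  · intro R hR R' hR' h
    simp only [mem_coe, mem_filter] at hR hR'
    rw [← insert_erase hR.2.1, ← insert_erase hR'.2.1]
    exact congrArg (insert k) h

lemma card_powersetCard_filter_notMem {U : Finset (Fin K)} {r : ℕ} {j : Fin K} (hj : j ∈ U) :
    ((U.powersetCard r).filter fun R => j ∉ R).card = (U.card - 1).choose r := by
  rw [← card_erase_of_mem hj, ← card_powersetCard]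
  congr 1
  ext R
  simp only [mem_filter, mem_powersetCard, subset_erase]
  tauto

namespace Deliverable

variable {mapped : Fin K → Finset (Fin N)}

/-- Coded multicasting inside `U` without helper: for every `r`-subset `R` of `U` the value `y R`
is known in `R` and wanted in `U \ R`. It is cut into `r` segments, one for each node in `R`, and
every node in `U` multicasts parity symbols of its segments. -/
lemma cdc_group {V' m r : ℕ} (hr : 1 ≤ r) (hV : V = r * (V' * (m + 1))) (hm : K ≤ m + 1)
    (U : Finset (Fin K)) (y : Finset (Fin K) → (Fin Q → Fin N → Bits V) → Bits V)
    (hy : ∀ R ∈ U.powersetCard r, ∀ k ∈ R, ∀ v v', AgreeOn (mapped k) v v' → y R v = y R v') :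
    Deliverable mapped (fun j v v' => j ∈ U → ∀ R ∈ U.powersetCard r, y R v = y R v')
      ((U.card * (V' * ((m + 1) * (U.card - 2).choose (r - 1))) : ℕ) : ℝ) := by
  classical
  obtain ⟨F, _, _, hF⟩ := exists_field_card m
  have hcard : Fintype.card (Bits V) = Fintype.card (Fin r → Fin V' → F) := by
    simp only [Bits, Fintype.card_fun, Fintype.card_fin, Fintype.card_bool, hF]
    rw [← pow_mul, ← pow_mul, hV]
    congr 1
    ring
  have e := Fintype.equivOfCardEq hcard
  -- the segment of `R` that the node `k` takes care of
  have hidx : ∃ idx : Finset (Fin K) → Fin K → Fin r,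
      ∀ R ∈ U.powersetCard r, ∀ i, ∃ k ∈ R, idx R k = i := by
    refine ⟨fun R k => if h : R.card = r ∧ k ∈ R then R.equivFinOfCardEq h.1 ⟨k, h.2⟩
      else ⟨0, hr⟩, fun R hR i => ?_⟩
    have hRc := (mem_powersetCard.1 hR).2
    refine ⟨(R.equivFinOfCardEq hRc).symm i, coe_mem _, ?_⟩
    simp [hRc]
  obtain ⟨idx, hidx⟩ := hidx
  have hT (k : Fin K) : ((U.powersetCard r).filter fun R => k ∈ R).card ≤ Fintype.card F := by
    calc _ ≤ (univ : Finset (Finset (Fin K))).card := card_le_card (subset_univ _)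
      _ = 2 ^ K := by simp
      _ ≤ Fintype.card F := by rw [hF]; exact Nat.pow_le_pow_right (by norm_num) hm
  have h := forall_mem (mapped := mapped) U fun k (_ : k ∈ U) =>
    forall_mem (mapped := mapped) (univ : Finset (Fin V')) fun c _ =>
      parity_symbols hF k _ (hT k) (fun R v => e (y R v) (idx R k) c)
        (fun R hR v v' ha => by
          rw [hy R (mem_filter.1 hR).1 k (mem_filter.1 hR).2 v v' ha])
        ((U.card - 2).choose (r - 1))
  simp only [sum_const, nsmul_eq_mul, card_univ, Fintype.card_fin] at h
  rw [Nat.cast_mul, Nat.cast_mul]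
  refine h.mono fun j v v' ha hD hjU R hR => ?_
  by_cases hjR : j ∈ R
  · exact hy R hR j hjR v v' ha
  apply e.injective
  ext i c
  obtain ⟨k, hkR, rfl⟩ := hidx R hR i
  have hkU := (mem_powersetCard.1 hR).1 hkR
  have hjk : j ≠ k := fun h => hjR (h ▸ hkR)
  refine hD k hkU c (mem_univ c) ((U.powersetCard r).filter fun R => k ∈ R ∧ j ∉ R) ?_ ?_
    (card_powersetCard_filter_mem_notMem hjU hkU hjk) R (mem_filter.2 ⟨hR, hkR⟩)
  · intro R' hR'
    simp only [mem_filter] at hR' ⊢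
    exact ⟨hR'.1, hR'.2.1⟩
  · intro R' hR' hjR'
    simp only [mem_filter] at hR' hjR'
    have : j ∈ R' := by tauto
    rw [hy R' hR'.1 j this v v' ha]

/-- Coded multicasting by a helper `h`, who knows all the values `y R`. -/
lemma helper_group {V' m r : ℕ} (hV : V = V' * (m + 1)) (hm : K ≤ m + 1) (h : Fin K)
    (U : Finset (Fin K)) (y : Finset (Fin K) → (Fin Q → Fin N → Bits V) → Bits V)
    (hyh : ∀ R ∈ U.powersetCard r, ∀ v v', AgreeOn (mapped h) v v' → y R v = y R v')
    (hy : ∀ R ∈ U.powersetCard r, ∀ k ∈ R, ∀ v v', AgreeOn (mapped k) v v' → y R v = y R v') :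
    Deliverable mapped (fun j v v' => j ∈ U → ∀ R ∈ U.powersetCard r, y R v = y R v')
      ((V' * ((m + 1) * (U.card - 1).choose r) : ℕ) : ℝ) := by
  classical
  obtain ⟨F, _, _, hF⟩ := exists_field_card m
  have hcard : Fintype.card (Bits V) = Fintype.card (Fin V' → F) := by
    simp only [Bits, Fintype.card_fun, Fintype.card_fin, Fintype.card_bool, hF]
    rw [← pow_mul, hV]
    congr 1
    ring
  have e := Fintype.equivOfCardEq hcard
  have hT : (U.powersetCard r).card ≤ Fintype.card F := by
    calc _ ≤ (univ : Finset (Finset (Fin K))).card := card_le_card (subset_univ _)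
      _ = 2 ^ K := by simp
      _ ≤ Fintype.card F := by rw [hF]; exact Nat.pow_le_pow_right (by norm_num) hm
  have h := forall_mem (mapped := mapped) (univ : Finset (Fin V')) fun c _ =>
      parity_symbols hF h _ hT (fun R v => e (y R v) c)
        (fun R hR v v' ha => by rw [hyh R hR v v' ha])
        ((U.card - 1).choose r)
  simp only [sum_const, nsmul_eq_mul, card_univ, Fintype.card_fin] at h
  rw [Nat.cast_mul]
  refine h.mono fun j v v' ha hD hjU R hR => ?_
  apply e.injective
  ext c
  refine hD c (mem_univ c) ((U.powersetCard r).filter fun R => j ∉ R) (filter_subset _ _) ?_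
    (card_powersetCard_filter_notMem hjU).le R hR
  intro R' hR' hjR'
  simp only [mem_filter] at hjR'
  have : j ∈ R' := by tauto
  rw [hy R' hR' j this v v' ha]

end Deliverable

end GroupDelivery

/-! ### Delivery for a symmetric placement of the files -/

section PlacedDelivery

variable {K N Q V : ℕ}

/-- The files stored at node `k` when file `n` is stored at the nodes in `R n` and, if `o n` is a
node, also at this helper. -/
def placedFiles (o : Fin N → Option (Fin K)) (R : Fin N → Finset (Fin K)) (k : Fin K) :
    Finset (Fin N) :=
  univ.filter fun n => k ∈ R n ∨ o n = some k

/-- The number of transmissions per intermediate value that is known by `r` nodes among a group of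
`l` nodes which know or want it, without a helper (`none`) and with one (`some h`). -/
noncomputable def codedCost (o : Option (Fin K)) (l r : ℕ) : ℝ :=
  o.elim (((l : ℝ) - r) / (l - 1)) fun _ => ((l : ℝ) - r) / l

lemma mul_choose_sub_two {l r : ℕ} (hl : 2 ≤ l) (hr : 1 ≤ r) :
    (l : ℝ) * (l - 2).choose (r - 1) = r * (l.choose r * (((l : ℝ) - r) / (l - 1))) := by
  obtain ⟨a, rfl⟩ : ∃ a, l = a + 1 + 1 := ⟨l - 2, by omega⟩
  obtain ⟨b, rfl⟩ : ∃ b, r = b + 1 := ⟨r - 1, by omega⟩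
  have e1 : a + 1 + 1 - 2 = a := by omega
  have e2 : (((a + 1 + 1 : ℕ) : ℝ)) - 1 = a + 1 := by push_cast; ring
  have e3 : (((a + 1 + 1 : ℕ) : ℝ)) - ((b + 1 : ℕ) : ℝ) = a + 1 - b := by push_cast; ring
  rw [e1, e2, e3, Nat.add_sub_cancel, mul_div_assoc', mul_div_assoc', eq_div_iff (by positivity)]
  rcases Nat.lt_or_ge (a + 1) b with h | h
  · rw [Nat.choose_eq_zero_of_lt (by omega : a < b),
      Nat.choose_eq_zero_of_lt (by omega : a + 1 + 1 < b + 1)]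
    simp
  · have h1 : ((a + 1 + 1 : ℕ) : ℝ) * (a + 1).choose b =
        (a + 1 + 1).choose (b + 1) * ((b + 1 : ℕ) : ℝ) := by
      exact_mod_cast Nat.add_one_mul_choose_eq (a + 1) b
    have h2 : (a.choose b : ℝ) * (a + 1) = (a + 1).choose b * ((a : ℝ) + 1 - b) := by
      have := Nat.choose_mul_succ_eq a b
      have h3 : ((a : ℝ) + 1 - b) = ((a + 1 - b : ℕ) : ℝ) := by
        rw [Nat.cast_sub h]
        push_cast
        ring
      rw [h3]
      exact_mod_cast this
    linear_combination ((a + 1 + 1 : ℕ) : ℝ) * h2 + ((a : ℝ) + 1 - b) * h1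

lemma choose_sub_one_eq {l : ℕ} (hl : 1 ≤ l) (r : ℕ) :
    ((l - 1).choose r : ℝ) = l.choose r * (((l : ℝ) - r) / l) := by
  obtain ⟨a, rfl⟩ : ∃ a, l = a + 1 := ⟨l - 1, by omega⟩
  rw [Nat.add_sub_cancel, mul_div_assoc', eq_div_iff (by positivity)]
  rcases Nat.lt_or_ge (a + 1) r with h | h
  · rw [Nat.choose_eq_zero_of_lt (by omega : a < r), Nat.choose_eq_zero_of_lt h]
    simp
  · rw [← Nat.cast_sub h]
    exact_mod_cast Nat.choose_mul_succ_eq a r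

lemma Deliverable.coded_group {mapped : Fin K → Finset (Fin N)}
    (hV : ∀ r, 1 ≤ r → r ≤ K → r * (K + 1) ∣ V)
    (o : Option (Fin K)) {r : ℕ} (hor : o = none → 1 ≤ r) (U : Finset (Fin K))
    (y : Finset (Fin K) → (Fin Q → Fin N → Bits V) → Bits V)
    (hy : ∀ R ∈ U.powersetCard r, ∀ k, k ∈ R ∨ o = some k →
      ∀ v v', AgreeOn (mapped k) v v' → y R v = y R v') :
    Deliverable mapped (fun j v v' => j ∈ U → ∀ R ∈ U.powersetCard r, y R v = y R v')
      (V * (U.card.choose r * codedCost o U.card r)) := by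
  classical
  have hUK : U.card ≤ K := by simpa using card_le_univ U
  cases o with
  | none =>
    have hr := hor rfl
    rcases Nat.lt_or_ge U.card r with hlt | hge
    · rw [Nat.choose_eq_zero_of_lt hlt, Nat.cast_zero, zero_mul, mul_zero]
      refine Deliverable.trivial.mono fun j v v' _ _ _ R hR => ?_
      rw [powersetCard_eq_empty.2 hlt] at hR
      exact absurd hR (notMem_empty R)
    rcases Nat.lt_or_ge U.card 2 with hlt | hge2
    · -- a single node already has what it wants
      have h1 : U.card = 1 := by omega
      have h0 : codedCost (none : Option (Fin K)) U.card r = 0 := by simp [codedCost, h1]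
      rw [h0, mul_zero, mul_zero]
      refine Deliverable.trivial.mono fun j v v' ha _ hj R hR => ?_
      have hRc := mem_powersetCard.1 hR
      have hRU : R = U := eq_of_subset_of_card_le hRc.1 (by omega)
      exact hy R hR j (Or.inl (hRU ▸ hj)) v v' ha
    obtain ⟨V', hV'⟩ := hV r hr (hge.trans hUK)
    have h := Deliverable.cdc_group (mapped := mapped) (V' := V') (m := K) hr
      (by rw [hV']; ring) (by omega) U y (fun R hR k hk => hy R hR k (Or.inl hk))
    have hc : ((U.card * (V' * ((K + 1) * (U.card - 2).choose (r - 1))) : ℕ) : ℝ) =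
        V * (U.card.choose r * codedCost (none : Option (Fin K)) U.card r) := by
      have := mul_choose_sub_two hge2 hr
      rw [hV', codedCost]
      push_cast
      simp only [Option.elim_none]
      linear_combination ((V' : ℝ) * (K + 1)) * this
    rwa [hc] at h
  | some h =>
    rcases Nat.eq_zero_or_pos U.card with h0 | hpos
    · have : codedCost (some h) U.card r = 0 := by simp [codedCost, h0]
      rw [this, mul_zero, mul_zero]
      refine Deliverable.trivial.mono fun j v v' _ _ hj => ?_
      rw [card_eq_zero.1 h0] at hj
      exact absurd hj (notMem_empty j)
    obtain ⟨V', hV'⟩ := hV 1 le_rfl (by omega)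
    rw [one_mul] at hV'
    have hg := Deliverable.helper_group (mapped := mapped) (V' := V') (m := K) (r := r)
      (by rw [hV']; ring) (by omega) h U y (fun R hR => hy R hR h (Or.inr rfl))
      (fun R hR k hk => hy R hR k (Or.inl hk))
    have hc : ((V' * ((K + 1) * (U.card - 1).choose r) : ℕ) : ℝ) =
        V * (U.card.choose r * codedCost (some h) U.card r) := by
      have := choose_sub_one_eq hpos r
      rw [hV', codedCost]
      push_cast
      simp only [Option.elim_some]
      linear_combination ((V' : ℝ) * (K + 1)) * this
    rwa [hc] at hg

/-- Delivery of all values with the same helper, the same number `r` of other storing nodes and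
the same group `U` of interested nodes, if the `r`-subsets of `U` hold equally many of them. -/
lemma Deliverable.batch {o : Fin N → Option (Fin K)} {R : Fin N → Finset (Fin K)}
    (hV : ∀ r, 1 ≤ r → r ≤ K → r * (K + 1) ∣ V)
    (assigned : Fin Q → Finset (Fin K)) (o₀ : Option (Fin K)) {r : ℕ} (hor : o₀ = none → 1 ≤ r)
    (U : Finset (Fin K)) (A : Finset (Fin Q × Fin N))
    (hA : ∀ p ∈ A, o p.2 = o₀ ∧ (R p.2).card = r ∧ assigned p.1 ∪ R p.2 = U) {z : ℕ}
    (hz : ∀ R' ∈ U.powersetCard r, (A.filter fun p => R p.2 = R').card = z) :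
    Deliverable (placedFiles o R)
      (fun k (v v' : Fin Q → Fin N → Bits V) =>
        ∀ p ∈ A, k ∈ assigned p.1 → v p.1 p.2 = v' p.1 p.2)
      (V * (A.card * codedCost o₀ U.card r)) := by
  classical
  have hRU : ∀ p ∈ A, R p.2 ∈ U.powersetCard r := by
    intro p hp
    obtain ⟨-, h2, h3⟩ := hA p hp
    exact mem_powersetCard.2 ⟨h3 ▸ subset_union_right, h2⟩
  have hcard : A.card = U.card.choose r * z := by
    rw [card_eq_sum_card_fiberwise hRU, sum_congr rfl hz, sum_const, card_powersetCard,
      smul_eq_mul]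
  -- list the values stored at each `R'`, and serve the `i`-th values of all lists together
  have hy : ∃ y : Fin z → Finset (Fin K) → (Fin Q → Fin N → Bits V) → Bits V,
      (∀ i, ∀ R' ∈ U.powersetCard r, ∃ p ∈ A, R p.2 = R' ∧ ∀ v, y i R' v = v p.1 p.2) ∧
      ∀ p ∈ A, ∃ i, ∀ v, y i (R p.2) v = v p.1 p.2 := by
    have hex : ∀ R' : Finset (Fin K), ∃ y : Fin z → (Fin Q → Fin N → Bits V) → Bits V,
        R' ∈ U.powersetCard r →
        (∀ i, ∃ p ∈ A, R p.2 = R' ∧ ∀ v, y i v = v p.1 p.2) ∧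
        ∀ p ∈ A, R p.2 = R' → ∃ i, ∀ v, y i v = v p.1 p.2 := by
      intro R'
      by_cases h : R' ∈ U.powersetCard r
      · set e := (A.filter fun p => R p.2 = R').equivFinOfCardEq (hz R' h) with he
        refine ⟨fun i v => v (e.symm i).1.1 (e.symm i).1.2, fun _ => ⟨fun i => ?_, ?_⟩⟩
        · have := mem_filter.1 (e.symm i).2
          exact ⟨_, this.1, this.2, fun v => rfl⟩
        · intro p hp hpR
          exact ⟨e ⟨p, mem_filter.2 ⟨hp, hpR⟩⟩, fun v => by simp⟩
      · exact ⟨fun _ _ _ => false, fun h' => absurd h' h⟩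
    choose y hy using hex
    exact ⟨fun i R' => y R' i, fun i R' hR' => (hy R' hR').1 i,
      fun p hp => (hy _ (hRU p hp)).2 p hp rfl⟩
  obtain ⟨y, hy1, hy2⟩ := hy
  have h := Deliverable.forall_mem (mapped := placedFiles o R) (univ : Finset (Fin z))
    fun i _ => Deliverable.coded_group hV o₀ hor U (y i) (by
      intro R' hR' k hk v v' ha
      obtain ⟨p, hp, hpR, hpy⟩ := hy1 i R' hR'
      rw [hpy, hpy]
      apply ha
      simp only [placedFiles, mem_filter, mem_univ, true_and]
      rw [hpR, (hA p hp).1]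
      exact hk)
  simp only [sum_const, nsmul_eq_mul, card_univ, Fintype.card_fin] at h
  have hc : (z : ℝ) * (V * (U.card.choose r * codedCost o₀ U.card r)) =
      V * (A.card * codedCost o₀ U.card r) := by
    rw [hcard]
    push_cast
    ring
  rw [hc] at h
  refine h.mono fun k v v' _ hD p hp hk => ?_
  obtain ⟨i, hi⟩ := hy2 p hp
  rw [← hi v, ← hi v']
  exact hD i (mem_univ i) ((hA p hp).2.2 ▸ mem_union_left _ hk) _ (hRU p hp)

lemma card_filter_union_eq {s : ℕ} {T U R : Finset (Fin K)} (hUT : U ⊆ T) (hRU : R ⊆ U) :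
    ((T.powersetCard s).filter fun P => P ∪ R = U).card =
      if s ≤ U.card ∧ U.card ≤ R.card + s then R.card.choose (U.card - s) else 0 := by
  split_ifs with h
  · have h1 := card_filter_card_union hRU (card_le_card hRU) h.1 h.2
    rw [Nat.choose_self, one_mul] at h1
    rw [← h1]
    congr 1
    ext P
    simp only [mem_filter, mem_powersetCard]
    constructor
    · rintro ⟨⟨-, hP⟩, rfl⟩
      exact ⟨⟨subset_union_left, hP⟩, rfl⟩
    · rintro ⟨⟨hPU, hP⟩, hc⟩
      exact ⟨⟨hPU.trans hUT, hP⟩,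
        eq_of_subset_of_card_le (union_subset hPU hRU) hc.ge⟩
  · rw [card_eq_zero, filter_eq_empty_iff]
    intro P hP hPU
    apply h
    rw [← (mem_powersetCard.1 hP).2, ← hPU]
    exact ⟨card_le_card subset_union_left, by rw [add_comm]; exact card_union_le P R⟩

lemma sum_assigned_eq {assigned : Fin Q → Finset (Fin K)} {𝓢 : Finset (Fin K)} {s η : ℕ}
    (hmem : ∀ q, assigned q ∈ 𝓢.powersetCard s)
    (hbal : ∀ P ∈ 𝓢.powersetCard s, (univ.filter fun q => assigned q = P).card = η)
    (g : Finset (Fin K) → ℝ) :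
    ∑ q, g (assigned q) = η * ∑ P ∈ 𝓢.powersetCard s, g P := by
  rw [← sum_fiberwise_of_maps_to (fun q _ => hmem q), mul_sum]
  refine sum_congr rfl fun P hP => ?_
  rw [sum_congr rfl fun q hq => by rw [(mem_filter.1 hq).2], sum_const, hbal P hP, nsmul_eq_mul]

/-- If the storage of the files is symmetric in the solvers, then all values can be delivered at
their coded cost. -/
lemma Deliverable.all {o : Fin N → Option (Fin K)} {R : Fin N → Finset (Fin K)}
    (hV : ∀ r, 1 ≤ r → r ≤ K → r * (K + 1) ∣ V)
    {assigned : Fin Q → Finset (Fin K)} {𝓢 : Finset (Fin K)} {s η : ℕ}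
    (hmem : ∀ q, assigned q ∈ 𝓢.powersetCard s)
    (hbal : ∀ P ∈ 𝓢.powersetCard s, (univ.filter fun q => assigned q = P).card = η)
    (hR : ∀ n, R n ⊆ 𝓢) (hnone : ∀ n, o n = none → (R n).Nonempty)
    (b : Option (Fin K) → ℕ → ℕ)
    (hb : ∀ o₀, ∀ R' ⊆ 𝓢, (univ.filter fun n => o n = o₀ ∧ R n = R').card = b o₀ R'.card) :
    Deliverable (placedFiles o R)
      (fun k (v v' : Fin Q → Fin N → Bits V) => ∀ q, k ∈ assigned q → ∀ n, v q n = v' q n)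
      (V * ∑ n, ∑ q, codedCost (o n) (assigned q ∪ R n).card (R n).card) := by
  classical
  set key : Fin Q × Fin N → Option (Fin K) × ℕ × Finset (Fin K) :=
    fun p => (o p.2, (R p.2).card, assigned p.1 ∪ R p.2) with hkey
  have hbatch : ∀ κ ∈ univ.image key, Deliverable (placedFiles o R)
      (fun k (v v' : Fin Q → Fin N → Bits V) => ∀ p ∈ univ.filter (fun p => key p = κ),
        k ∈ assigned p.1 → v p.1 p.2 = v' p.1 p.2)
      (V * ∑ p with key p = κ, codedCost (o p.2) (assigned p.1 ∪ R p.2).card (R p.2).card) := by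
    rintro ⟨o₀, r, U⟩ hκ
    obtain ⟨⟨q₀, n₀⟩, -, hp₀⟩ := mem_image.1 hκ
    simp only [hkey, Prod.mk.injEq] at hp₀
    obtain ⟨ho₀, hr₀, hU₀⟩ := hp₀
    have hUS : U ⊆ 𝓢 := hU₀ ▸ union_subset (mem_powersetCard.1 (hmem q₀)).1 (hR n₀)
    have hA : ∀ p ∈ univ.filter (fun p => key p = (o₀, r, U)),
        o p.2 = o₀ ∧ (R p.2).card = r ∧ assigned p.1 ∪ R p.2 = U := by
      intro p hp
      simpa [hkey] using hp
    have hsum : ∑ p with key p = (o₀, r, U),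
        codedCost (o p.2) (assigned p.1 ∪ R p.2).card (R p.2).card =
        (univ.filter fun p => key p = (o₀, r, U)).card * codedCost o₀ U.card r := by
      rw [← nsmul_eq_mul, ← sum_const]
      refine sum_congr rfl fun p hp => ?_
      obtain ⟨h1, h2, h3⟩ := hA p hp
      rw [h1, h2, h3]
    rw [hsum]
    refine Deliverable.batch hV assigned o₀ ?_ U _ hA (z := (η * if s ≤ U.card ∧ U.card ≤ r + s
      then r.choose (U.card - s) else 0) * b o₀ r) ?_
    · intro h
      have := (hnone n₀ (ho₀.trans h)).card_pos
      omega
    · intro R' hR'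
      obtain ⟨hR'U, hR'c⟩ := mem_powersetCard.1 hR'
      have e1 : (univ.filter fun p => key p = (o₀, r, U)).filter (fun p => R p.2 = R') =
          (univ.filter fun q => assigned q ∪ R' = U) ×ˢ
            (univ.filter fun n => o n = o₀ ∧ R n = R') := by
        ext ⟨q, n⟩
        simp only [hkey, mem_filter, mem_univ, true_and, mem_product, Prod.mk.injEq]
        constructor
        · rintro ⟨⟨h1, h2, h3⟩, rfl⟩
          exact ⟨h3, h1, rfl⟩
        · rintro ⟨h3, h1, rfl⟩
          exact ⟨⟨h1, hR'c, h3⟩, rfl⟩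
      have e2 : (univ.filter fun q => assigned q ∪ R' = U).card =
          η * ((𝓢.powersetCard s).filter fun P => P ∪ R' = U).card := by
        rw [card_eq_sum_card_fiberwise (f := assigned)
          (t := (𝓢.powersetCard s).filter fun P => P ∪ R' = U)]
        · rw [mul_comm, ← smul_eq_mul, ← sum_const]
          refine sum_congr rfl fun P hP => ?_
          rw [← hbal P (mem_filter.1 hP).1, filter_filter]
          congr 1
          ext q
          simp only [mem_filter, mem_univ, true_and, and_iff_right_iff_imp]
          rintro rfl
          exact (mem_filter.1 hP).2
        · intro q hq
          exact mem_filter.2 ⟨hmem q, (mem_filter.1 hq).2⟩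
      rw [e1, card_product, e2, card_filter_union_eq hUS hR'U, hb o₀ R' (hR'U.trans hUS), hR'c]
  have h := Deliverable.forall_mem (univ.image key) hbatch
  rw [← mul_sum, sum_fiberwise_of_maps_to (fun p _ => mem_image_of_mem key (mem_univ p)),
    Fintype.sum_prod_type_right] at h
  refine h.mono fun k v v' _ hD q hk n => ?_
  exact hD _ (mem_image_of_mem key (mem_univ (q, n))) (q, n) (by simp) hk

end PlacedDelivery

/-! ### Schemes from deliveries -/

section SchemeOfDelivery

variable {K M N Q s V : ℕ}

/-- A delivery of all wanted values is a scheme: the tables of the Map and Reduce functions are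
known to everybody, so that a node computes its outputs from the delivered values. -/
lemma exists_scheme_of_deliverable {mapped : Fin K → Finset (Fin N)}
    (hcover : ∀ n, ∃ k, n ∈ mapped k) (hstorage : ∑ k, (mapped k).card ≤ M)
    {𝓢 : Finset (Fin K)} {assigned : Fin Q → Finset (Fin K)}
    (hmem : ∀ q, assigned q ∈ 𝓢.powersetCard s)
    (hbal : ∀ P ∈ 𝓢.powersetCard s,
      (univ.filter fun q => assigned q = P).card * 𝓢.card.choose s = Q) {L : ℝ}
    (hL : Deliverable mapped
      (fun k (v v' : Fin Q → Fin N → Bits V) => ∀ q, k ∈ assigned q → ∀ n, v q n = v' q n) L) :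
    ∃ S : Scheme K M N Q s V, S.mapped = mapped ∧ S.assigned = assigned ∧ S.solvers = 𝓢 ∧
      ((∑ k, S.len k : ℕ) : ℝ) = L := by
  classical
  obtain ⟨len, enc, hsum, hloc, hdec⟩ := hL
  -- extension of the local values by zeros
  let ext (A : Finset (Fin N)) (x : LocalVals N Q V A) : Fin Q → Fin N → Bits V :=
    fun q n => if h : n ∈ A then x q ⟨n, h⟩ else fun _ => false
  have hext (k : Fin K) (v : Fin Q → Fin N → Bits V) :
      enc k (ext _ (restrictVals (mapped k) v)) = enc k v := by
    apply hloc
    intro q n hn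
    simp [ext, hn, restrictVals]
  refine ⟨⟨mapped, hcover, hstorage, 𝓢, assigned, hmem, hbal, len,
    fun k x => enc k (ext _ x), ?_⟩, rfl, rfl, rfl, hsum⟩
  intro T
  have hprod : ∀ (k : Fin K) (q : Fin Q), ∃ f : LocalVals N Q V (mapped k) →
      (∀ j, Bits (len j)) → Bits T.B, ∀ ω, k ∈ assigned q →
        f (restrictVals (mapped k) (T.interVal ω)) (fun j => enc j (T.interVal ω)) =
          T.output ω q := by
    intro k q
    refine ⟨fun x m => if h : ∃ ω, restrictVals (mapped k) (T.interVal ω) = x ∧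
      (fun j => enc j (T.interVal ω)) = m then T.output h.choose q else fun _ => false,
      fun ω hk => ?_⟩
    have h : ∃ ω', restrictVals (mapped k) (T.interVal ω') =
        restrictVals (mapped k) (T.interVal ω) ∧
        (fun j => enc j (T.interVal ω')) = fun j => enc j (T.interVal ω) := ⟨ω, rfl, rfl⟩
    beta_reduce
    rw [dif_pos h]
    obtain ⟨h1, h2⟩ := h.choose_spec
    have := hdec k _ _ (fun q n hn => congrFun (congrFun h1 q) ⟨n, hn⟩) (congrFun h2) q hk
    exact congrArg (T.reduceFn q) (funext this)
  choose f hf using hprod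
  refine ⟨f, fun ω k q hk => ?_⟩
  rw [← hf k q ω hk]
  simp only [hext]

end SchemeOfDelivery

/-! ### Reduce assignments -/

section ReduceAssignment

variable {K M N Q s V : ℕ}

lemma exists_balanced_assignment {𝓢 : Finset (Fin K)} (hdvd : 𝓢.card.choose s ∣ Q) :
    ∃ assigned : Fin Q → Finset (Fin K), (∀ q, assigned q ∈ 𝓢.powersetCard s) ∧
      ∀ P ∈ 𝓢.powersetCard s,
        (univ.filter fun q => assigned q = P).card * 𝓢.card.choose s = Q := by
  classical
  obtain ⟨η, rfl⟩ := hdvd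
  have hcard : Fintype.card (Fin (𝓢.card.choose s * η)) =
      Fintype.card ({P // P ∈ 𝓢.powersetCard s} × Fin η) := by
    rw [Fintype.card_prod, Fintype.card_coe, card_powersetCard, Fintype.card_fin, Fintype.card_fin]
  have e := Fintype.equivOfCardEq hcard
  refine ⟨fun q => (e q).1, fun q => (e q).1.2, fun P hP => ?_⟩
  have : (univ.filter fun q => ((e q).1 : Finset (Fin K)) = P).card =
      (univ : Finset (Fin η)).card := by
    refine card_nbij' (fun q => (e q).2) (fun i => e.symm (⟨P, hP⟩, i)) ?_ ?_ ?_ ?_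
    · intro q _
      simp
    · intro i _
      simp
    · intro q hq
      simp only [mem_coe, mem_filter, mem_univ, true_and] at hq
      subst hq
      simp
    · intro i _
      simp
  rw [this, card_univ, Fintype.card_fin, mul_comm]

lemma card_powersetCard_filter_mem {T : Finset (Fin K)} {k : Fin K} (hk : k ∈ T) (s : ℕ) :
    ((T.powersetCard s).filter fun P => k ∈ P).card * T.card = s * T.card.choose s := by
  have h1 : T.card = (T.card - 1) + 1 := by
    have := card_pos.2 ⟨k, hk⟩
    omega
  cases s with
  | zero => simp
  | succ s =>
    have h2 : ((T.powersetCard (s + 1)).filter fun P => k ∈ P).card = (T.card - 1).choose s := by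
      have h3 := card_powersetCard_filter_notMem (r := s + 1) hk
      have h4 := card_filter_add_card_filter_not (s := T.powersetCard (s + 1)) (fun P => k ∈ P)
      rw [card_powersetCard, h3] at h4
      have h5 := Nat.choose_succ_succ (T.card - 1) s
      rw [← Nat.succ_eq_add_one] at h1
      rw [← h1] at h5
      simp only [Nat.succ_eq_add_one] at h5
      omega
    rw [h2]
    have := Nat.add_one_mul_choose_eq (T.card - 1) s
    rw [← h1] at this
    linarith

namespace Scheme

lemma s_le_card (S : Scheme K M N Q s V) (hQ : 0 < Q) : s ≤ S.solvers.card := by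
  have h := mem_powersetCard.1 (S.assigned_mem ⟨0, hQ⟩)
  exact h.2.symm.le.trans (card_le_card h.1)

lemma card_batch (S : Scheme K M N Q s V) (hQ : 0 < Q) {P : Finset (Fin K)}
    (hP : P ∈ S.solvers.powersetCard s) :
    (univ.filter fun q => S.assigned q = P).card = Q / S.solvers.card.choose s := by
  have h := S.balanced P hP
  have h1 := Nat.choose_pos (S.s_le_card hQ)
  exact (Nat.div_eq_of_eq_mul_left h1 h.symm).symm

lemma choose_dvd (S : Scheme K M N Q s V) (hQ : 0 < Q) : S.solvers.card.choose s ∣ Q :=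
  ⟨_, ((mul_comm _ _).trans (S.balanced _ (S.assigned_mem ⟨0, hQ⟩))).symm⟩

lemma card_reduceSet_mul (S : Scheme K M N Q s V) (hQ : 0 < Q) {k : Fin K} (hk : k ∈ S.solvers) :
    (S.reduceSet k).card * S.solvers.card = s * Q := by
  classical
  have h1 : (S.reduceSet k).card = ∑ P ∈ S.solvers.powersetCard s with k ∈ P,
      (univ.filter fun q => S.assigned q = P).card := by
    rw [card_eq_sum_card_fiberwise (f := S.assigned)
      (t := (S.solvers.powersetCard s).filter fun P => k ∈ P)]
    · refine sum_congr rfl fun P hP => ?_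
      rw [reduceSet, filter_filter]
      congr 1
      ext q
      simp only [mem_filter, mem_univ, true_and, and_iff_right_iff_imp]
      rintro rfl
      exact (mem_filter.1 hP).2
    · intro q hq
      exact mem_filter.2 ⟨S.assigned_mem q, (mem_filter.1 hq).2⟩
  rw [h1, sum_congr rfl fun P hP => S.card_batch hQ (mem_filter.1 hP).1, sum_const, smul_eq_mul,
    mul_right_comm, card_powersetCard_filter_mem hk, mul_assoc,
    Nat.mul_div_cancel' (S.choose_dvd hQ)]

lemma sup_card_reduceSet (S : Scheme K M N Q s V) (hQ : 0 < Q) (hs : 1 ≤ s) :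
    ((univ.sup fun k => (S.reduceSet k).card : ℕ) : ℝ) = (s : ℝ) * Q / S.solvers.card := by
  have hpos : 0 < S.solvers.card := hs.trans (S.s_le_card hQ)
  obtain ⟨k₀, hk₀⟩ := card_pos.1 hpos
  have h : (univ.sup fun k => (S.reduceSet k).card) = (S.reduceSet k₀).card := by
    apply le_antisymm
    · refine Finset.sup_le fun k _ => ?_
      by_cases hk : k ∈ S.solvers
      · refine le_of_mul_le_mul_right ?_ hpos
        rw [S.card_reduceSet_mul hQ hk, S.card_reduceSet_mul hQ hk₀]
      · have : S.reduceSet k = ∅ := by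
          rw [reduceSet, filter_eq_empty_iff]
          exact fun q _ hq => hk ((mem_powersetCard.1 (S.assigned_mem q)).1 hq)
        rw [this]
        simp
    · exact le_sup (f := fun k => (S.reduceSet k).card) (mem_univ k₀)
  rw [h, eq_div_iff (by exact_mod_cast hpos.ne')]
  exact_mod_cast S.card_reduceSet_mul hQ hk₀

end Scheme

/-- Multicasting everything is a scheme, for any bit length of the intermediate values. -/
lemma exists_scheme (hN : N ≤ M) (hs : 1 ≤ s) (hsK : s ≤ K) :
    Nonempty (Scheme K M N Q s V) := by
  classical
  obtain ⟨𝓢, -, h𝓢⟩ := exists_subset_card_eq (s := (univ : Finset (Fin K))) (n := s) (by simpa)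
  obtain ⟨k₀, -⟩ := card_pos.1 (by omega : 0 < 𝓢.card)
  obtain ⟨assigned, h1, h2⟩ := exists_balanced_assignment (K := K) (Q := Q) (𝓢 := 𝓢) (s := s)
    (by rw [h𝓢, Nat.choose_self]; exact one_dvd _)
  have hdel : Deliverable (fun k : Fin K => if k = k₀ then (univ : Finset (Fin N)) else ∅)
      (fun k (v v' : Fin Q → Fin N → Bits V) => ∀ q, k ∈ assigned q → ∀ n, v q n = v' q n)
      (Fintype.card (Fin Q → Fin N → Bits V)) := by
    refine (Deliverable.of_sender (β := Fin Q → Fin N → Bits V) Nat.lt_two_pow_self.le k₀ id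
      (fun v v' ha => ?_)).mono fun k v v' _ h q _ n => congrFun (congrFun h q) n
    ext1 q
    ext1 n
    exact ha q n (by simp)
  obtain ⟨S, -⟩ := exists_scheme_of_deliverable (M := M) (fun n => ⟨k₀, by simp⟩)
    (by
      rw [sum_eq_single k₀ (by intro k _ hk; simp [hk]) (by simp)]
      simpa using hN) h1 h2 hdel
  exact ⟨S⟩

end ReduceAssignment

/-! ### Coded schemes with prescribed numbers of files of each type -/

section Placement

variable {K N : ℕ}

lemma exists_placement (𝓢 : Finset (Fin K)) (cnt : Option (Fin K) → ℕ → ℕ)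
    (hN : ∑ o, ∑ R ∈ 𝓢.powerset, cnt o R.card = N) :
    ∃ (o : Fin N → Option (Fin K)) (R : Fin N → Finset (Fin K)), (∀ n, R n ⊆ 𝓢) ∧
      ∀ o₀, ∀ R' ⊆ 𝓢, (univ.filter fun n => o n = o₀ ∧ R n = R').card = cnt o₀ R'.card := by
  classical
  have hcard : Fintype.card (Fin N) = Fintype.card
      (Σ x : Option (Fin K) × {R // R ∈ 𝓢.powerset}, Fin (cnt x.1 x.2.1.card)) := by
    rw [Fintype.card_sigma, Fintype.sum_prod_type, Fintype.card_fin, ← hN]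
    refine sum_congr rfl fun o _ => ?_
    simp only [Fintype.card_fin]
    exact (sum_coe_sort 𝓢.powerset fun R => cnt o R.card).symm
  have e := Fintype.equivOfCardEq hcard
  refine ⟨fun n => (e n).1.1, fun n => (e n).1.2.1, fun n => mem_powerset.1 (e n).1.2.2,
    fun o₀ R' hR' => ?_⟩
  let x : Option (Fin K) × {R // R ∈ 𝓢.powerset} := (o₀, ⟨R', mem_powerset.2 hR'⟩)
  rw [← Fintype.card_fin (cnt o₀ R'.card), ← card_univ]
  symm
  refine card_bij (fun (i : Fin (cnt x.1 x.2.1.card)) _ => e.symm ⟨x, i⟩) ?_ ?_ ?_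
  · intro i _
    simp [x]
  · intro i _ j _ h
    simpa using h
  · intro n hn
    simp only [mem_filter, mem_univ, true_and] at hn
    have hx : (e n).1 = x := Prod.ext hn.1 (Subtype.ext hn.2)
    have hex : ∀ y : (Σ x : Option (Fin K) × {R // R ∈ 𝓢.powerset}, Fin (cnt x.1 x.2.1.card)),
        y.1 = x → ∃ i, ⟨x, i⟩ = y := by
      rintro ⟨x', i⟩ h
      simp only at h
      subst h
      exact ⟨i, rfl⟩
    obtain ⟨i, hi⟩ := hex (e n) hx
    exact ⟨i, mem_univ _, by rw [hi, e.symm_apply_apply]⟩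

lemma sum_placement {𝓢 : Finset (Fin K)} {cnt : Option (Fin K) → ℕ → ℕ}
    {o : Fin N → Option (Fin K)} {R : Fin N → Finset (Fin K)} (hR : ∀ n, R n ⊆ 𝓢)
    (hcnt : ∀ o₀, ∀ R' ⊆ 𝓢, (univ.filter fun n => o n = o₀ ∧ R n = R').card = cnt o₀ R'.card)
    (G : Option (Fin K) → Finset (Fin K) → ℝ) :
    ∑ n, G (o n) (R n) = ∑ o₀, ∑ R' ∈ 𝓢.powerset, cnt o₀ R'.card * G o₀ R' := by
  rw [← sum_product', ← sum_fiberwise_of_maps_to (g := fun n => (o n, R n))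
    (t := univ ×ˢ 𝓢.powerset)
    (fun n _ => mem_product.2 ⟨mem_univ _, mem_powerset.2 (hR n)⟩)]
  refine sum_congr rfl fun x hx => ?_
  rw [← hcnt x.1 x.2 (mem_powerset.1 (mem_product.1 hx).2), ← nsmul_eq_mul, ← sum_const]
  have hf : (univ.filter fun n => (o n, R n) = x) =
      univ.filter fun n => o n = x.1 ∧ R n = x.2 := by
    ext n
    simp [Prod.ext_iff]
  rw [hf]
  refine sum_congr rfl fun n hn => ?_
  rw [(mem_filter.1 hn).2.1, (mem_filter.1 hn).2.2]

lemma sum_powerset_mem {𝓢 : Finset (Fin K)} {k : Fin K} (hk : k ∈ 𝓢) (f : ℕ → ℝ) :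
    ∑ R ∈ 𝓢.powerset, f R.card * (if k ∈ R then 1 else 0) =
      ∑ R ∈ 𝓢.powerset, f R.card * (R.card / 𝓢.card) := by
  rw [sum_powerset, sum_powerset]
  refine sum_congr rfl fun r _ => ?_
  have h1 : ∑ R ∈ 𝓢.powersetCard r, f R.card * (if k ∈ R then 1 else 0) =
      f r * ((𝓢.powersetCard r).filter fun R => k ∈ R).card := by
    rw [card_filter, Nat.cast_sum, mul_sum]
    refine sum_congr rfl fun R hR => ?_
    rw [(mem_powersetCard.1 hR).2]
    simp
  have h2 : ∑ R ∈ 𝓢.powersetCard r, f R.card * ((R.card : ℝ) / 𝓢.card) =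
      𝓢.card.choose r * (f r * (r / 𝓢.card)) := by
    rw [← card_powersetCard, ← nsmul_eq_mul, ← sum_const]
    refine sum_congr rfl fun R hR => ?_
    rw [(mem_powersetCard.1 hR).2]
  have h3 : (𝓢.card : ℝ) ≠ 0 := by exact_mod_cast (card_pos.2 ⟨k, hk⟩).ne'
  have h4 : (((𝓢.powersetCard r).filter fun R => k ∈ R).card : ℝ) * 𝓢.card =
      r * 𝓢.card.choose r := by exact_mod_cast card_powersetCard_filter_mem hk r
  rw [h1, h2]
  field_simp
  linear_combination f r * h4

/-- The number of files stored at each `r`-set of solvers (and the given helper): `β₁ r` without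
helper, `β₂ r` for each helper in `𝓗`, and `E` files stored at the single node `k₀`. -/
def slotCount (𝓗 : Finset (Fin K)) (k₀ : Fin K) (β₁ β₂ : ℕ → ℕ) (E : ℕ) :
    Option (Fin K) → ℕ → ℕ
  | none, r => if r = 0 then 0 else β₁ r
  | some h, r => if h ∈ 𝓗 then β₂ r else if h = k₀ ∧ r = 0 then E else 0

lemma sum_slotCount (𝓢 𝓗 : Finset (Fin K)) {k₀ : Fin K} (hk₀ : k₀ ∉ 𝓗) (β₁ β₂ : ℕ → ℕ) (E : ℕ)
    (g : Option (Fin K) → ℕ → ℝ) :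
    ∑ o, ∑ R ∈ 𝓢.powerset, (slotCount 𝓗 k₀ β₁ β₂ E o R.card : ℝ) * g o R.card =
      ∑ r ∈ Icc 1 𝓢.card, (β₁ r : ℝ) * 𝓢.card.choose r * g none r +
      ∑ h ∈ 𝓗, ∑ r ∈ Icc 0 𝓢.card, (β₂ r : ℝ) * 𝓢.card.choose r * g (some h) r +
      E * g (some k₀) 0 := by
  have h0 (o : Option (Fin K)) :
      ∑ R ∈ 𝓢.powerset, (slotCount 𝓗 k₀ β₁ β₂ E o R.card : ℝ) * g o R.card =
        ∑ r ∈ Icc 0 𝓢.card, (slotCount 𝓗 k₀ β₁ β₂ E o r : ℝ) * 𝓢.card.choose r * g o r := by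
    rw [sum_powerset_apply_card (fun r => (slotCount 𝓗 k₀ β₁ β₂ E o r : ℝ) * g o r),
      range_eq_Ico]
    refine sum_congr rfl fun r _ => ?_
    rw [nsmul_eq_mul]
    ring
  simp only [h0]
  rw [Fintype.sum_option, add_assoc]
  congr 1
  · rw [← add_sum_Ioc_eq_sum_Icc (Nat.zero_le _)]
    simp only [slotCount, if_true, Nat.cast_zero, zero_mul, zero_add]
    refine sum_congr rfl fun r hr => ?_
    rw [if_neg (by have := (mem_Ioc.1 hr).1; omega)]
  · rw [← sum_sdiff (subset_univ 𝓗), add_comm]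
    congr 1
    · refine sum_congr rfl fun h hh => sum_congr rfl fun r _ => ?_
      simp [slotCount, hh]
    · rw [sum_eq_single_of_mem k₀ (by simpa using hk₀)]
      · rw [sum_eq_single_of_mem 0 (by simp)]
        · simp [slotCount, hk₀]
        · intro r _ hr
          simp [slotCount, hk₀, hr]
      · intro h hh hne
        have := (mem_sdiff.1 hh).2
        refine sum_eq_zero fun r _ => ?_
        simp [slotCount, this, hne]

end Placement

section CodedScheme

variable {K M N Q s V : ℕ}

/-- The load per file of one of the two schemes, without and with a helper. -/
noncomputable def typeLoad (o : Option (Fin K)) (r s n : ℕ) : ℝ :=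
  o.elim (loadCDC r s n) fun _ => loadACDC r s n

lemma sum_codedCost {𝓢 : Finset (Fin K)} {assigned : Fin Q → Finset (Fin K)}
    (hsS : s ≤ 𝓢.card) (hmem : ∀ q, assigned q ∈ 𝓢.powersetCard s)
    (hbal : ∀ P ∈ 𝓢.powersetCard s,
      (univ.filter fun q => assigned q = P).card * 𝓢.card.choose s = Q)
    (o : Option (Fin K)) {R : Finset (Fin K)} (hR : R ⊆ 𝓢) :
    ∑ q, codedCost o (assigned q ∪ R).card R.card = Q * typeLoad o R.card s 𝓢.card := by
  have hC := Nat.choose_pos hsS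
  have hη : ∀ P ∈ 𝓢.powersetCard s, (univ.filter fun q => assigned q = P).card =
      Q / 𝓢.card.choose s :=
    fun P hP => (Nat.div_eq_of_eq_mul_left hC (hbal P hP).symm).symm
  obtain ⟨P₀, hP₀⟩ := powersetCard_nonempty.2 hsS
  have hQ : ((Q / 𝓢.card.choose s : ℕ) : ℝ) * 𝓢.card.choose s = Q := by
    rw [← hη P₀ hP₀]
    exact_mod_cast hbal P₀ hP₀
  rw [sum_assigned_eq hmem hη fun P => codedCost o (P ∪ R).card R.card]
  cases o with
  | none =>
    simp only [codedCost, typeLoad, Option.elim_none]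
    rw [sum_powersetCard_cdc hR hsS, ← mul_assoc, hQ]
  | some h =>
    simp only [codedCost, typeLoad, Option.elim_some]
    rw [sum_powersetCard_acdc hR hsS, ← mul_assoc, hQ]

/-- The coded scheme in which `β₁ r` files are stored at every `r`-set of solvers, `β₂ r` files at
every helper and `r`-set of solvers, and `E` files at a single solver, uncoded. -/
theorem exists_coded_scheme (hV : ∀ r, 1 ≤ r → r ≤ K → r * (K + 1) ∣ V) (hs : 1 ≤ s)
    {𝓢 𝓗 : Finset (Fin K)} (hdisj : Disjoint 𝓢 𝓗) (hsS : s ≤ 𝓢.card)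
    (hdvd : 𝓢.card.choose s ∣ Q) (β₁ β₂ : ℕ → ℕ) (E : ℕ)
    (hN : (∑ r ∈ Icc 1 𝓢.card, (β₁ r : ℝ) * 𝓢.card.choose r) +
      𝓗.card * (∑ r ∈ Icc 0 𝓢.card, (β₂ r : ℝ) * 𝓢.card.choose r) + E = N)
    (hM : (∑ r ∈ Icc 1 𝓢.card, (β₁ r : ℝ) * 𝓢.card.choose r * r) +
      𝓗.card * (∑ r ∈ Icc 0 𝓢.card, (β₂ r : ℝ) * 𝓢.card.choose r * (r + 1)) + E ≤ M) {A B : ℝ}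
    (hA : A = ((∑ r ∈ Icc 1 𝓢.card, (β₁ r : ℝ) * 𝓢.card.choose r * r) +
      𝓗.card * (∑ r ∈ Icc 0 𝓢.card, (β₂ r : ℝ) * 𝓢.card.choose r * r)) / 𝓢.card)
    (hB : B = (𝓗.card * (∑ r ∈ Icc 0 𝓢.card, (β₂ r : ℝ) * 𝓢.card.choose r)) / 𝓗.card) :
    ∃ S : Scheme K M N Q s V, S.solvers = 𝓢 ∧
      ((univ.sup fun k => (S.mapped k).card : ℕ) : ℝ) ≤ max A B + E ∧
      (E = 0 → ((univ.sup fun k => (S.mapped k).card : ℕ) : ℝ) = max A B) ∧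
      ((∑ k, S.len k : ℕ) : ℝ) = V * (Q *
        ((∑ r ∈ Icc 1 𝓢.card, (β₁ r : ℝ) * 𝓢.card.choose r * loadCDC r s 𝓢.card) +
        𝓗.card * (∑ r ∈ Icc 0 𝓢.card, (β₂ r : ℝ) * 𝓢.card.choose r * loadACDC r s 𝓢.card) +
        E)) := by
  classical
  obtain ⟨k₀, hk₀⟩ := card_pos.1 (hs.trans hsS)
  have hk₀H : k₀ ∉ 𝓗 := disjoint_left.1 hdisj hk₀
  set cnt := slotCount 𝓗 k₀ β₁ β₂ E with hcntdef
  have hcntN : ∑ o, ∑ R ∈ 𝓢.powerset, cnt o R.card = N := by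
    have := sum_slotCount 𝓢 𝓗 hk₀H β₁ β₂ E fun _ _ => 1
    simp only [mul_one, sum_const, nsmul_eq_mul] at this
    rw [hN] at this
    exact_mod_cast this
  obtain ⟨o, R, hR, hcnt⟩ := exists_placement 𝓢 cnt hcntN
  have hsum (G : Option (Fin K) → Finset (Fin K) → ℝ) := sum_placement hR hcnt G
  have hslot := sum_slotCount 𝓢 𝓗 hk₀H β₁ β₂ E
  have hnone (n : Fin N) (hn : o n = none) : (R n).Nonempty := by
    rw [nonempty_iff_ne_empty]
    intro h0
    have h := hcnt none ∅ (empty_subset _)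
    rw [card_empty, hcntdef, slotCount, if_pos rfl, card_eq_zero, filter_eq_empty_iff] at h
    exact h (mem_univ n) ⟨hn, h0⟩
  obtain ⟨assigned, hmem, hbal⟩ := exists_balanced_assignment (K := K) hdvd
  have hη : ∀ P ∈ 𝓢.powersetCard s, (univ.filter fun q => assigned q = P).card =
      Q / 𝓢.card.choose s := fun P hP =>
    (Nat.div_eq_of_eq_mul_left (Nat.choose_pos hsS) (hbal P hP).symm).symm
  have hdel := Deliverable.all hV hmem hη hR hnone cnt hcnt
  -- numbers of files stored at a node as a solver and as a helper
  set cR : Fin K → ℝ := fun k => ∑ n, if k ∈ R n then (1 : ℝ) else 0 with hcR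
  set cO : Fin K → ℝ := fun k => ∑ n, if o n = some k then (1 : ℝ) else 0 with hcO
  have hcR_solver (k : Fin K) (hk : k ∈ 𝓢) : cR k = A := by
    rw [hcR]
    simp only
    rw [hsum fun _ R => if k ∈ R then 1 else 0,
      sum_congr rfl fun o₀ _ => sum_powerset_mem hk fun r => (cnt o₀ r : ℝ),
      hslot fun _ r => (r : ℝ) / 𝓢.card, hA, sum_const, nsmul_eq_mul, add_div, mul_div_assoc,
      sum_div, sum_div]
    simp [mul_div_assoc]
  have hcR_zero (k : Fin K) (hk : k ∉ 𝓢) : cR k = 0 :=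
    sum_eq_zero fun n _ => if_neg fun h => hk (hR n h)
  have hcO_eq (k : Fin K) : cO k = (if k ∈ 𝓗 then B else 0) + if k = k₀ then (E : ℝ) else 0 := by
    rw [hcO]
    simp only
    rw [hsum fun o₀ _ => if o₀ = some k then 1 else 0,
      hslot fun o₀ _ => if o₀ = some k then 1 else 0]
    by_cases hkH : k ∈ 𝓗
    · have hne : (𝓗.card : ℝ) ≠ 0 := by exact_mod_cast (card_pos.2 ⟨k, hkH⟩).ne'
      rw [if_pos hkH, hB, mul_div_cancel_left₀ _ hne]
      simp [hkH, eq_comm]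
    · rw [if_neg hkH]
      simp [hkH, eq_comm]
  have hcard_le (k : Fin K) : ((placedFiles o R k).card : ℝ) ≤ cR k + cO k := by
    rw [hcR, hcO, ← sum_add_distrib, placedFiles, card_filter, Nat.cast_sum]
    refine sum_le_sum fun n _ => ?_
    by_cases h1 : k ∈ R n <;> by_cases h2 : o n = some k <;> simp [h1, h2]
  have hcR_le (k : Fin K) : cR k ≤ (placedFiles o R k).card := by
    rw [hcR, placedFiles, card_filter, Nat.cast_sum]
    refine sum_le_sum fun n _ => ?_
    by_cases h1 : k ∈ R n <;> by_cases h2 : o n = some k <;> simp [h1, h2]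
  have hcO_le (k : Fin K) : cO k ≤ (placedFiles o R k).card := by
    rw [hcO, placedFiles, card_filter, Nat.cast_sum]
    refine sum_le_sum fun n _ => ?_
    by_cases h1 : k ∈ R n <;> by_cases h2 : o n = some k <;> simp [h1, h2]
  have hA0 : 0 ≤ A := by rw [hA]; positivity
  have hB0 : 0 ≤ B := by rw [hB]; positivity
  have hpeak (k : Fin K) : ((placedFiles o R k).card : ℝ) ≤ max A B + E := by
    refine (hcard_le k).trans ?_
    rw [hcO_eq]
    have hE : (if k = k₀ then (E : ℝ) else 0) ≤ E := by split_ifs <;> simp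
    by_cases hk : k ∈ 𝓢
    · rw [hcR_solver k hk, if_neg (disjoint_left.1 hdisj hk)]
      have := le_max_left A B
      linarith
    · have : (if k ∈ 𝓗 then B else 0) ≤ B := by split_ifs <;> simp [hB0]
      rw [hcR_zero k hk]
      have := le_max_right A B
      linarith
  have hcover (n : Fin N) : ∃ k, n ∈ placedFiles o R k := by
    cases hn : o n with
    | none =>
      obtain ⟨k, hk⟩ := hnone n hn
      exact ⟨k, mem_filter.2 ⟨mem_univ n, Or.inl hk⟩⟩
    | some h => exact ⟨h, mem_filter.2 ⟨mem_univ n, Or.inr hn⟩⟩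
  have hstorage : ∑ k, (placedFiles o R k).card ≤ M := by
    have h1 : ∑ k, (cR k + cO k) =
        ∑ n, (((R n).card : ℝ) + (o n).elim 0 fun _ => 1) := by
      rw [sum_add_distrib, sum_add_distrib, hcR, hcO]
      congr 1
      · rw [sum_comm]
        exact sum_congr rfl fun n _ => by simp
      · rw [sum_comm]
        refine sum_congr rfl fun n _ => ?_
        cases hn : o n <;> simp
    rw [hsum fun o₀ R' => (R'.card : ℝ) + o₀.elim 0 fun _ => 1,
      hslot fun o₀ r => (r : ℝ) + o₀.elim 0 fun _ => 1] at h1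
    have h2 := sum_le_sum fun k (_ : k ∈ univ) => hcard_le k
    rw [h1] at h2
    simp only [Option.elim_none, Option.elim_some, add_zero, sum_const, nsmul_eq_mul,
      Nat.cast_zero, zero_add, mul_one] at h2
    exact_mod_cast h2.trans hM
  have hLen : (V : ℝ) * ∑ n, ∑ q, codedCost (o n) (assigned q ∪ R n).card (R n).card = V * (Q *
        ((∑ r ∈ Icc 1 𝓢.card, (β₁ r : ℝ) * 𝓢.card.choose r * loadCDC r s 𝓢.card) +
        𝓗.card * (∑ r ∈ Icc 0 𝓢.card, (β₂ r : ℝ) * 𝓢.card.choose r * loadACDC r s 𝓢.card) +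
        E)) := by
    rw [sum_congr rfl fun n _ => sum_codedCost hsS hmem hbal (o n) (hR n), ← mul_sum,
      hsum fun o₀ R' => typeLoad o₀ R'.card s 𝓢.card, hslot fun o₀ r => typeLoad o₀ r s 𝓢.card]
    simp only [typeLoad, Option.elim_none, Option.elim_some, sum_const, nsmul_eq_mul,
      loadACDC_zero hs hsS, mul_one]
  obtain ⟨S, hSm, -, hSs, hSl⟩ := exists_scheme_of_deliverable hcover hstorage hmem hbal hdel
  refine ⟨S, hSs, ?_, ?_, hSl.trans hLen⟩
  · obtain ⟨k, -, hk⟩ := exists_mem_eq_sup univ ⟨k₀, mem_univ k₀⟩ fun k => (S.mapped k).card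
    rw [hk, hSm]
    exact hpeak k
  · intro hE
    apply le_antisymm
    · obtain ⟨k, -, hk⟩ := exists_mem_eq_sup univ ⟨k₀, mem_univ k₀⟩ fun k => (S.mapped k).card
      rw [hk, hSm]
      simpa [hE] using hpeak k
    · have hle (k : Fin K) : ((placedFiles o R k).card : ℝ) ≤
          ((univ.sup fun k => (S.mapped k).card : ℕ) : ℝ) := by
        rw [hSm]
        exact_mod_cast le_sup (f := fun k => (placedFiles o R k).card) (mem_univ k)
      refine max_le ?_ ?_
      · rw [← hcR_solver k₀ hk₀]
        exact (hcR_le k₀).trans (hle k₀)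
      · rcases 𝓗.eq_empty_or_nonempty with h0 | ⟨h, hh⟩
        · rw [hB, h0]
          simp
        · have := hcO_eq h
          rw [if_pos hh, hE] at this
          simp only [Nat.cast_zero, ite_self, add_zero] at this
          rw [← this]
          exact (hcO_le h).trans (hle h)

end CodedScheme

/-! ### The lower bound on the communication load of a scheme -/

lemma logb_card_bits (n : ℕ) : Real.logb 2 (Fintype.card (Bits n)) = n := by
  rw [Fintype.card_fun, Fintype.card_bool, Fintype.card_fin, Nat.cast_pow, Real.logb_pow,
    Nat.cast_ofNat, Real.logb_self_eq_one (by norm_num), mul_one]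

namespace Scheme

variable {K M N Q s V : ℕ}

/-- Correctness for the task whose Map functions read off arbitrary values and whose Reduce
functions return all of their inputs: a node that computes function `q` determines the values
`v q`. -/
lemma eq_of_messages_eq (S : Scheme K M N Q s V) {k : Fin K} {q : Fin Q} (hk : k ∈ S.assigned q)
    {v w : Fin Q → Fin N → Bits V} (hloc : AgreeOn (S.mapped k) v w)
    (hmsg : ∀ j, S.encode j (restrictVals (S.mapped j) v) =
      S.encode j (restrictVals (S.mapped j) w)) : v q = w q := by
  classical
  have e : Bits (Q * V) ≃ (Fin Q → Bits V) := Fintype.equivOfCardEq (by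
    simp only [Bits, Fintype.card_fun, Fintype.card_fin, Fintype.card_bool]
    rw [← pow_mul, mul_comm])
  have e' : Bits (N * V) ≃ (Fin N → Bits V) := Fintype.equivOfCardEq (by
    simp only [Bits, Fintype.card_fun, Fintype.card_fin, Fintype.card_bool]
    rw [← pow_mul, mul_comm])
  let T : MRTask N Q V :=
    { F := Q * V, B := N * V, mapFn := fun q _ x => e x q, reduceFn := fun _ x => e'.symm x }
  have hT (u : Fin Q → Fin N → Bits V) :
      T.interVal (fun n => e.symm fun q => u q n) = u := by
    funext q n
    exact congrFun (e.apply_symm_apply fun q => u q n) q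
  obtain ⟨f, hf⟩ := S.correct T
  have hv := hf (fun n => e.symm fun q => v q n) k q hk
  have hw := hf (fun n => e.symm fun q => w q n) k q hk
  have hr : restrictVals (S.mapped k) v = restrictVals (S.mapped k) w := by
    funext q n
    exact hloc q n n.2
  rw [hT] at hv hw
  simp only [hmsg, hr] at hv
  have hout := hv.symm.trans hw
  simp only [MRTask.output, hT] at hout
  exact e'.symm.injective hout

/-- The solvers that map file `n`. -/
def solversOf (S : Scheme K M N Q s V) (n : Fin N) : Finset (Fin K) :=
  S.solvers.filter fun k => n ∈ S.mapped k

open Classical in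
/-- Some node outside the set of solvers that maps file `n`, if there is one. -/
noncomputable def helperOf (S : Scheme K M N Q s V) (n : Fin N) : Option (Fin K) :=
  if h : ∃ k, k ∉ S.solvers ∧ n ∈ S.mapped k then some h.choose else none

lemma helperOf_eq_none {S : Scheme K M N Q s V} {n : Fin N} :
    S.helperOf n = none ↔ ∀ k ∉ S.solvers, n ∉ S.mapped k := by
  unfold helperOf
  split_ifs with h
  · simp only [false_iff]
    push Not
    exact h
  · push Not at h
    simpa using h

lemma helperOf_spec {S : Scheme K M N Q s V} {n : Fin N} {k : Fin K} (h : S.helperOf n = some k) :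
    k ∉ S.solvers ∧ n ∈ S.mapped k := by
  unfold helperOf at h
  split_ifs at h with h'
  have := h'.choose_spec
  rw [Option.some_inj] at h
  rwa [h] at this

/-- The nodes that know file `n`, where all helpers are merged into the single node `none`. -/
noncomputable def knowers (S : Scheme K M N Q s V) (n : Fin N) : Finset (Option (Fin K)) :=
  (S.helperOf n).elim ((S.solversOf n).map Function.Embedding.some)
    fun _ => insert none ((S.solversOf n).map Function.Embedding.some)

lemma some_mem_knowers {S : Scheme K M N Q s V} {n : Fin N} {k : Fin K} :
    some k ∈ S.knowers n ↔ k ∈ S.solvers ∧ n ∈ S.mapped k := by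
  unfold knowers solversOf
  cases S.helperOf n <;> simp

lemma none_mem_knowers {S : Scheme K M N Q s V} {n : Fin N} :
    none ∈ S.knowers n ↔ ∃ k, k ∉ S.solvers ∧ n ∈ S.mapped k := by
  have h := helperOf_eq_none (S := S) (n := n)
  unfold knowers
  cases hn : S.helperOf n with
  | none =>
    have := h.1 hn
    simp only [Option.elim_none, mem_map, Function.Embedding.some_apply, reduceCtorEq, and_false,
      exists_false, false_iff]
    push Not
    exact this
  | some k => simpa using ⟨k, helperOf_spec hn⟩

lemma unitCost_knowers (S : Scheme K M N Q s V) (P : Finset (Fin K)) (n : Fin N) :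
    unitCost (P.map Function.Embedding.some) (S.knowers n) =
      codedCost (S.helperOf n) (P ∪ S.solversOf n).card (S.solversOf n).card := by
  unfold unitCost knowers codedCost
  cases S.helperOf n with
  | none => simp only [Option.elim_none, ← map_union, card_map]
  | some h =>
    simp only [Option.elim_some, union_insert, ← map_union]
    rw [card_insert_of_notMem (by simp), card_insert_of_notMem (by simp), card_map, card_map]
    push_cast
    rw [add_sub_add_right_eq_sub, add_sub_cancel_right]

lemma knowers_nonempty (S : Scheme K M N Q s V) (n : Fin N) : (S.knowers n).Nonempty := by
  obtain ⟨k, hk⟩ := S.mapped_cover n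
  by_cases h : k ∈ S.solvers
  · exact ⟨some k, some_mem_knowers.2 ⟨h, hk⟩⟩
  · exact ⟨none, none_mem_knowers.2 ⟨k, h, hk⟩⟩

theorem load_lower_bound (S : Scheme K M N Q s V) (hQ : 0 < Q) :
    (V : ℝ) * (Q * ∑ n, typeLoad (S.helperOf n) (S.solversOf n).card s S.solvers.card) ≤
      ((∑ k, S.len k : ℕ) : ℝ) := by
  classical
  let Ω := Fin Q × Fin N → Bits V
  let enc (k : Fin K) : Ω → Bits (S.len k) :=
    fun v => S.encode k (restrictVals (S.mapped k) fun q n => v (q, n))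
  let a (k : Fin K) : Setoid Ω := Setoid.ker (enc k)
  let X : Option (Fin K) → Setoid Ω := fun i =>
    i.elim ((univ.filter fun k => k ∉ S.solvers).inf a) fun k => if k ∈ S.solvers then a k else ⊤
  let want : Fin Q × Fin N → Finset (Option (Fin K)) :=
    fun p => (S.assigned p.1).map Function.Embedding.some
  let know : Fin Q × Fin N → Finset (Option (Fin K)) := fun p => S.knowers p.2
  have henc (k : Fin K) (v w : Ω) (h : ∀ q, ∀ n ∈ S.mapped k, v (q, n) = w (q, n)) :
      enc k v = enc k w :=
    congrArg (S.encode k) (funext fun q => funext fun n => h q n n.2)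
  have hX (i : Option (Fin K)) : (coordSetoid {p | i ∈ know p} : Setoid Ω) ≤ X i := by
    cases i with
    | none =>
      refine Finset.le_inf fun k hk v w h => henc k v w fun q n hn => h (q, n) ?_
      exact none_mem_knowers.2 ⟨k, (mem_filter.1 hk).2, hn⟩
    | some k =>
      change _ ≤ (if k ∈ S.solvers then a k else ⊤)
      split_ifs with hk
      · exact fun v w h => henc k v w fun q n hn => h (q, n) (some_mem_knowers.2 ⟨hk, hn⟩)
      · exact le_top
  have hXa (k : Fin K) : univ.inf X ≤ a k := by
    by_cases hk : k ∈ S.solvers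
    · refine (Finset.inf_le (mem_univ (some k))).trans ?_
      change (if k ∈ S.solvers then a k else ⊤) ≤ _
      rw [if_pos hk]
    · exact (Finset.inf_le (mem_univ none)).trans
        (Finset.inf_le (mem_filter.2 ⟨mem_univ k, hk⟩))
  have hdec (i : Option (Fin K)) : (coordSetoid {p | i ∈ know p} : Setoid Ω) ⊓ univ.inf X ≤
      coordSetoid {p | i ∈ want p} := by
    rintro v w ⟨hloc, hmsg⟩ ⟨q, n⟩ hp
    obtain ⟨k, hk, rfl⟩ := mem_map.1 (show i ∈ want (q, n) from hp)
    have hkS : k ∈ S.solvers := (mem_powersetCard.1 (S.assigned_mem q)).1 hk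
    exact congrFun (S.eq_of_messages_eq hk (v := fun q n => v (q, n)) (w := fun q n => w (q, n))
      (fun q n hn => hloc (q, n) (some_mem_knowers.2 ⟨hkS, hn⟩)) fun j => hXa j hmsg) n
  have hbound := index_coding_bound want know (fun p => S.knowers_nonempty p.2) X hX hdec
  have ha (k : Fin K) : entropy (a k) ≤ S.len k := by
    exact (entropy_ker_le (enc k)).trans (logb_card_bits _).le
  have hsum : ∑ i, entropy (X i) ≤ ((∑ k, S.len k : ℕ) : ℝ) := by
    have h1 := entropy_inf_le_sum (univ.filter fun k => k ∉ S.solvers) a ⊤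
    simp only [entropy_top, sub_zero, inf_top_eq] at h1
    have h2 (k : Fin K) : entropy (X (some k)) = if k ∈ S.solvers then entropy (a k) else 0 := by
      change entropy (if k ∈ S.solvers then a k else ⊤) = _
      split_ifs
      · rfl
      · exact entropy_top
    rw [Fintype.sum_option, sum_congr rfl fun k _ => h2 k, ← sum_filter]
    have h3 := sum_filter_add_sum_filter_not univ (fun k => k ∈ S.solvers) fun k => entropy (a k)
    have h4 := sum_le_sum fun k (_ : k ∈ univ) => ha k
    push_cast
    change entropy ((univ.filter fun k => k ∉ S.solvers).inf a) + _ ≤ _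
    linarith
  have hlog : Real.logb 2 (Fintype.card (Bits V)) = V := logb_card_bits V
  have hcost : ∑ p, unitCost (want p) (know p) =
      Q * ∑ n, typeLoad (S.helperOf n) (S.solversOf n).card s S.solvers.card := by
    rw [Fintype.sum_prod_type_right, mul_sum]
    refine sum_congr rfl fun n _ => ?_
    have hsub : S.solversOf n ⊆ S.solvers := filter_subset _ _
    rw [← sum_codedCost (S.s_le_card hQ) S.assigned_mem S.balanced (S.helperOf n) hsub]
    exact sum_congr rfl fun q _ => S.unitCost_knowers _ n
  rw [hlog, hcost, mul_comm] at hbound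
  exact hbound.trans hsum

end Scheme

/-! ### Mixtures of file types -/

/-- The types of files when there are `n` solvers: `inl r` stands for files stored at `r` solvers
only, and `inr r` for files stored at `r` solvers and a helper. -/
def fileTypes (n : ℕ) : Finset (ℕ ⊕ ℕ) := (Icc 1 n).disjSum (Icc 0 n)

/-- The number of solvers storing a file of the given type. -/
def solverShare : ℕ ⊕ ℕ → ℚ := Sum.elim (fun r => r) fun r => r

/-- The number of helpers storing a file of the given type. -/
def helperShare : ℕ ⊕ ℕ → ℚ := Sum.elim (fun _ => 0) fun _ => 1

/-- The communication load per file of the given type. -/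
noncomputable def typeCost (s n : ℕ) : ℕ ⊕ ℕ → ℝ :=
  Sum.elim (fun r => loadCDC r s n) fun r => loadACDC r s n

/-- `w` gives the fractions of the files of each type, where the average number of copies of a
file is at most `μ`. For `Kh = 0` the condition on the helpers rules out files with a helper, and
otherwise it is void. -/
structure IsMixture (μ : ℝ) (Ks Kh : ℕ) (w : ℕ ⊕ ℕ → ℝ) : Prop where
  nonneg : ∀ j ∈ fileTypes Ks, 0 ≤ w j
  sum_eq_one : ∑ j ∈ fileTypes Ks, w j = 1
  storage : ∑ j ∈ fileTypes Ks, w j * (solverShare j + helperShare j : ℚ) ≤ μ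
  helpers : ∑ j ∈ fileTypes Ks, w j * helperShare j ≤ Kh

/-- The execution time of a mixture of file types. Without helpers the second load is `0 / 0 = 0`, as
it should be. -/
noncomputable def mixtureTime (Ks Kh Q s : ℕ) (cm cs cr : ℝ) (w : ℕ ⊕ ℕ → ℝ) : ℝ :=
  cm * max ((∑ j ∈ fileTypes Ks, w j * solverShare j) / Ks)
      ((∑ j ∈ fileTypes Ks, w j * helperShare j) / Kh)
    + cs * (∑ j ∈ fileTypes Ks, w j * typeCost s Ks j) + cr * ((s : ℝ) * Q / Ks)

/-- The conditions on the numbers `Ks` of solvers and `Kh` of helpers. -/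
structure Admissible (K Q s Ks Kh : ℕ) : Prop where
  servers : Ks + Kh ≤ K
  s_le : s ≤ Ks
  Ks_le : Ks ≤ Q
  batches : Ks.choose s ∣ Q

lemma solverShare_nonneg (j : ℕ ⊕ ℕ) : 0 ≤ solverShare j := by
  cases j <;> simp [solverShare]

lemma helperShare_nonneg (j : ℕ ⊕ ℕ) : 0 ≤ helperShare j := by
  cases j <;> simp [helperShare]

lemma one_le_shares {n : ℕ} {j : ℕ ⊕ ℕ} (hj : j ∈ fileTypes n) :
    1 ≤ solverShare j + helperShare j := by
  cases j with
  | inl r =>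
    have : 1 ≤ r := by
      simp only [fileTypes, inl_mem_disjSum, mem_Icc] at hj
      exact hj.1
    simpa [solverShare, helperShare] using this
  | inr r => simp [solverShare, helperShare]

lemma typeCost_nonneg {s n : ℕ} {j : ℕ ⊕ ℕ} (hj : j ∈ fileTypes n) : 0 ≤ typeCost s n j := by
  cases j with
  | inl r =>
    simp only [fileTypes, inl_mem_disjSum, mem_Icc] at hj
    exact loadCDC_nonneg hj.1
  | inr r => exact loadACDC_nonneg r s n

lemma mixtureTime_mono {Ks Kh Q s : ℕ} {cm cs cr : ℝ} (hcm : 0 ≤ cm) (hcs : 0 ≤ cs)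
    {w w' : ℕ ⊕ ℕ → ℝ} (h : ∀ j ∈ fileTypes Ks, w j ≤ w' j) :
    mixtureTime Ks Kh Q s cm cs cr w ≤ mixtureTime Ks Kh Q s cm cs cr w' := by
  have h1 : ∑ j ∈ fileTypes Ks, w j * solverShare j ≤ ∑ j ∈ fileTypes Ks, w' j * solverShare j :=
    sum_le_sum fun j hj =>
      mul_le_mul_of_nonneg_right (h j hj) (by exact_mod_cast solverShare_nonneg j)
  have h2 : ∑ j ∈ fileTypes Ks, w j * helperShare j ≤ ∑ j ∈ fileTypes Ks, w' j * helperShare j :=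
    sum_le_sum fun j hj =>
      mul_le_mul_of_nonneg_right (h j hj) (by exact_mod_cast helperShare_nonneg j)
  have h3 : ∑ j ∈ fileTypes Ks, w j * typeCost s Ks j ≤
      ∑ j ∈ fileTypes Ks, w' j * typeCost s Ks j :=
    sum_le_sum fun j hj => mul_le_mul_of_nonneg_right (h j hj) (typeCost_nonneg hj)
  unfold mixtureTime
  gcongr

lemma le_choose_of_lt {n s : ℕ} (hs : 1 ≤ s) (hsn : s < n) : n ≤ n.choose s := by
  induction n with
  | zero => omega
  | succ n ih =>
    rcases (Nat.lt_succ_iff.1 hsn).eq_or_lt with rfl | h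
    · rw [Nat.choose_succ_self_right]
    · obtain ⟨t, rfl⟩ : ∃ t, s = t + 1 := ⟨s - 1, by omega⟩
      have h1 := ih h
      have h2 := Nat.choose_pos (show t ≤ n by omega)
      rw [Nat.choose_succ_succ, Nat.succ_eq_add_one]
      omega

namespace Scheme

variable {K M N Q s V : ℕ}

/-- The type of file `n` in the scheme. -/
noncomputable def fileType (S : Scheme K M N Q s V) (n : Fin N) : ℕ ⊕ ℕ :=
  (S.helperOf n).elim (Sum.inl (S.solversOf n).card) fun _ => Sum.inr (S.solversOf n).card

open Classical in
/-- The fractions of the files of the scheme that have a given type. -/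
noncomputable def mixture (S : Scheme K M N Q s V) (j : ℕ ⊕ ℕ) : ℝ :=
  ((univ.filter fun n => S.fileType n = j).card : ℝ) / N

lemma card_solversOf_le (S : Scheme K M N Q s V) (n : Fin N) :
    (S.solversOf n).card ≤ S.solvers.card := card_le_card (filter_subset _ _)

lemma fileType_mem (S : Scheme K M N Q s V) (n : Fin N) :
    S.fileType n ∈ fileTypes S.solvers.card := by
  have h1 := S.card_solversOf_le n
  unfold fileType
  cases hn : S.helperOf n with
  | none =>
    have h2 : 0 < (S.solversOf n).card := by
      obtain ⟨k, hk⟩ := S.mapped_cover n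
      refine card_pos.2 ⟨k, mem_filter.2 ⟨?_, hk⟩⟩
      by_contra hks
      exact helperOf_eq_none.1 hn k hks hk
    simp only [Option.elim_none, fileTypes, inl_mem_disjSum, mem_Icc]
    omega
  | some h =>
    simp only [Option.elim_some, fileTypes, inr_mem_disjSum, mem_Icc]
    omega

lemma sum_mixture (S : Scheme K M N Q s V) (f : ℕ ⊕ ℕ → ℝ) :
    ∑ j ∈ fileTypes S.solvers.card, S.mixture j * f j = (∑ n, f (S.fileType n)) / N := by
  classical
  rw [← sum_fiberwise_of_maps_to (fun n _ => S.fileType_mem n), sum_div]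
  refine sum_congr rfl fun j _ => ?_
  rw [sum_congr rfl fun n hn => by rw [(mem_filter.1 hn).2], sum_const, nsmul_eq_mul, mixture,
    div_mul_eq_mul_div]

lemma sum_solverShare (S : Scheme K M N Q s V) :
    ∑ n, (solverShare (S.fileType n) : ℝ) = ((∑ k ∈ S.solvers, (S.mapped k).card : ℕ) : ℝ) := by
  classical
  have h (n : Fin N) : (solverShare (S.fileType n) : ℝ) =
      ∑ k ∈ S.solvers, if n ∈ S.mapped k then (1 : ℝ) else 0 := by
    have h1 : (solverShare (S.fileType n) : ℝ) = (S.solversOf n).card := by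
      unfold fileType
      cases S.helperOf n <;> simp [solverShare]
    rw [h1, solversOf, ← sum_filter, sum_const, nsmul_eq_mul, mul_one]
  rw [sum_congr rfl fun n _ => h n, sum_comm]
  push_cast
  exact sum_congr rfl fun k _ => by simp

lemma sum_helperShare_le (S : Scheme K M N Q s V) :
    ∑ n, (helperShare (S.fileType n) : ℝ) ≤ ((∑ k ∈ S.solversᶜ, (S.mapped k).card : ℕ) : ℝ) := by
  classical
  have h (n : Fin N) : (helperShare (S.fileType n) : ℝ) ≤
      ∑ k ∈ S.solversᶜ, if n ∈ S.mapped k then (1 : ℝ) else 0 := by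
    unfold fileType
    cases hn : S.helperOf n with
    | none =>
      simp only [helperShare, Option.elim_none, Sum.elim_inl, Rat.cast_zero]
      exact sum_nonneg fun k _ => by split_ifs <;> norm_num
    | some k =>
      obtain ⟨h1, h2⟩ := helperOf_spec hn
      simp only [helperShare, Option.elim_some, Sum.elim_inr, Rat.cast_one]
      refine le_trans ?_ (single_le_sum (f := fun k => if n ∈ S.mapped k then (1 : ℝ) else 0)
        (fun k _ => by split_ifs <;> norm_num) (mem_compl.2 h1))
      rw [if_pos h2]
  refine (sum_le_sum fun n _ => h n).trans ?_
  rw [sum_comm]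
  push_cast
  exact (sum_congr rfl fun k _ => by simp).le

lemma admissible (S : Scheme K M N Q s V) (hs : 1 ≤ s) (hsQ : s ≤ Q) :
    Admissible K Q s S.solvers.card (K - S.solvers.card) := by
  have hQ : 0 < Q := by omega
  have hc : S.solvers.card ≤ K := by simpa using card_le_univ S.solvers
  have hsc := S.s_le_card hQ
  refine ⟨by omega, hsc, ?_, S.choose_dvd hQ⟩
  rcases hsc.eq_or_lt with h | h
  · omega
  · refine le_trans ?_ (Nat.le_of_dvd hQ (S.choose_dvd hQ))
    exact le_choose_of_lt hs h

/-- Every scheme is at least as slow as the mixture of its file types. -/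
theorem exists_mixture (S : Scheme K M N Q s V) (hN : 0 < N) (hV : 0 < V) (hs : 1 ≤ s)
    (hsQ : s ≤ Q) {cm cs cr : ℝ} (hcm : 0 ≤ cm) (hcs : 0 ≤ cs) :
    IsMixture ((M : ℝ) / N) S.solvers.card (K - S.solvers.card) S.mixture ∧
      mixtureTime S.solvers.card (K - S.solvers.card) Q s cm cs cr S.mixture ≤
        S.time cm cs cr := by
  classical
  have hQ : 0 < Q := by omega
  have hN' : (0 : ℝ) < N := by exact_mod_cast hN
  have hQ' : (0 : ℝ) < Q := by exact_mod_cast hQ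
  have hV' : (0 : ℝ) < V := by exact_mod_cast hV
  have hKs : 0 < S.solvers.card := hs.trans (S.s_le_card hQ)
  have hKs' : (0 : ℝ) < S.solvers.card := by exact_mod_cast hKs
  set peak := univ.sup fun k => (S.mapped k).card with hpeak
  have hle (k : Fin K) : (S.mapped k).card ≤ peak :=
    le_sup (f := fun k => (S.mapped k).card) (mem_univ k)
  have hcompl : S.solversᶜ.card = K - S.solvers.card := by rw [card_compl, Fintype.card_fin]
  have hsolv : ∑ n, (solverShare (S.fileType n) : ℝ) ≤ S.solvers.card * peak := by
    rw [sum_solverShare]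
    exact_mod_cast sum_le_card_nsmul _ _ _ fun k _ => hle k
  have hhelp : ∑ n, (helperShare (S.fileType n) : ℝ) ≤ (K - S.solvers.card : ℕ) * peak := by
    refine S.sum_helperShare_le.trans ?_
    rw [← hcompl]
    exact_mod_cast sum_le_card_nsmul _ _ _ fun k _ => hle k
  constructor
  · refine ⟨fun j _ => ?_, ?_, ?_, ?_⟩
    · unfold mixture
      positivity
    · have := S.sum_mixture fun _ => 1
      simp only [mul_one, sum_const, card_univ, Fintype.card_fin, nsmul_eq_mul] at this
      rw [this, div_self hN'.ne']
    · rw [S.sum_mixture fun j => ((solverShare j + helperShare j : ℚ) : ℝ)]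
      push_cast
      gcongr
      rw [sum_add_distrib, sum_solverShare]
      refine (add_le_add_right S.sum_helperShare_le _).trans ?_
      have := sum_add_sum_compl S.solvers fun k => (S.mapped k).card
      have h2 := S.storage
      rw [← this] at h2
      exact_mod_cast h2
    · rw [S.sum_mixture fun j => (helperShare j : ℝ)]
      rcases Nat.eq_zero_or_pos (K - S.solvers.card) with h0 | hpos
      · rw [h0] at hhelp ⊢
        simp only [Nat.cast_zero, zero_mul] at hhelp ⊢
        exact div_nonpos_of_nonpos_of_nonneg hhelp hN'.le
      · have h1 : ∑ n, (helperShare (S.fileType n) : ℝ) ≤ ∑ _n : Fin N, (1 : ℝ) :=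
          sum_le_sum fun n _ => by
            cases S.fileType n <;> simp [helperShare]
        simp only [sum_const, card_univ, Fintype.card_fin, nsmul_eq_mul, mul_one] at h1
        have h2 : (1 : ℝ) ≤ (K - S.solvers.card : ℕ) := by exact_mod_cast hpos
        exact ((div_le_one hN').2 h1).trans h2
  · unfold mixtureTime time
    rw [S.sup_card_reduceSet hQ hs, S.sum_mixture fun j => (solverShare j : ℝ),
      S.sum_mixture fun j => (helperShare j : ℝ), S.sum_mixture]
    refine add_le_add_left (add_le_add ?_ ?_) _
    · refine mul_le_mul_of_nonneg_left (max_le ?_ ?_) hcm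
      · unfold peakLoad
        rw [div_div, div_le_div_iff₀ (by positivity) hN']
        nlinarith
      · unfold peakLoad
        rcases Nat.eq_zero_or_pos (K - S.solvers.card) with h0 | hpos
        · rw [h0, Nat.cast_zero, div_zero]
          positivity
        · have h2 : (0 : ℝ) < (K - S.solvers.card : ℕ) := by exact_mod_cast hpos
          rw [div_div, div_le_div_iff₀ (by positivity) hN']
          nlinarith
    · refine mul_le_mul_of_nonneg_left ?_ hcs
      unfold commLoad
      rw [div_le_div_iff₀ hN' (by positivity)]
      have h := S.load_lower_bound hQ
      have hcost : ∑ n, typeCost s S.solvers.card (S.fileType n) =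
          ∑ n, typeLoad (S.helperOf n) (S.solversOf n).card s S.solvers.card := by
        refine sum_congr rfl fun n _ => ?_
        unfold fileType typeCost typeLoad
        cases S.helperOf n <;> rfl
      rw [hcost]
      have := mul_le_mul_of_nonneg_right h hN'.le
      linarith

end Scheme

/-! ### Linear programs with rational constraints -/

/-- If a linear functional is minimized over the points `z` with `a k · z ≥ 0` for all `k` and
`e · z = 1`, where the `a k` and `e` are rational, then it is minimized at a rational point: the
coordinates of a real minimizer span a finite-dimensional space over `ℚ`, and moving a `ℚ`-basis
of it to nearby rational numbers preserves the tight constraints. -/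
theorem exists_rational_minimizer {ι κ : Type*} [Fintype ι] [Fintype κ] (a : κ → ι → ℚ)
    (e : ι → ℚ) (c z : ι → ℝ) (hz : ∀ k, 0 ≤ ∑ i, a k i * z i) (hez : ∑ i, e i * z i = 1)
    (hmin : ∀ w : ι → ℝ, (∀ k, 0 ≤ ∑ i, a k i * w i) → ∑ i, e i * w i = 1 →
      ∑ i, c i * z i ≤ ∑ i, c i * w i) :
    ∃ q : ι → ℚ, (∀ k, 0 ≤ ∑ i, a k i * q i) ∧ ∑ i, e i * q i = 1 ∧
      ∑ i, c i * (q i : ℝ) = ∑ i, c i * z i := by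
  classical
  set W : Submodule ℚ ℝ := Submodule.span ℚ (Set.range z) with hW
  have hfin : Module.Finite ℚ W := Module.Finite.span_of_finite ℚ (Set.finite_range z)
  set β := Module.finBasis ℚ W with hβ
  set n := Module.finrank ℚ W with hn
  -- `zz i` are the coordinates of `z i`, and `pt x` is `z` with the basis moved to `x`
  set coef : ι → Fin n → ℚ := fun i j =>
    β.repr ⟨z i, Submodule.subset_span (Set.mem_range_self i)⟩ j with hcoef
  set pt : (Fin n → ℝ) → ι → ℝ := fun x i => ∑ j, coef i j * x j with hpt
  set x₀ : Fin n → ℝ := fun j => (β j : ℝ) with hx₀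
  have hzx : pt x₀ = z := by
    funext i
    have h := congrArg (Submodule.subtype W)
      (β.sum_repr ⟨z i, Submodule.subset_span (Set.mem_range_self i)⟩)
    simp only [map_sum, map_smul, Submodule.coe_subtype] at h
    rw [← h]
    refine sum_congr rfl fun j _ => ?_
    rw [Rat.smul_def]
  -- a rational functional of `pt x` is a rational functional of `x`
  have hlin (f : ι → ℚ) (x : Fin n → ℝ) :
      ∑ i, (f i : ℝ) * pt x i = ∑ j, ((∑ i, f i * coef i j : ℚ) : ℝ) * x j := by
    simp only [hpt, mul_sum]
    rw [sum_comm]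
    refine sum_congr rfl fun j _ => ?_
    push_cast
    rw [sum_mul]
    exact sum_congr rfl fun i _ => by ring
  have htight (f : ι → ℚ) (hf : ∑ i, (f i : ℝ) * z i = 0) (x : Fin n → ℝ) :
      ∑ i, (f i : ℝ) * pt x i = 0 := by
    rw [← hzx, hlin] at hf
    have h0 : ∑ j, (∑ i, f i * coef i j) • β j = 0 := by
      apply Subtype.ext
      rw [← Submodule.coe_subtype, map_sum]
      simp only [map_smul, Submodule.coe_subtype, Rat.smul_def]
      exact hf
    have h1 := Fintype.linearIndependent_iff.1 β.linearIndependent _ h0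
    rw [hlin]
    exact sum_eq_zero fun j _ => by rw [h1 j]; simp
  have hcont (f : ι → ℝ) : Continuous fun x => ∑ i, f i * pt x i := by
    simp only [hpt]
    fun_prop
  -- near `x₀` all constraints hold
  have hnear : ∀ᶠ x in nhds x₀, (∀ k, 0 ≤ ∑ i, (a k i : ℝ) * pt x i) ∧
      0 < ∑ i, (e i : ℝ) * pt x i := by
    refine Filter.Eventually.and (Filter.eventually_all.2 fun k => ?_) ?_
    · rcases (hz k).eq_or_lt with h | h
      · exact Filter.Eventually.of_forall fun x => (htight (a k) h.symm x).ge
      · have h' : 0 < ∑ i, (a k i : ℝ) * pt x₀ i := by rwa [hzx]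
        exact ((hcont fun i => (a k i : ℝ)).continuousAt.eventually
          (lt_mem_nhds h')).mono fun x hx => le_of_lt hx
    · have h' : 0 < ∑ i, (e i : ℝ) * pt x₀ i := by rw [hzx, hez]; exact one_pos
      exact (hcont fun i => (e i : ℝ)).continuousAt.eventually (lt_mem_nhds h')
  set τ := ∑ i, c i * z i with hτ
  -- `excess` is linear, nonnegative near `x₀` and zero at `x₀`, hence zero
  set excess : (Fin n → ℝ) → ℝ := fun x => ∑ i, c i * pt x i - τ * ∑ i, (e i : ℝ) * pt x i
    with hexcess
  have hge : ∀ᶠ x in nhds x₀, 0 ≤ excess x := by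
    filter_upwards [hnear] with x hx
    set t := ∑ i, (e i : ℝ) * pt x i with ht
    have hscale (f : ι → ℝ) : ∑ i, f i * (t⁻¹ * pt x i) = t⁻¹ * ∑ i, f i * pt x i := by
      rw [mul_sum]
      exact sum_congr rfl fun i _ => by ring
    have h := hmin (fun i => t⁻¹ * pt x i)
      (fun k => by
        rw [hscale]
        exact mul_nonneg (inv_pos.2 hx.2).le (hx.1 k))
      (by rw [hscale]; exact inv_mul_cancel₀ hx.2.ne')
    rw [hscale, inv_mul_eq_div, le_div_iff₀ hx.2] at h
    simp only [hexcess]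
    linarith
  have hpt_add (x y : Fin n → ℝ) (u : ℝ) (i : ι) :
      pt (fun j => x j + u * y j) i = pt x i + u * pt y i := by
    simp only [hpt, mul_sum, ← sum_add_distrib]
    exact sum_congr rfl fun j _ => by ring
  have hadd (x y : Fin n → ℝ) (u : ℝ) :
      excess (fun j => x j + u * y j) = excess x + u * excess y := by
    have h (f : ι → ℝ) : ∑ i, f i * (pt x i + u * pt y i) =
        ∑ i, f i * pt x i + u * ∑ i, f i * pt y i := by
      rw [mul_sum, ← sum_add_distrib]
      exact sum_congr rfl fun i _ => by ring
    simp only [hexcess, hpt_add, h]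
    ring
  have hx₀0 : excess x₀ = 0 := by
    simp only [hexcess, hzx, hez]
    rw [hτ]
    ring
  have hzero (y : Fin n → ℝ) : excess y = 0 := by
    have hc : Continuous fun u : ℝ => fun j => x₀ j + u * y j := by fun_prop
    have h0 : (fun j => x₀ j + 0 * y j) = x₀ := by funext j; ring
    have hev : ∀ᶠ u : ℝ in nhds 0, 0 ≤ u * excess y := by
      have := hc.continuousAt (x := (0 : ℝ)) |>.eventually (h0.symm ▸ hge)
      filter_upwards [this] with u hu
      rwa [hadd, hx₀0, zero_add] at hu
    obtain ⟨ε, hε, hball⟩ := Metric.eventually_nhds_iff.1 hev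
    have h1 := hball (y := ε / 2) (by
      rw [Real.dist_eq, sub_zero, abs_of_pos (by linarith)]
      linarith)
    have h2 := hball (y := -(ε / 2)) (by
      rw [Real.dist_eq, sub_zero, abs_neg, abs_of_pos (by linarith)]
      linarith)
    nlinarith
  -- a rational point near `x₀`
  obtain ⟨y, hy⟩ : ∃ y : Fin n → ℚ, (∀ k, 0 ≤ ∑ i, (a k i : ℝ) * pt (fun j => (y j : ℝ)) i) ∧
      0 < ∑ i, (e i : ℝ) * pt (fun j => (y j : ℝ)) i := by
    have hd : DenseRange fun (y : Fin n → ℚ) (j : Fin n) => (y j : ℝ) :=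
      DenseRange.piMap fun _ => Rat.denseRange_cast
    obtain ⟨_, ⟨y, rfl⟩, hx⟩ := hd.inter_nhds_nonempty hnear
    exact ⟨y, hx⟩
  set t : ℚ := ∑ i, e i * ∑ j, coef i j * y j with ht
  have hptq (f : ι → ℚ) : ∑ i, (f i : ℝ) * pt (fun j => (y j : ℝ)) i =
      ((∑ i, f i * ∑ j, coef i j * y j : ℚ) : ℝ) := by
    simp only [hpt]
    push_cast
    rfl
  have ht0 : 0 < t := by
    have := hy.2
    rw [hptq] at this
    exact_mod_cast this
  have hscale (f : ι → ℚ) : ∑ i, f i * (t⁻¹ * ∑ j, coef i j * y j) =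
      t⁻¹ * ∑ i, f i * ∑ j, coef i j * y j := by
    rw [mul_sum]
    exact sum_congr rfl fun i _ => by ring
  refine ⟨fun i => t⁻¹ * ∑ j, coef i j * y j, fun k => ?_, ?_, ?_⟩
  · have := hy.1 k
    rw [hptq] at this
    rw [hscale]
    exact mul_nonneg (inv_pos.2 ht0).le (by exact_mod_cast this)
  · rw [hscale]
    exact inv_mul_cancel₀ ht0.ne'
  · have h := hzero fun j => (y j : ℝ)
    simp only [hexcess] at h
    rw [hptq, sub_eq_zero] at h
    have h2 : ∑ i, c i * ((t⁻¹ * ∑ j, coef i j * y j : ℚ) : ℝ) =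
        (t : ℝ)⁻¹ * ∑ i, c i * pt (fun j => (y j : ℝ)) i := by
      rw [mul_sum]
      refine sum_congr rfl fun i _ => ?_
      simp only [hpt]
      push_cast
      ring
    rw [h2, h]
    have : (t : ℝ) ≠ 0 := by exact_mod_cast ht0.ne'
    change (t : ℝ)⁻¹ * (τ * (t : ℝ)) = τ
    field_simp

/-- The same for an objective with a maximum of two rational functionals: the sign of their
difference at the minimizer is one more rational constraint. -/
theorem exists_rational_minimizer_max {ι κ : Type*} [Fintype ι] [Fintype κ] (a : κ → ι → ℚ)
    (e u v : ι → ℚ) (c : ι → ℝ) (m : ℝ) (z : ι → ℝ) (hz : ∀ k, 0 ≤ ∑ i, a k i * z i)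
    (hez : ∑ i, e i * z i = 1)
    (hmin : ∀ w : ι → ℝ, (∀ k, 0 ≤ ∑ i, a k i * w i) → ∑ i, e i * w i = 1 →
      m * max (∑ i, u i * z i) (∑ i, v i * z i) + ∑ i, c i * z i ≤
        m * max (∑ i, u i * w i) (∑ i, v i * w i) + ∑ i, c i * w i) :
    ∃ q : ι → ℚ, (∀ k, 0 ≤ ∑ i, a k i * q i) ∧ ∑ i, e i * q i = 1 ∧
      m * max (∑ i, (u i : ℝ) * q i) (∑ i, (v i : ℝ) * q i) + ∑ i, c i * q i =
        m * max (∑ i, u i * z i) (∑ i, v i * z i) + ∑ i, c i * z i := by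
  wlog huv : ∑ i, v i * z i ≤ ∑ i, u i * z i generalizing u v
  · obtain ⟨q, h1, h2, h3⟩ := this v u (fun w hw hw1 => by
      have := hmin w hw hw1
      rwa [max_comm, max_comm (∑ i, (v i : ℝ) * w i)]) (le_of_not_ge huv)
    exact ⟨q, h1, h2, by rwa [max_comm, max_comm (∑ i, (u i : ℝ) * z i)]⟩
  have hobj (w : ι → ℝ) : ∑ i, (m * u i + c i) * w i =
      m * ∑ i, u i * w i + ∑ i, c i * w i := by
    rw [mul_sum, ← sum_add_distrib]
    exact sum_congr rfl fun i _ => by ring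
  have hdiff (w : ι → ℝ) : ∑ i, ((u i - v i : ℚ) : ℝ) * w i =
      ∑ i, u i * w i - ∑ i, v i * w i := by
    rw [← sum_sub_distrib]
    exact sum_congr rfl fun i _ => by push_cast; ring
  obtain ⟨q, h1, h2, h3⟩ := exists_rational_minimizer
    (fun k : Option κ => k.elim (fun i => u i - v i) a) e (fun i => m * u i + c i) z
    (fun k => by
      cases k with
      | none =>
        simp only [Option.elim_none]
        rw [hdiff]
        linarith
      | some k => exact hz k) hez
    (fun w hw hw1 => by
      have h := hmin w (fun k => hw (some k)) hw1
      have h' := hw none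
      simp only [Option.elim_none] at h'
      rw [hdiff] at h'
      rw [max_eq_left huv, max_eq_left (by linarith)] at h
      rw [hobj, hobj]
      exact h)
  refine ⟨q, fun k => h1 (some k), h2, ?_⟩
  have h' := h1 none
  simp only [Option.elim_none] at h'
  have hle : ∑ i, (v i : ℝ) * q i ≤ ∑ i, (u i : ℝ) * q i := by
    have h'' : (0 : ℝ) ≤ ∑ i, ((u i - v i : ℚ) : ℝ) * q i := by exact_mod_cast h'
    rw [hdiff] at h''
    linarith
  rw [max_eq_left hle, max_eq_left huv, ← hobj, ← hobj]
  exact h3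

/-! ### Optimal mixtures and the resource allocation problem -/

lemma exists_min_mixture {μ : ℝ} (hμ : 1 ≤ μ) {Ks : ℕ} (hKs : 1 ≤ Ks) (Kh Q s : ℕ)
    (cm cs cr : ℝ) :
    ∃ w, IsMixture μ Ks Kh w ∧
      ∀ w', IsMixture μ Ks Kh w' →
        mixtureTime Ks Kh Q s cm cs cr w ≤ mixtureTime Ks Kh Q s cm cs cr w' := by
  classical
  let ext (z : fileTypes Ks → ℝ) (j : ℕ ⊕ ℕ) : ℝ := if h : j ∈ fileTypes Ks then z ⟨j, h⟩ else 0
  have hext (z : fileTypes Ks → ℝ) (f : ℕ ⊕ ℕ → ℝ) :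
      ∑ j ∈ fileTypes Ks, ext z j * f j = ∑ j : fileTypes Ks, z j * f j := by
    rw [← sum_coe_sort]
    exact sum_congr rfl fun j _ => by simp [ext]
  have hext1 (z : fileTypes Ks → ℝ) : ∑ j ∈ fileTypes Ks, ext z j = ∑ j, z j := by
    simpa using hext z fun _ => 1
  have hres (w : ℕ ⊕ ℕ → ℝ) : ∀ j ∈ fileTypes Ks, ext (fun j => w j) j = w j := by
    intro j hj
    simp [ext, hj]
  have hcont (f : ℕ ⊕ ℕ → ℝ) :
      Continuous fun z : fileTypes Ks → ℝ => ∑ j ∈ fileTypes Ks, ext z j * f j := by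
    simp only [hext]
    fun_prop
  set Δ : Set (fileTypes Ks → ℝ) := {z | IsMixture μ Ks Kh (ext z)} with hΔ
  have hΔeq : Δ = stdSimplex ℝ (fileTypes Ks) ∩
      ({z | ∑ j ∈ fileTypes Ks, ext z j * (solverShare j + helperShare j : ℚ) ≤ μ} ∩
        {z | ∑ j ∈ fileTypes Ks, ext z j * helperShare j ≤ Kh}) := by
    ext z
    constructor
    · rintro ⟨h1, h2, h3, h4⟩
      refine ⟨⟨fun j => ?_, by rwa [hext1] at h2⟩, h3, h4⟩
      simpa [ext] using h1 j j.2
    · rintro ⟨⟨h1, h2⟩, h3, h4⟩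
      refine ⟨fun j hj => ?_, by rwa [hext1], h3, h4⟩
      simpa [ext, hj] using h1 ⟨j, hj⟩
  have hcompact : IsCompact Δ := by
    rw [hΔeq]
    exact (isCompact_stdSimplex ℝ _).inter_right
      ((isClosed_le (hcont _) continuous_const).inter (isClosed_le (hcont _) continuous_const))
  have hmem : Sum.inl 1 ∈ fileTypes Ks := by simp [fileTypes, hKs]
  -- storing every file at a single solver
  have hne : Δ.Nonempty := by
    refine ⟨Pi.single ⟨Sum.inl 1, hmem⟩ 1, ?_⟩
    have hsum (f : ℕ ⊕ ℕ → ℝ) : ∑ j ∈ fileTypes Ks,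
        ext (Pi.single ⟨Sum.inl 1, hmem⟩ 1) j * f j = f (Sum.inl 1) := by
      rw [hext, sum_eq_single_of_mem ⟨Sum.inl 1, hmem⟩ (mem_univ _)]
      · simp
      · intro j _ hj
        simp [hj]
    refine ⟨fun j hj => ?_, ?_, ?_, ?_⟩
    · simp only [ext, hj, dif_pos]
      by_cases h : (⟨j, hj⟩ : fileTypes Ks) = ⟨Sum.inl 1, hmem⟩
      · rw [h]
        simp
      · rw [Pi.single_eq_of_ne h]
    · simpa using hsum fun _ => 1
    · rw [hsum fun j => ((solverShare j + helperShare j : ℚ) : ℝ)]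
      simpa [solverShare, helperShare] using hμ
    · rw [hsum fun j => (helperShare j : ℝ)]
      simp [helperShare]
  have hobj : Continuous fun z => mixtureTime Ks Kh Q s cm cs cr (ext z) := by
    unfold mixtureTime
    have h1 := hcont fun j => (solverShare j : ℝ)
    have h2 := hcont fun j => (helperShare j : ℝ)
    have h3 := hcont (typeCost s Ks)
    fun_prop
  obtain ⟨z, hz, hzmin⟩ := hcompact.exists_isMinOn hne hobj.continuousOn
  refine ⟨ext z, hz, fun w' hw' => ?_⟩
  have hcongr (f : ℕ ⊕ ℕ → ℝ) : ∑ j ∈ fileTypes Ks, ext (fun j => w' j) j * f j =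
      ∑ j ∈ fileTypes Ks, w' j * f j :=
    sum_congr rfl fun j hj => by rw [hres w' j hj]
  have hw : (fun j : fileTypes Ks => w' j) ∈ Δ := by
    refine ⟨fun j hj => ?_, ?_, ?_, ?_⟩
    · rw [hres w' j hj]
      exact hw'.nonneg j hj
    · rw [sum_congr rfl (hres w')]
      exact hw'.sum_eq_one
    · rw [hcongr]
      exact hw'.storage
    · rw [hcongr]
      exact hw'.helpers
  have h := hzmin hw
  refine le_of_le_of_eq h ?_
  simp only [mixtureTime, hcongr]

/-- For rational storage the fastest mixture can be chosen with rational fractions. -/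
lemma exists_rational_min_mixture {μ : ℚ} (hμ : 1 ≤ μ) {Ks : ℕ} (hKs : 1 ≤ Ks) (Kh Q s : ℕ)
    (cm cs cr : ℝ) :
    ∃ q : ℕ ⊕ ℕ → ℚ, IsMixture μ Ks Kh (fun j => q j) ∧
      ∀ w', IsMixture μ Ks Kh w' →
        mixtureTime Ks Kh Q s cm cs cr (fun j => q j) ≤ mixtureTime Ks Kh Q s cm cs cr w' := by
  classical
  obtain ⟨w, hw, hmin⟩ := exists_min_mixture (μ := μ) (by exact_mod_cast hμ) hKs Kh Q s cm cs cr
  let ext (z : fileTypes Ks → ℝ) (j : ℕ ⊕ ℕ) : ℝ := if h : j ∈ fileTypes Ks then z ⟨j, h⟩ else 0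
  have hext (z : fileTypes Ks → ℝ) (f : ℕ ⊕ ℕ → ℝ) :
      ∑ j ∈ fileTypes Ks, ext z j * f j = ∑ j : fileTypes Ks, f j * z j := by
    rw [← sum_coe_sort]
    exact sum_congr rfl fun j _ => by simp [ext, mul_comm]
  let a : fileTypes Ks ⊕ Bool → fileTypes Ks → ℚ := Sum.elim (fun i j => if j = i then 1 else 0)
    fun b j => if b then μ - (solverShare j + helperShare j) else Kh - helperShare j
  -- the constraints `a` describe mixtures
  have ha (z : fileTypes Ks → ℝ) (hz1 : ∑ j, ((1 : ℚ) : ℝ) * z j = 1) :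
      (∀ k, 0 ≤ ∑ j, (a k j : ℝ) * z j) ↔ IsMixture μ Ks Kh (ext z) := by
    have h1 : ∑ j, z j = 1 := by simpa using hz1
    have e1 (i : fileTypes Ks) : ∑ j, (a (Sum.inl i) j : ℝ) * z j = z i := by
      rw [sum_eq_single_of_mem i (mem_univ _) fun j _ hj => by simp [a, hj]]
      simp [a]
    have e2 : ∑ j, (a (Sum.inr true) j : ℝ) * z j =
        μ - ∑ j : fileTypes Ks, ((solverShare j + helperShare j : ℚ) : ℝ) * z j := by
      have : (μ : ℝ) = ∑ j : fileTypes Ks, (μ : ℝ) * z j := by rw [← mul_sum, h1, mul_one]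
      rw [this, ← sum_sub_distrib]
      refine sum_congr rfl fun j _ => ?_
      simp only [a, Sum.elim_inr, if_true]
      push_cast
      ring
    have e3 : ∑ j, (a (Sum.inr false) j : ℝ) * z j =
        Kh - ∑ j : fileTypes Ks, (helperShare j : ℝ) * z j := by
      have : (Kh : ℝ) = ∑ j : fileTypes Ks, (Kh : ℝ) * z j := by rw [← mul_sum, h1, mul_one]
      rw [this, ← sum_sub_distrib]
      refine sum_congr rfl fun j _ => ?_
      simp only [a, Sum.elim_inr, Bool.false_eq_true, if_false]
      push_cast
      ring
    constructor
    · intro h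
      refine ⟨fun j hj => ?_, ?_, ?_, ?_⟩
      · have := h (Sum.inl ⟨j, hj⟩)
        rw [e1] at this
        simpa [ext, hj] using this
      · have := hext z fun _ => 1
        simp only [mul_one, one_mul] at this
        rw [this, h1]
      · have := h (Sum.inr true)
        rw [hext z fun j => ((solverShare j + helperShare j : ℚ) : ℝ)]
        linarith
      · have := h (Sum.inr false)
        rw [hext z fun j => (helperShare j : ℝ)]
        linarith
    · rintro h (i | b)
      · rw [e1]
        simpa [ext] using h.nonneg i i.2
      · cases b
        · have := h.helpers
          rw [hext z fun j => (helperShare j : ℝ)] at this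
          linarith
        · have := h.storage
          rw [hext z fun j => ((solverShare j + helperShare j : ℚ) : ℝ)] at this
          linarith
  have htime (z : fileTypes Ks → ℝ) : mixtureTime Ks Kh Q s cm cs cr (ext z) =
      cm * max (∑ j : fileTypes Ks, ((solverShare j / Ks : ℚ) : ℝ) * z j)
        (∑ j : fileTypes Ks, ((helperShare j / Kh : ℚ) : ℝ) * z j) +
      ∑ j : fileTypes Ks, (cs * typeCost s Ks j) * z j + cr * ((s : ℝ) * Q / Ks) := by
    unfold mixtureTime
    rw [hext z fun j => (solverShare j : ℝ), hext z fun j => (helperShare j : ℝ), hext, mul_sum,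
      sum_div, sum_div]
    push_cast
    simp only [div_mul_eq_mul_div, mul_assoc]
  have hw1 : ∑ j : fileTypes Ks, ((1 : ℚ) : ℝ) * w j = 1 := by
    have := hw.sum_eq_one
    rw [← sum_coe_sort] at this
    simpa using this
  have hresw : ∀ j ∈ fileTypes Ks, ext (fun j => w j) j = w j := by
    intro j hj
    simp [ext, hj]
  have hwext : IsMixture μ Ks Kh (ext fun j => w j) := by
    have hcongr (f : ℕ ⊕ ℕ → ℝ) : ∑ j ∈ fileTypes Ks, ext (fun j => w j) j * f j =
        ∑ j ∈ fileTypes Ks, w j * f j :=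
      sum_congr rfl fun j hj => by rw [hresw j hj]
    refine ⟨fun j hj => ?_, ?_, ?_, ?_⟩
    · rw [hresw j hj]
      exact hw.nonneg j hj
    · rw [sum_congr rfl hresw]
      exact hw.sum_eq_one
    · rw [hcongr]
      exact hw.storage
    · rw [hcongr]
      exact hw.helpers
  have htimew : mixtureTime Ks Kh Q s cm cs cr (ext fun j => w j) =
      mixtureTime Ks Kh Q s cm cs cr w := by
    have hcongr (f : ℕ ⊕ ℕ → ℝ) : ∑ j ∈ fileTypes Ks, ext (fun j => w j) j * f j =
        ∑ j ∈ fileTypes Ks, w j * f j :=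
      sum_congr rfl fun j hj => by rw [hresw j hj]
    simp only [mixtureTime, hcongr]
  obtain ⟨q, hq, hq1, hqt⟩ := exists_rational_minimizer_max a (fun _ => 1)
    (fun j => solverShare j / Ks) (fun j => helperShare j / Kh)
    (fun j => cs * typeCost s Ks j) cm (fun j => w j)
    ((ha _ hw1).2 hwext) hw1 (fun w' hw' hw'1 => by
      have h := hmin _ ((ha w' hw'1).1 hw')
      rw [← htimew, htime w', htime fun j => w j] at h
      exact (add_le_add_iff_right _).1 h)
  have hq1' : ∑ j, ((1 : ℚ) : ℝ) * ((q j : ℚ) : ℝ) = 1 := by exact_mod_cast hq1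
  have hqext : (fun j => (((if h : j ∈ fileTypes Ks then q ⟨j, h⟩ else 0 : ℚ) : ℚ) : ℝ)) =
      ext fun j => (q j : ℝ) := by
    funext j
    simp only [ext]
    split_ifs <;> simp
  refine ⟨fun j => if h : j ∈ fileTypes Ks then q ⟨j, h⟩ else 0, ?_, fun w' hw' => ?_⟩
  · rw [hqext]
    exact (ha _ hq1').1 fun k => by exact_mod_cast hq k
  · rw [hqext]
    refine le_trans (le_of_eq ?_) (hmin w' hw')
    rw [← htimew, htime fun j => (q j : ℝ), htime fun j => w j]
    exact congrArg (· + cr * ((s : ℝ) * Q / Ks)) hqt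

/-- Weights of any total mass have a barycenter where the envelope is at most the average. If the
mass is zero, then any point will do. -/
lemma exists_point_lowerConvexEnvelope {a b : ℕ} (hab : a ≤ b) (L w : ℕ → ℝ)
    (hw : ∀ r ∈ Icc a b, 0 ≤ w r) :
    ∃ x ∈ Set.Icc (a : ℝ) b, (∑ r ∈ Icc a b, w r) * x = ∑ r ∈ Icc a b, w r * r ∧
      (∑ r ∈ Icc a b, w r) * lowerConvexEnvelope
        {p : ℝ × ℝ | ∃ r ∈ Set.Icc a b, p = ((r : ℝ), L r)} x ≤ ∑ r ∈ Icc a b, w r * L r := by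
  set σ := ∑ r ∈ Icc a b, w r with hσ
  rcases (sum_nonneg hw).eq_or_lt with h0 | hpos
  · have hz : ∀ r ∈ Icc a b, w r = 0 := (sum_eq_zero_iff_of_nonneg hw).1 h0.symm
    refine ⟨a, ⟨le_rfl, by exact_mod_cast hab⟩, ?_, ?_⟩
    · rw [hσ, ← h0, zero_mul, sum_eq_zero fun r hr => by rw [hz r hr, zero_mul]]
    · rw [hσ, ← h0, zero_mul, sum_eq_zero fun r hr => by rw [hz r hr, zero_mul]]
  · rw [← hσ] at hpos
    have hw' : ∀ r ∈ Icc a b, 0 ≤ w r / σ := fun r hr => div_nonneg (hw r hr) hpos.le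
    have hw1 : ∑ r ∈ Icc a b, w r / σ = 1 := by rw [← sum_div, ← hσ, div_self hpos.ne']
    have key (f : ℕ → ℝ) : σ * ∑ r ∈ Icc a b, w r / σ * f r = ∑ r ∈ Icc a b, w r * f r := by
      rw [mul_sum]
      refine sum_congr rfl fun r _ => ?_
      field_simp
    refine ⟨∑ r ∈ Icc a b, w r / σ * r, ⟨?_, ?_⟩, key _, ?_⟩
    · calc (a : ℝ) = ∑ r ∈ Icc a b, w r / σ * a := by rw [← sum_mul, hw1, one_mul]
        _ ≤ _ := sum_le_sum fun r hr => mul_le_mul_of_nonneg_left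
          (by exact_mod_cast (mem_Icc.1 hr).1) (hw' r hr)
    · calc ∑ r ∈ Icc a b, w r / σ * r ≤ ∑ r ∈ Icc a b, w r / σ * b :=
          sum_le_sum fun r hr => mul_le_mul_of_nonneg_left
            (by exact_mod_cast (mem_Icc.1 hr).2) (hw' r hr)
        _ = b := by rw [← sum_mul, hw1, one_mul]
    · rw [← key]
      exact mul_le_mul_of_nonneg_left (lowerConvexEnvelope_le hw' hw1) hpos.le

/-- A mixture of file types is at least as slow as the allocation with the same average number of
copies of the files in each of the two parts. -/
lemma IsMixture.exists_allocation {K M N Q s Ks Kh : ℕ} {w : ℕ ⊕ ℕ → ℝ}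
    (hw : IsMixture ((M : ℝ) / N) Ks Kh w) (hadm : Admissible K Q s Ks Kh) (hs : 1 ≤ s)
    {cm cs : ℝ} (cr : ℝ) (hcs : 0 ≤ cs) :
    ∃ a : Allocation, a.Feasible K M N Q s ∧
      a.time Q s cm cs cr ≤ mixtureTime Ks Kh Q s cm cs cr w := by
  have hKs : 1 ≤ Ks := hs.trans hadm.s_le
  obtain ⟨h0, h1, h2, h3⟩ := hw
  simp only [fileTypes, sum_disjSum, solverShare, helperShare, Sum.elim_inl, Sum.elim_inr, add_zero,
    Rat.cast_zero, mul_zero, sum_const_zero, zero_add, Rat.cast_one, mul_one, Rat.cast_add,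
    Rat.cast_natCast] at h1 h2 h3
  obtain ⟨r₁, hr₁, e1, l1⟩ := exists_point_lowerConvexEnvelope hKs (fun r => loadCDC r s Ks)
    (fun r => w (Sum.inl r)) fun r hr => h0 _ (by simpa [fileTypes] using hr)
  obtain ⟨r₂, hr₂, e2, l2⟩ := exists_point_lowerConvexEnvelope (Nat.zero_le Ks)
    (fun r => loadACDC r s Ks)
    (fun r => w (Sum.inr r)) fun r hr => h0 _ (by simpa [fileTypes] using hr)
  have p1 : 0 ≤ ∑ r ∈ Icc 1 Ks, w (Sum.inl r) :=
    sum_nonneg fun r hr => h0 _ (by simpa [fileTypes] using hr)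
  have p2 : 0 ≤ ∑ r ∈ Icc 0 Ks, w (Sum.inr r) :=
    sum_nonneg fun r hr => h0 _ (by simpa [fileTypes] using hr)
  set α := ∑ r ∈ Icc 1 Ks, w (Sum.inl r) with hα
  have hα' : ∑ r ∈ Icc 0 Ks, w (Sum.inr r) = 1 - α := by linarith
  rw [hα'] at e2 l2 p2 h3
  refine ⟨⟨α, r₁, r₂, Ks, Kh⟩, ⟨hadm.servers, hKs, hadm.Ks_le, hadm.s_le, hadm.batches, ?_,
    ⟨p1, by linarith⟩, by simpa using hr₁, by simpa using hr₂, ?_⟩, ?_⟩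
  · simp only [mul_add, sum_add_distrib, mul_one, ← e1, ← e2, hα'] at h2 ⊢
    linarith
  · rintro (rfl : Kh = 0)
    simp only [Nat.cast_zero] at h3
    show α = 1
    linarith
  · simp only [mixtureTime, Allocation.time, fileTypes, sum_disjSum, solverShare, helperShare,
      Sum.elim_inl, Sum.elim_inr, Rat.cast_zero, mul_zero, sum_const_zero, zero_add, Rat.cast_one,
      mul_one, Rat.cast_natCast, hα', ← e1, ← e2, typeCost]
    have l1' : α * loadCDCEnv r₁ s Ks ≤ _ := l1
    have l2' : (1 - α) * loadACDCEnv r₂ s Ks ≤ _ := l2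
    have := mul_le_mul_of_nonneg_left (add_le_add l1' l2') hcs
    linarith

namespace Allocation

variable {a : Allocation} {K M N Q s : ℕ}

lemma Feasible.admissible (h : a.Feasible K M N Q s) : Admissible K Q s a.Ks a.Kh :=
  ⟨h.servers, h.s_le, h.Ks_le, h.batches⟩

/-- Every allocation is attained by a mixture of file types. -/
lemma Feasible.exists_mixture (h : a.Feasible K M N Q s) (cm cs cr : ℝ) :
    ∃ w, IsMixture ((M : ℝ) / N) a.Ks a.Kh w ∧
      mixtureTime a.Ks a.Kh Q s cm cs cr w = a.time Q s cm cs cr := by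
  obtain ⟨u, hu0, hu1, hur, huL⟩ := exists_weights_lowerConvexEnvelope (a := 1) (b := a.Ks)
    (fun r => loadCDC r s a.Ks) (x := a.r₁) (by simpa using h.r₁_mem)
  obtain ⟨v, hv0, hv1, hvr, hvL⟩ := exists_weights_lowerConvexEnvelope (a := 0) (b := a.Ks)
    (fun r => loadACDC r s a.Ks) (x := a.r₂) (by simpa using h.r₂_mem)
  have hα0 := h.α_mem.1
  have hα1 : 0 ≤ 1 - a.α := sub_nonneg.2 h.α_mem.2
  refine ⟨Sum.elim (fun r => a.α * u r) fun r => (1 - a.α) * v r, ⟨?_, ?_, ?_, ?_⟩, ?_⟩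
  · rintro (r | r) hr
    · exact mul_nonneg hα0 (hu0 r (by simpa [fileTypes] using hr))
    · exact mul_nonneg hα1 (hv0 r (by simpa [fileTypes] using hr))
  · simp only [fileTypes, sum_disjSum, Sum.elim_inl, Sum.elim_inr, ← mul_sum, hu1, hv1]
    ring
  · simp only [fileTypes, sum_disjSum, solverShare, helperShare, Sum.elim_inl, Sum.elim_inr,
      Rat.cast_zero, mul_zero, sum_const_zero, zero_add, Rat.cast_one, Rat.cast_add,
      Rat.cast_natCast, mul_assoc, ← mul_sum, mul_add, sum_add_distrib, mul_one, hur, hvr, hv1]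
    have := h.storage
    linarith
  · simp only [fileTypes, sum_disjSum, helperShare, Sum.elim_inl, Sum.elim_inr,
      Rat.cast_one, Rat.cast_zero, mul_zero, sum_const_zero, zero_add, ← mul_sum, mul_one, hv1]
    rcases Nat.eq_zero_or_pos a.Kh with h0 | hpos
    · rw [h.no_helper h0]
      simp
    · have : (1 : ℝ) ≤ a.Kh := by exact_mod_cast hpos
      linarith
  · have e1 : _ = loadCDCEnv a.r₁ s a.Ks := huL
    have e2 : _ = loadACDCEnv a.r₂ s a.Ks := hvL
    simp only [mixtureTime, Allocation.time, fileTypes, sum_disjSum, solverShare, helperShare,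
      Sum.elim_inl, Sum.elim_inr, Rat.cast_zero, mul_zero, sum_const_zero, zero_add, Rat.cast_one,
      mul_one, Rat.cast_natCast, typeCost, mul_assoc, ← mul_sum, hur, hvr, hv1, e1, e2]
    ring

end Allocation

/-- The minimum of the resource allocation problem is attained, and it is the execution time of a
mixture with rational fractions. -/
lemma exists_isLeast_allocationTimes {K M N Q s : ℕ} {cm cs : ℝ} (cr : ℝ) (hN : 0 < N) (hNM : N ≤ M)
    (hs : 1 ≤ s) (hsK : s ≤ K) (hsQ : s ≤ Q) (hcs : 0 ≤ cs) :
    ∃ (Ks Kh : ℕ) (q : ℕ ⊕ ℕ → ℚ), Admissible K Q s Ks Kh ∧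
      IsMixture ((M : ℝ) / N) Ks Kh (fun j => q j) ∧
      IsLeast (allocationTimes K M N Q s cm cs cr)
        (mixtureTime Ks Kh Q s cm cs cr fun j => q j) ∧
      ∀ Ks' Kh' w, Admissible K Q s Ks' Kh' → IsMixture ((M : ℝ) / N) Ks' Kh' w →
        mixtureTime Ks Kh Q s cm cs cr (fun j => q j) ≤ mixtureTime Ks' Kh' Q s cm cs cr w := by
  classical
  have hμ : (1 : ℚ) ≤ (M : ℚ) / N := by
    rw [one_le_div (by exact_mod_cast hN)]
    exact_mod_cast hNM
  have hcast : (((M : ℚ) / N : ℚ) : ℝ) = (M : ℝ) / N := by push_cast; rfl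
  have hex (p : ℕ × ℕ) (hp : 1 ≤ p.1) := exists_rational_min_mixture hμ hp p.2 Q s cm cs cr
  simp only [hcast] at hex
  choose! q hq hqmin using hex
  let P := ((range (K + 1)) ×ˢ (range (K + 1))).filter fun p => Admissible K Q s p.1 p.2
  have hP (Ks Kh : ℕ) (h : Admissible K Q s Ks Kh) : (Ks, Kh) ∈ P := by
    have := h.servers
    simp only [P, mem_filter, mem_product, mem_range]
    exact ⟨⟨by omega, by omega⟩, h⟩
  obtain ⟨p, hpP, hp⟩ := P.exists_min_image
    (fun p => mixtureTime p.1 p.2 Q s cm cs cr fun j => q p j)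
    ⟨(s, 0), hP s 0 ⟨by omega, le_rfl, hsQ, by simp⟩⟩
  have hadm : Admissible K Q s p.1 p.2 := (mem_filter.1 hpP).2
  have hmin (Ks' Kh' : ℕ) (w : ℕ ⊕ ℕ → ℝ) (h : Admissible K Q s Ks' Kh')
      (hw : IsMixture ((M : ℝ) / N) Ks' Kh' w) :
      mixtureTime p.1 p.2 Q s cm cs cr (fun j => q p j) ≤ mixtureTime Ks' Kh' Q s cm cs cr w :=
    (hp _ (hP Ks' Kh' h)).trans (hqmin (Ks', Kh') (hs.trans h.s_le) w hw)
  have hqp := hq p (hs.trans hadm.s_le)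
  refine ⟨p.1, p.2, q p, hadm, hqp, ⟨?_, ?_⟩, hmin⟩
  · obtain ⟨a, ha, hle⟩ := hqp.exists_allocation hadm hs (cm := cm) cr hcs
    refine ⟨a, ha, hle.antisymm ?_⟩
    obtain ⟨w, hw, e⟩ := ha.exists_mixture cm cs cr
    rw [← e]
    exact hmin _ _ _ ha.admissible hw
  · rintro _ ⟨a, ha, rfl⟩
    obtain ⟨w, hw, e⟩ := ha.exists_mixture cm cs cr
    rw [← e]
    exact hmin _ _ _ ha.admissible hw

/-! ### Schemes for mixtures of file types -/

/-- The files of a given type are split into batches of equal size, one for each set of `r` solvers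
and, if the files are stored at a helper, for each choice of the helper. This is the number of
batches. -/
def batchCount (Ks Kh : ℕ) : ℕ ⊕ ℕ → ℕ :=
  Sum.elim (fun r => Ks.choose r) fun r => Kh * Ks.choose r

/-- There is a scheme with batches of `β j` files for each type `j`, and `E` further files which are
mapped by one solver and sent uncoded. -/
lemma exists_scheme_of_batches {K M N Q s V Ks Kh : ℕ}
    (hV : ∀ r, 1 ≤ r → r ≤ K → r * (K + 1) ∣ V) (hV0 : 0 < V) (hN0 : 0 < N) (hQ : 0 < Q)
    (hs : 1 ≤ s) (hadm : Admissible K Q s Ks Kh) (β : ℕ ⊕ ℕ → ℕ) (E : ℕ)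
    (hN : ∑ j ∈ fileTypes Ks, (β j * batchCount Ks Kh j : ℝ) + E = N)
    (hM : ∑ j ∈ fileTypes Ks, (β j * batchCount Ks Kh j : ℝ) * (solverShare j + helperShare j : ℚ)
      + E ≤ M) {cm cs : ℝ} (cr : ℝ) (hcm : 0 ≤ cm) :
    ∃ S : Scheme K M N Q s V,
      S.time cm cs cr ≤ mixtureTime Ks Kh Q s cm cs cr
        (fun j => (β j * batchCount Ks Kh j : ℝ) / N) + E * (cm + cs) / N ∧
      (E = 0 → S.time cm cs cr = mixtureTime Ks Kh Q s cm cs cr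
        (fun j => (β j * batchCount Ks Kh j : ℝ) / N)) := by
  classical
  have hN' : (0 : ℝ) < N := by exact_mod_cast hN0
  have hQ' : (0 : ℝ) < Q := by exact_mod_cast hQ
  have hV' : (0 : ℝ) < V := by exact_mod_cast hV0
  have hKK := hadm.servers
  obtain ⟨𝓢, -, rfl⟩ := exists_subset_card_eq (s := (univ : Finset (Fin K))) (n := Ks)
    (by simp; omega)
  obtain ⟨𝓗, h𝓗, rfl⟩ := exists_subset_card_eq (s := 𝓢ᶜ) (n := Kh)
    (by rw [card_compl, Fintype.card_fin]; omega)
  have hdisj : Disjoint 𝓢 𝓗 := disjoint_of_subset_right h𝓗 disjoint_compl_right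
  have hmul (f : ℕ → ℝ) : ∑ r ∈ Icc 0 𝓢.card,
      (β (Sum.inr r) : ℝ) * ((𝓗.card : ℝ) * 𝓢.card.choose r) * f r =
      𝓗.card * ∑ r ∈ Icc 0 𝓢.card, (β (Sum.inr r) : ℝ) * 𝓢.card.choose r * f r := by
    rw [mul_sum]
    exact sum_congr rfl fun r _ => by ring
  have hmul1 : ∑ r ∈ Icc 0 𝓢.card, (β (Sum.inr r) : ℝ) * ((𝓗.card : ℝ) * 𝓢.card.choose r) =
      𝓗.card * ∑ r ∈ Icc 0 𝓢.card, (β (Sum.inr r) : ℝ) * 𝓢.card.choose r := by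
    simpa using hmul fun _ => 1
  simp only [fileTypes, sum_disjSum, solverShare, helperShare, batchCount, Sum.elim_inl,
    Sum.elim_inr, add_zero, Rat.cast_one, Rat.cast_add, Rat.cast_natCast, Nat.cast_mul, hmul,
    hmul1, Rat.cast_zero] at hN hM
  obtain ⟨S, hS, hpeak, hpeak0, hload⟩ := exists_coded_scheme (M := M) (N := N) (Q := Q) hV hs
    hdisj hadm.s_le hadm.batches (fun r => β (Sum.inl r)) (fun r => β (Sum.inr r)) E hN hM rfl rfl
  have hdiv (f : ℕ → ℝ) (t : Finset ℕ) (g : ℕ → ℝ) :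
      ∑ r ∈ t, g r / N * f r = (∑ r ∈ t, g r * f r) / N := by
    rw [sum_div]
    exact sum_congr rfl fun r _ => by ring
  have hdiv1 (t : Finset ℕ) (g : ℕ → ℝ) : ∑ r ∈ t, g r / N = (∑ r ∈ t, g r) / N := by
    rw [sum_div]
  have htime : mixtureTime 𝓢.card 𝓗.card Q s cm cs cr
      (fun j => (β j * batchCount 𝓢.card 𝓗.card j : ℝ) / N) = cm * (max
      (((∑ r ∈ Icc 1 𝓢.card, (β (Sum.inl r) : ℝ) * 𝓢.card.choose r * r) +
        𝓗.card * (∑ r ∈ Icc 0 𝓢.card, (β (Sum.inr r) : ℝ) * 𝓢.card.choose r * r)) / 𝓢.card)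
      ((𝓗.card * (∑ r ∈ Icc 0 𝓢.card, (β (Sum.inr r) : ℝ) * 𝓢.card.choose r)) / 𝓗.card) / N) +
      cs * (((∑ r ∈ Icc 1 𝓢.card, (β (Sum.inl r) : ℝ) * 𝓢.card.choose r * loadCDC r s 𝓢.card) +
        𝓗.card * (∑ r ∈ Icc 0 𝓢.card,
          (β (Sum.inr r) : ℝ) * 𝓢.card.choose r * loadACDC r s 𝓢.card)) / N) +
      cr * ((s : ℝ) * Q / 𝓢.card) := by
    rw [← max_div_div_right hN'.le]
    simp only [mixtureTime, fileTypes, sum_disjSum, solverShare, helperShare, batchCount,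
      Sum.elim_inl, Sum.elim_inr, mul_zero, sum_const_zero, zero_add, mul_one, Rat.cast_zero,
      Rat.cast_one, Rat.cast_natCast, Nat.cast_mul, hdiv, hdiv1, hmul, hmul1, typeCost,
      ← add_div]
    simp only [div_div, mul_comm (N : ℝ)]
  have hcomm : S.commLoad = ((∑ r ∈ Icc 1 𝓢.card,
      (β (Sum.inl r) : ℝ) * 𝓢.card.choose r * loadCDC r s 𝓢.card) +
        𝓗.card * (∑ r ∈ Icc 0 𝓢.card,
          (β (Sum.inr r) : ℝ) * 𝓢.card.choose r * loadACDC r s 𝓢.card)) / N + E / N := by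
    unfold Scheme.commLoad
    rw [hload]
    field_simp
  have hred := S.sup_card_reduceSet hQ hs
  rw [hS] at hred
  refine ⟨S, ?_⟩
  rw [htime]
  unfold Scheme.time Scheme.peakLoad
  rw [hcomm, hred]
  refine ⟨?_, ?_⟩
  · have h1 := mul_le_mul_of_nonneg_left (div_le_div_of_nonneg_right hpeak hN'.le) hcm
    rw [add_div] at h1
    have h2 : (E : ℝ) * (cm + cs) / N = cm * (E / N) + cs * (E / N) := by ring
    rw [h2]
    linarith
  · rintro rfl
    rw [hpeak0 rfl]
    simp

/-- If there are no batches of type `j`, then there are no helpers and hence no such files. -/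
lemma IsMixture.eq_zero_of_batchCount_eq_zero {μ : ℝ} {Ks Kh : ℕ} {w : ℕ ⊕ ℕ → ℝ}
    (hw : IsMixture μ Ks Kh w) {j : ℕ ⊕ ℕ} (hj : j ∈ fileTypes Ks)
    (h : batchCount Ks Kh j = 0) : w j = 0 := by
  have hj' := hj
  cases j with
  | inl r =>
    simp only [fileTypes, inl_mem_disjSum, mem_Icc] at hj'
    exact absurd h (Nat.choose_pos hj'.2).ne'
  | inr r =>
    simp only [fileTypes, inr_mem_disjSum, mem_Icc] at hj'
    have h2 : Kh = 0 := (mul_eq_zero.1 h).resolve_right (Nat.choose_pos hj'.2).ne'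
    have h3 := hw.helpers
    rw [h2, Nat.cast_zero] at h3
    have h4 := single_le_sum (f := fun j => w j * (helperShare j : ℝ))
      (fun j hj => mul_nonneg (hw.nonneg j hj) (by exact_mod_cast helperShare_nonneg j)) hj
    simp only [helperShare, Sum.elim_inr, Rat.cast_one, mul_one] at h4
    exact le_antisymm (h4.trans h3) (hw.nonneg _ hj)

/-- Rounding the fractions of a mixture down to whole batches leaves a bounded number of files. -/
lemma IsMixture.exists_scheme {K M N Q s V Ks Kh : ℕ} {w : ℕ ⊕ ℕ → ℝ}
    (hw : IsMixture ((M : ℝ) / N) Ks Kh w) (hadm : Admissible K Q s Ks Kh)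
    (hV : ∀ r, 1 ≤ r → r ≤ K → r * (K + 1) ∣ V) (hV0 : 0 < V) (hN0 : 0 < N) (hQ : 0 < Q)
    (hs : 1 ≤ s) {cm cs : ℝ} (cr : ℝ) (hcm : 0 ≤ cm) (hcs : 0 ≤ cs) :
    ∃ S : Scheme K M N Q s V, S.time cm cs cr ≤
      mixtureTime Ks Kh Q s cm cs cr w + ((K + 1) * 2 ^ K : ℕ) * (cm + cs) / N := by
  have hN' : (0 : ℝ) < N := by exact_mod_cast hN0
  set c : ℕ ⊕ ℕ → ℝ := fun j => batchCount Ks Kh j with hc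
  have hc0 (j) : 0 ≤ c j := Nat.cast_nonneg _
  set β : ℕ ⊕ ℕ → ℕ := fun j => ⌊N * w j / c j⌋₊ with hβ
  have hle (j) (hj : j ∈ fileTypes Ks) : β j * c j ≤ N * w j := by
    have hNw : 0 ≤ N * w j := mul_nonneg hN'.le (hw.nonneg j hj)
    rcases (hc0 j).eq_or_lt with h | h
    · rwa [← h, mul_zero]
    · rw [← le_div_iff₀ h]
      exact Nat.floor_le (div_nonneg hNw h.le)
  have hlt (j) (hj : j ∈ fileTypes Ks) : N * w j ≤ β j * c j + c j := by
    rcases (hc0 j).eq_or_lt with h | h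
    · have hzero : w j = 0 := hw.eq_zero_of_batchCount_eq_zero hj (Nat.cast_eq_zero.1 h.symm)
      rw [hzero, ← h]
      simp
    · have := (Nat.lt_floor_add_one (N * w j / c j)).le
      rw [div_le_iff₀ h] at this
      linarith
  have hsumN : ∑ j ∈ fileTypes Ks, N * w j = N := by rw [← mul_sum, hw.sum_eq_one, mul_one]
  have hsumle : ∑ j ∈ fileTypes Ks, β j * batchCount Ks Kh j ≤ N := by
    have : ∑ j ∈ fileTypes Ks, β j * c j ≤ N := hsumN ▸ sum_le_sum hle
    simp only [hc] at this
    exact_mod_cast this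
  obtain ⟨E, hE⟩ := Nat.exists_eq_add_of_le hsumle
  have hE' : ∑ j ∈ fileTypes Ks, β j * c j + E = N := by
    have := congrArg (Nat.cast (R := ℝ)) hE
    push_cast at this
    exact this.symm
  have hEle : (E : ℝ) ≤ ((K + 1) * 2 ^ K : ℕ) := by
    have h1 : (E : ℝ) ≤ ∑ j ∈ fileTypes Ks, c j := by
      have := sum_le_sum hlt
      rw [hsumN, sum_add_distrib] at this
      linarith
    refine h1.trans ?_
    rw [hc, ← Nat.cast_sum, Nat.cast_le]
    have h2 : ∑ r ∈ Icc 0 Ks, Ks.choose r = 2 ^ Ks := by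
      rw [← Nat.sum_range_choose, Nat.range_succ_eq_Icc_zero]
    have h3 : ∑ r ∈ Icc 1 Ks, Ks.choose r ≤ 2 ^ Ks := by
      rw [← h2]
      exact sum_le_sum_of_subset (Icc_subset_Icc_left zero_le_one)
    have hKK := hadm.servers
    have hKs := hadm.s_le
    calc ∑ j ∈ fileTypes Ks, batchCount Ks Kh j
        = ∑ r ∈ Icc 1 Ks, Ks.choose r + Kh * ∑ r ∈ Icc 0 Ks, Ks.choose r := by
          simp [fileTypes, sum_disjSum, batchCount, mul_sum]
      _ ≤ 2 ^ Ks + Kh * 2 ^ Ks := by rw [h2]; exact Nat.add_le_add_right h3 _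
      _ = (Kh + 1) * 2 ^ Ks := by ring
      _ ≤ (K + 1) * 2 ^ K := Nat.mul_le_mul (by omega) (Nat.pow_le_pow_right two_pos (by omega))
  obtain ⟨S, hS, -⟩ := exists_scheme_of_batches (M := M) (N := N) (cs := cs) hV hV0 hN0 hQ hs hadm β
    E hE' (by
      -- a leftover file needs one copy only, which every file of the mixture has
      have h1 := hw.storage
      rw [le_div_iff₀ hN', sum_mul] at h1
      refine le_trans ?_ h1
      have h2 : (E : ℝ) = ∑ j ∈ fileTypes Ks, (N * w j - β j * c j) := by
        rw [sum_sub_distrib, hsumN]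
        linarith
      rw [h2, ← sum_add_distrib]
      refine sum_le_sum fun j hj => ?_
      have h3 : (1 : ℝ) ≤ (solverShare j + helperShare j : ℚ) := by
        exact_mod_cast one_le_shares hj
      have h4 := mul_le_mul_of_nonneg_left h3 (sub_nonneg.2 (hle j hj))
      linarith) cr hcm
  refine ⟨S, hS.trans (add_le_add (mixtureTime_mono hcm hcs fun j hj => ?_) ?_)⟩
  · rw [div_le_iff₀ hN', mul_comm (w j)]
    exact hle j hj
  · gcongr

/-- For a suitable number of files a rational mixture is attained without leftover files. -/
lemma IsMixture.exists_scheme_mul {K M N Q s Ks Kh : ℕ} {q : ℕ ⊕ ℕ → ℚ}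
    (hq : IsMixture ((M : ℝ) / N) Ks Kh fun j => q j) (hadm : Admissible K Q s Ks Kh)
    (hN0 : 0 < N) (hQ : 0 < Q) (hs : 1 ≤ s) {cm cs : ℝ} (cr : ℝ) (hcm : 0 ≤ cm) (hcs : 0 ≤ cs) :
    ∃ t₀ : ℕ, 0 < t₀ ∧ ∀ t : ℕ, 0 < t → t₀ ∣ t → ∀ V : ℕ, 0 < V →
      (∀ r, 1 ≤ r → r ≤ K → r * (K + 1) ∣ V) → ∃ S : Scheme K (t * M) (t * N) Q s V,
        S.time cm cs cr ≤ mixtureTime Ks Kh Q s cm cs cr fun j => q j := by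
  refine ⟨∏ j ∈ fileTypes Ks, (q j).den * max 1 (batchCount Ks Kh j),
    prod_pos fun j _ => Nat.mul_pos (q j).den_pos (by omega), fun t ht htdvd V hV0 hV => ?_⟩
  have hN' : (0 : ℝ) < (t * N : ℕ) := by exact_mod_cast Nat.mul_pos ht hN0
  have hex (j : ℕ ⊕ ℕ) (hj : j ∈ fileTypes Ks) :
      ∃ b : ℕ, (b : ℝ) * batchCount Ks Kh j = (t * N : ℕ) * q j := by
    rcases Nat.eq_zero_or_pos (batchCount Ks Kh j) with h | h
    · refine ⟨0, ?_⟩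
      rw [hq.eq_zero_of_batchCount_eq_zero hj h]
      simp
    · obtain ⟨m, hm⟩ := (dvd_prod_of_mem (fun j => (q j).den * max 1 (batchCount Ks Kh j)) hj).trans
        htdvd
      rw [max_eq_right h] at hm
      refine ⟨m * N * (q j).num.toNat, ?_⟩
      have hnum : (((q j).num.toNat : ℕ) : ℝ) = (q j).den * q j := by
        have h0 : 0 ≤ q j := by exact_mod_cast hq.nonneg j hj
        have h1 : (((q j).num.toNat : ℕ) : ℤ) = (q j).num :=
          Int.toNat_of_nonneg (Rat.num_nonneg.2 h0)
        have h2 : (((q j).num.toNat : ℕ) : ℚ) = (q j).den * q j := by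
          rw [Rat.den_mul_eq_num, ← h1]
          rfl
        exact_mod_cast h2
      rw [hm]
      push_cast
      rw [hnum]
      ring
  choose! β hβ using hex
  obtain ⟨S, hS, -⟩ := exists_scheme_of_batches (M := t * M) (N := t * N) (cs := cs) hV hV0
    (Nat.mul_pos ht hN0) hQ hs hadm β 0 (by
      rw [sum_congr rfl hβ, ← mul_sum, hq.sum_eq_one]
      simp) (by
      rw [sum_congr rfl fun j hj => by rw [hβ j hj, mul_assoc], ← mul_sum]
      have h1 := mul_le_mul_of_nonneg_left hq.storage hN'.le
      have h2 : ((t * N : ℕ) : ℝ) * (M / N) = (t * M : ℕ) := by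
        have : (N : ℝ) ≠ 0 := by positivity
        push_cast
        field_simp
      rw [h2] at h1
      simpa using h1) cr hcm
  refine ⟨S, hS.trans ?_⟩
  simp only [Nat.cast_zero, zero_mul, zero_div, add_zero]
  refine mixtureTime_mono hcm hcs fun j hj => ?_
  rw [hβ j hj, mul_div_cancel_left₀ _ hN'.ne']

/-- An integral allocation mixes two file types only, and needs no rounding. -/
lemma Allocation.Feasible.time_mem_executionTimes {a : Allocation} {K M N Q s V : ℕ}
    (h : a.Feasible K M N Q s) (hint : a.Integral N)
    (hV : ∀ r, 1 ≤ r → r ≤ K → r * (K + 1) ∣ V) (hV0 : 0 < V) (hN0 : 0 < N) (hQ : 0 < Q)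
    (hs : 1 ≤ s) {cm : ℝ} (cs cr : ℝ) (hcm : 0 ≤ cm) :
    a.time Q s cm cs cr ∈ executionTimes K M N Q s V cm cs cr := by
  obtain ⟨r₁, r₂, b₁, b₂, e₁, e₂, hb₁, hb₂⟩ := hint
  have hN' : (0 : ℝ) < N := by exact_mod_cast hN0
  have hr₁ : r₁ ∈ Icc 1 a.Ks := by
    have := h.r₁_mem
    rw [e₁] at this
    exact mem_Icc.2 ⟨by exact_mod_cast this.1, by exact_mod_cast this.2⟩
  have hr₂ : r₂ ∈ Icc 0 a.Ks := by
    have := h.r₂_mem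
    rw [e₂] at this
    exact mem_Icc.2 ⟨Nat.zero_le _, by exact_mod_cast this.2⟩
  let β : ℕ ⊕ ℕ → ℕ := Sum.elim (fun r => if r = r₁ then b₁ else 0) fun r => if r = r₂ then b₂ else 0
  have hsum (f : ℕ ⊕ ℕ → ℝ) : ∑ j ∈ fileTypes a.Ks, (β j * batchCount a.Ks a.Kh j : ℝ) * f j =
      N * (a.α * f (Sum.inl r₁) + (1 - a.α) * f (Sum.inr r₂)) := by
    rw [fileTypes, sum_disjSum, sum_eq_single_of_mem r₁ hr₁ fun r _ hr => by simp [β, hr],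
      sum_eq_single_of_mem r₂ hr₂ fun r _ hr => by simp [β, hr]]
    simp only [β, Sum.elim_inl, Sum.elim_inr, if_true, batchCount, Nat.cast_mul]
    rw [← hb₁, ← hb₂]
    ring
  have hsum' (f : ℕ ⊕ ℕ → ℝ) :
      ∑ j ∈ fileTypes a.Ks, (β j * batchCount a.Ks a.Kh j : ℝ) / N * f j =
        a.α * f (Sum.inl r₁) + (1 - a.α) * f (Sum.inr r₂) := by
    rw [← mul_right_inj' hN'.ne', ← hsum f, mul_sum]
    refine sum_congr rfl fun j _ => ?_
    field_simp
  obtain ⟨S, -, hS⟩ := exists_scheme_of_batches (M := M) (N := N) (cs := cs) hV hV0 hN0 hQ hs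
    h.admissible β 0 (by
      have := hsum fun _ => 1
      simp only [mul_one] at this
      rw [this]
      simp) (by
      rw [hsum fun j => ((solverShare j + helperShare j : ℚ) : ℝ)]
      have := h.storage
      rw [le_div_iff₀ hN', e₁, e₂] at this
      simp only [solverShare, helperShare, Sum.elim_inl, Sum.elim_inr, add_zero, Rat.cast_add,
        Rat.cast_natCast, Rat.cast_one, Nat.cast_zero]
      linarith) cr hcm
  refine ⟨S, (hS rfl).trans ?_⟩
  unfold mixtureTime
  rw [hsum' fun j => (solverShare j : ℝ), hsum' fun j => (helperShare j : ℝ), hsum', time, e₁, e₂,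
    loadCDCEnv_natCast hs h.s_le hr₁, loadACDCEnv_natCast hs h.s_le hr₂]
  simp only [solverShare, helperShare, typeCost, Sum.elim_inl, Sum.elim_inr, Rat.cast_zero,
    Rat.cast_one, Rat.cast_natCast]
  ring_nf

/-- Execution times are monotone in three natural numbers, so that there is a least one. -/
lemma exists_isLeast_executionTimes {K M N Q s V : ℕ} (hNM : N ≤ M) (hs : 1 ≤ s) (hsK : s ≤ K)
    {cm cs cr : ℝ} (hcm : 0 ≤ cm) (hcs : 0 ≤ cs) (hcr : 0 ≤ cr) :
    ∃ T, IsLeast (executionTimes K M N Q s V cm cs cr) T := by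
  let g : ℕ × ℕ × ℕ → ℝ := fun x => cm * ((x.1 : ℝ) / N) + cs * ((x.2.1 : ℝ) / (N * Q * V)) +
    cr * (x.2.2 : ℝ)
  have hg : Monotone g := by
    rintro ⟨x, y, z⟩ ⟨x', y', z'⟩ ⟨h1, h2, h3⟩
    have h1' : (x : ℝ) ≤ x' := by exact_mod_cast h1
    have h2' : (y : ℝ) ≤ y' := by exact_mod_cast h2
    have h3' : (z : ℝ) ≤ z' := by exact_mod_cast h3
    dsimp only [g]
    gcongr
  have hsub : executionTimes K M N Q s V cm cs cr ⊆ g '' Set.univ := by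
    rintro _ ⟨S, rfl⟩
    exact ⟨(univ.sup fun k => (S.mapped k).card, ∑ k, S.len k,
      univ.sup fun k => (S.reduceSet k).card), trivial, rfl⟩
  have hwf : (executionTimes K M N Q s V cm cs cr).IsWF :=
    (((Set.isPWO_of_wellQuasiOrderedLE Set.univ).image_of_monotone hg).mono hsub).isWF
  obtain ⟨S⟩ := exists_scheme (Q := Q) (V := V) hNM hs hsK
  have hne : (executionTimes K M N Q s V cm cs cr).Nonempty := ⟨_, S, rfl⟩
  exact ⟨hwf.min hne, hwf.min_mem hne, fun x hx => hwf.min_le hne hx⟩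

theorem theorem1 (K : ℕ) :
    ∃ D : ℕ, 0 < D ∧
      ∀ (M N Q s : ℕ) (cm cs cr : ℝ),
        0 < N → N ≤ M → 1 ≤ s → s ≤ K → s ≤ Q → 0 < cm → 0 < cs → 0 < cr →
        ∃ τ : ℝ,
          IsLeast (allocationTimes K M N Q s cm cs cr) τ ∧
          (∃ t₀ : ℕ, 0 < t₀ ∧ ∀ t : ℕ, 0 < t → t₀ ∣ t → ∀ V : ℕ, 0 < V → D ∣ V →
            IsLeast (executionTimes K (t * M) (t * N) Q s V cm cs cr) τ) ∧
          ∀ V : ℕ, 0 < V → ∃ Tstar : ℝ,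
            IsLeast (executionTimes K M N Q s V cm cs cr) Tstar ∧
            τ ≤ Tstar ∧
            (D ∣ V →
              Tstar ≤ τ + D * (cm + cs) / N ∧
              (∀ a : Allocation, a.Feasible K M N Q s → a.Integral N →
                a.time Q s cm cs cr ∈ executionTimes K M N Q s V cm cs cr) ∧
              ((∃ a : Allocation, a.Feasible K M N Q s ∧ a.Integral N ∧
                a.time Q s cm cs cr = τ) → Tstar = τ)) := by
  -- the first factor splits the intermediate values into the pieces needed by the codes, and the
  -- second one bounds the number of leftover files
  set D := K.factorial * ((K + 1) * 2 ^ K) with hD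
  have hDV (V : ℕ) (h : D ∣ V) (r : ℕ) (h1 : 1 ≤ r) (h2 : r ≤ K) : r * (K + 1) ∣ V :=
    (mul_dvd_mul (Nat.dvd_factorial h1 h2) (Dvd.intro _ rfl)).trans h
  have hDle : (K + 1) * 2 ^ K ≤ D := Nat.le_mul_of_pos_left _ K.factorial_pos
  refine ⟨D, by positivity, fun M N Q s cm cs cr hN hNM hs hsK hsQ hcm hcs hcr => ?_⟩
  have hQ : 0 < Q := by omega
  have hN' : (0 : ℝ) < N := by exact_mod_cast hN
  obtain ⟨Ks, Kh, q, hadm, hq, hτ, hmin⟩ :=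
    exists_isLeast_allocationTimes (cm := cm) cr hN hNM hs hsK hsQ hcs.le
  set τ := mixtureTime Ks Kh Q s cm cs cr fun j => q j
  have hlower (t V : ℕ) (ht : 0 < t) (hV : 0 < V) :
      τ ∈ lowerBounds (executionTimes K (t * M) (t * N) Q s V cm cs cr) := by
    rintro _ ⟨S, rfl⟩
    obtain ⟨h1, h2⟩ := S.exists_mixture (cr := cr) (Nat.mul_pos ht hN) hV hs hsQ hcm.le hcs.le
    have h3 : ((t * M : ℕ) : ℝ) / (t * N : ℕ) = M / N := by
      push_cast
      exact mul_div_mul_left _ _ (by positivity)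
    rw [h3] at h1
    exact (hmin _ _ _ (S.admissible hs hsQ) h1).trans h2
  refine ⟨τ, hτ, ?_, fun V hV => ?_⟩
  · obtain ⟨t₀, ht₀, h⟩ := hq.exists_scheme_mul hadm hN hQ hs cr hcm.le hcs.le
    refine ⟨t₀, ht₀, fun t ht htdvd V hV hDdvd => ⟨?_, hlower t V ht hV⟩⟩
    obtain ⟨S, hS⟩ := h t ht htdvd V hV (hDV V hDdvd)
    exact ⟨S, hS.antisymm (hlower t V ht hV ⟨S, rfl⟩)⟩
  · obtain ⟨T, hT⟩ := exists_isLeast_executionTimes (Q := Q) (V := V) hNM hs hsK hcm.le hcs.le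
      hcr.le
    have hτT : τ ≤ T := by
      have := hlower 1 V one_pos hV
      rw [one_mul, one_mul] at this
      exact this hT.1
    refine ⟨T, hT, hτT, fun hDdvd => ?_⟩
    have hint (a : Allocation) (ha : a.Feasible K M N Q s) (hai : a.Integral N) :
        a.time Q s cm cs cr ∈ executionTimes K M N Q s V cm cs cr :=
      ha.time_mem_executionTimes hai (hDV V hDdvd) hV hN hQ hs cs cr hcm.le
    refine ⟨?_, hint, ?_⟩
    · obtain ⟨S, hS⟩ := hq.exists_scheme hadm (hDV V hDdvd) hV hN hQ hs cr hcm.le hcs.le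
      refine (hT.2 ⟨S, rfl⟩).trans (hS.trans ?_)
      gcongr
    · rintro ⟨a, ha, hai, e⟩
      exact le_antisymm (e ▸ hT.2 (hint a ha hai)) hτT
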